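/- Let $\Lambda\subset\mathbb{R}^2$ be a discrete subgroup and let $M$ be a bounded domain in the flat surface $\mathbb{R}^2/\Lambda$ (the plane, a periodic strip, or a flat torus), possibly containing boundary points: $M$ is bounded, its interior is nonempty and connected, $M$ is contained in the closure of its interior, and $M$ minus its interior has zero area. Examples are bounded planar domains with smooth boundary such as the disk, the channel $\mathbb{T}\times[0,1]$, and the torus $\mathbb{T}^2$. Write $dx$ for the area measure on $M$ and $$X=\{\omega\in L^\infty(M):\ \|\omega\|_{L^\infty(M)}\le 1\}.$$ Let $\mathscr{D}_\mu(M)$ be the group of area-preserving $C^\infty$ diffeomorphisms of $M$ that can be joined to the identity by a smooth path of area-preserving diffeomorphisms. For $\omega_0\in X$ let $\mathcal{O}_{\omega_0}=\{\omega_0\circ\varphi:\ \varphi\in\mathscr{D}_\mu(M)\}$, and let $\overline{\mathcal{O}_{\omega_0}}^{*}$ be its closure in $L^\infty(M)$ for the weak-$*$ topology (duality with $L^1(M)$). Let $\mathscr{K}$ be the set of bistochastic operators (polymorphisms) of $M$: measurable families $K=(K(x,dy))_{x\in M}$ of probability measures on $M$ such that $\int_M K(x,B)\,dx=|B|$ for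 every measurable $B\subseteq M$; they act by $(K\omega)(x)=\int_M\omega(y)\,K(x,dy)$. Then, for every $\omega_0\in X$, $$\begin{aligned}\overline{\mathcal{O}_{\omega_0}}^{*}&=\{\omega\in X:\ \omega=K\omega_0\ \text{ a.e. for some } K\in\mathscr{K}\}\\ &=\Big\{\omega\in X:\ \int_M\omega\,dx=\int_M\omega_0\,dx\ \text{ and }\ \int_M(\omega-c)_+\,dx\le\int_M(\omega_0-c)_+\,dx\ \text{ for all } c\in\mathbb{R}\Big\}\\ &=\Big\{\omega\in X:\ \int_M\omega\,dx=\int_M\omega_0\,dx\ \text{ and }\ \int_M f(\omega)\,dx\le\int_M f(\omega_0)\,dx\ \text{ for all convex } f:\mathbb{R}\to\mathbb{R}\Big\}.\end{aligned}$$ -/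

import Mathlib

open MeasureTheory ProbabilityTheory Set Filter Topology

namespace FlatFluid

/-- The Euclidean plane. -/
abbrev Plane : Type := EuclideanSpace ℝ (Fin 2)

/-- The flat surface `ℝ² / Λ`. For a discrete `Λ` this is the plane (`Λ = 0`), a periodic
strip `𝕋 × ℝ` (rank one) or a flat torus (rank two). It carries the quotient topology and the
quotient σ-algebra. -/
abbrev Surface (Λ : AddSubgroup Plane) : Type := Plane ⧸ Λ

/-- The covering map `ℝ² → ℝ² / Λ`. -/
def proj (Λ : AddSubgroup Plane) (x : Plane) : Surface Λ := (x : Plane ⧸ Λ)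

/-- The open Dirichlet cell of `Λ` at the origin. Its translates by `Λ` are disjoint and cover
the plane up to a null set; for `Λ = 0` it is the whole plane. -/
def dirichletCell (Λ : AddSubgroup Plane) : Set Plane :=
  {x | ∀ v ∈ Λ, v ≠ 0 → ‖x‖ < ‖x - v‖}

/-- The area measure of `ℝ² / Λ`: Lebesgue measure on a fundamental cell, pushed to the quotient. -/
noncomputable def area (Λ : AddSubgroup Plane) : Measure (Surface Λ) :=
  (volume.restrict (dirichletCell Λ)).map (proj Λ)

/-- A bounded domain of `ℝ² / Λ`, with none, some or all of its boundary points, the boundary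
points that belong to it having zero area. -/
structure IsBoundedDomain {Λ : AddSubgroup Plane} (M : Set (Surface Λ)) : Prop where
  bounded : ∃ R : ℝ, M ⊆ proj Λ '' Metric.ball 0 R
  connected : IsConnected (interior M)
  subset_closure : M ⊆ closure (interior M)
  boundary_null : area Λ (M \ interior M) = 0

/-- The area measure on `M`, i.e. `dx` on `M`. -/
noncomputable def areaOn {Λ : AddSubgroup Plane} (M : Set (Surface Λ)) : Measure (Surface Λ) :=
  (area Λ).restrict M

section Diffeomorphisms

variable {Λ : AddSubgroup Plane}

/-- `f` is a `C^∞` map on `M` (up to the boundary points that belong to `M`): near every point it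
has a lift to the plane that is `C^∞`. -/
def SmoothOn (M : Set (Surface Λ)) (f : Surface Λ → Surface Λ) : Prop :=
  ∀ x : Plane, proj Λ x ∈ M → ∃ F : Plane → Plane,
    ContDiffWithinAt ℝ (⊤ : ℕ∞) F (proj Λ ⁻¹' M) x ∧
    ∀ᶠ y in 𝓝[proj Λ ⁻¹' M] x, proj Λ (F y) = f (proj Λ y)

/-- `(t, x) ↦ Φ t x` is jointly `C^∞` on `[0, 1] × M`. -/
def SmoothFamilyOn (M : Set (Surface Λ)) (Φ : ℝ → Surface Λ → Surface Λ) : Prop :=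
  ∀ t ∈ Icc (0 : ℝ) 1, ∀ x : Plane, proj Λ x ∈ M → ∃ F : ℝ × Plane → Plane,
    ContDiffWithinAt ℝ (⊤ : ℕ∞) F (Icc (0 : ℝ) 1 ×ˢ (proj Λ ⁻¹' M)) (t, x) ∧
    ∀ᶠ p in 𝓝[Icc (0 : ℝ) 1 ×ˢ (proj Λ ⁻¹' M)] (t, x), proj Λ (F p) = Φ p.1 (proj Λ p.2)

/-- `φ` restricts to an area-preserving `C^∞` diffeomorphism of `M`; its values outside `M` are
irrelevant. -/
def IsAreaPreservingDiffeo (M : Set (Surface Λ)) (φ : Surface Λ → Surface Λ) : Prop :=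
  (∃ ψ : Surface Λ → Surface Λ, MapsTo φ M M ∧ MapsTo ψ M M ∧ InvOn ψ φ M M ∧
    SmoothOn M φ ∧ SmoothOn M ψ) ∧
  ∀ B : Set (Surface Λ), MeasurableSet B → area Λ (M ∩ φ ⁻¹' B) = area Λ (M ∩ B)

/-- The area-preserving diffeomorphisms of `M` in the component of the identity: those joined to
the identity by a smooth path of area-preserving diffeomorphisms of `M`. -/
def areaPreservingDiffeos (M : Set (Surface Λ)) : Set (Surface Λ → Surface Λ) :=
  {φ | ∃ Φ : ℝ → Surface Λ → Surface Λ, SmoothFamilyOn M Φ ∧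
    (∀ t ∈ Icc (0 : ℝ) 1, IsAreaPreservingDiffeo M (Φ t)) ∧
    EqOn (Φ 0) id M ∧ EqOn (Φ 1) φ M}

end Diffeomorphisms

section Vorticity

variable {Λ : AddSubgroup Plane}

/-- `L^∞(M)`. -/
abbrev LInfty (M : Set (Surface Λ)) : Type := Lp ℝ ⊤ (areaOn M)

/-- The phase space `X`, the closed unit ball of `L^∞(M)`. -/
def phaseSpace (M : Set (Surface Λ)) : Set (LInfty M) := {ω | ‖ω‖ ≤ 1}

/-- The orbit of `ω₀`: all `ω₀ ∘ φ`. -/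
def orbit (M : Set (Surface Λ)) (ω₀ : LInfty M) : Set (LInfty M) :=
  {ω | ∃ φ ∈ areaPreservingDiffeos M, ω =ᵐ[areaOn M] fun x => ω₀ (φ x)}

/-- The weak-* topology of `L^∞(M)`: the coarsest one for which `ω ↦ ∫_M g ω dx` is continuous
for every `g ∈ L¹(M)`. -/
noncomputable abbrev weakStar (M : Set (Surface Λ)) : TopologicalSpace (LInfty M) :=
  TopologicalSpace.induced
    (fun (ω : LInfty M) (g : Lp ℝ 1 (areaOn M)) => ∫ x, g x * ω x ∂(areaOn M)) inferInstance

/-- The weak-* closure of a subset of `L^∞(M)`. -/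
noncomputable def weakStarClosure (M : Set (Surface Λ)) (A : Set (LInfty M)) : Set (LInfty M) :=
  @closure (LInfty M) (weakStar M) A

/-- `K` is bistochastic on `M`. The measure `K x` plays the role of `K(x, y) dy`: it is
nonnegative of total mass one, and integrating over `x ∈ M` gives back the area measure `dy`
of `M`. -/
def IsBistochastic (M : Set (Surface Λ)) (K : Kernel (Surface Λ) (Surface Λ)) : Prop :=
  IsMarkovKernel K ∧ K.Invariant (areaOn M)

end Vorticity

end FlatFluid

/-! The inclusions form a cycle: the weak-* closure of the orbit lies in the bistochastic images of
`ω₀`, these satisfy all convex inequalities, these include the inequalities for `max (x - c) 0`, and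
any field satisfying the latter is a weak-* limit of the orbit.

The first inclusion is compactness. The graph measure of an area-preserving map is a coupling of the
normalized area with itself; such couplings are tight, and disintegrating a limit coupling gives the
kernel (`exists_invariant_kernel_of_tendsto`). The second is Jensen's inequality
(`integral_convex_kernel_le`).

The last inclusion (`mem_weakStarClosure_of_majorized`) carries the weight. Only finitely many test
functions and a positive error matter, so `ω₀` and the test functions may be replaced by step
functions on a grid. The cell averages of `ω` are then majorized, up to an error, by the cell values
of `ω₀`. A quantitative Hardy-Littlewood-Pólya argument puts them near a convex combination of
permutations of those values (`exists_weights_close`). A convex combination is realized weakly by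
mixing: each cell is cut into `n²` pieces, and the pieces with the same relative position are
permuted among the cells, each permutation being used with a frequency close to its weight.

It remains to imitate permutations of small squares by area-preserving isotopies, up to small area.
The elementary move is the half-turn of a rectangle: a radial twist of the disc, carried to the
rectangle by a map of constant Jacobian, is a half-turn outside a thin collar and is supported in a
compact set (`exists_rect_twist`). Four half-turns exchange two squares in one row
(`isIsotopyLimit_swapMap_axis`). Connectedness of the interior together with conjugation of
transpositions exchanges any two small squares (`eventually_isIsotopyLimit_swapMap`), and
transpositions generate all permutations. -/

namespace FlatFluid

/-! ### Radial twists of the disc, and the one-variable function behind the map from disc to square.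
-/

section SquareTwist

/-- The linear endomorphism of `ℝ × ℝ` with rows `(a, b)` and `(c, d)`. -/
noncomputable def matCLM (a b c d : ℝ) : ℝ × ℝ →L[ℝ] ℝ × ℝ :=
  (a • ContinuousLinearMap.fst ℝ ℝ ℝ + b • ContinuousLinearMap.snd ℝ ℝ ℝ).prod
    (c • ContinuousLinearMap.fst ℝ ℝ ℝ + d • ContinuousLinearMap.snd ℝ ℝ ℝ)

lemma det_matCLM (a b c d : ℝ) : (matCLM a b c d).det = a * d - b * c := by
  have h : matCLM a b c d = LinearMap.toContinuousLinearMap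
      (Matrix.toLin (Module.Basis.finTwoProd ℝ) (Module.Basis.finTwoProd ℝ) !![a, b; c, d]) := by
    rw [Matrix.toLin_finTwoProd_toContinuousLinearMap]
    rfl
  rw [h, LinearMap.det_toContinuousLinearMap, LinearMap.det_toLin, Matrix.det_fin_two_of]

/-- Rotation of the point `z` by the angle `α`. -/
noncomputable def rot (α : ℝ) (z : ℝ × ℝ) : ℝ × ℝ :=
  (Real.cos α * z.1 - Real.sin α * z.2, Real.sin α * z.1 + Real.cos α * z.2)

/-- The squared Euclidean norm on `ℝ × ℝ`. -/
def sqNorm (z : ℝ × ℝ) : ℝ := z.1 ^ 2 + z.2 ^ 2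

lemma sqNorm_rot (α : ℝ) (z : ℝ × ℝ) : sqNorm (rot α z) = sqNorm z := by
  have := Real.sin_sq_add_cos_sq α
  simp only [sqNorm, rot]
  linear_combination (z.1 ^ 2 + z.2 ^ 2) * this

lemma rot_rot_neg (α : ℝ) (z : ℝ × ℝ) : rot α (rot (-α) z) = z := by
  have := Real.sin_sq_add_cos_sq α
  ext
  · simp only [rot, Real.cos_neg, Real.sin_neg]
    linear_combination z.1 * this
  · simp only [rot, Real.cos_neg, Real.sin_neg]
    linear_combination z.2 * this

lemma rot_zero (z : ℝ × ℝ) : rot 0 z = z := by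
  ext <;> simp [rot]

lemma rot_pi (z : ℝ × ℝ) : rot Real.pi z = -z := by
  ext <;> simp [rot]

/-- The twist map that rotates each circle about the origin, the angle being a function of the
squared radius. -/
noncomputable def twist (θ : ℝ → ℝ) (z : ℝ × ℝ) : ℝ × ℝ := rot (θ (sqNorm z)) z

lemma hasFDerivAt_sqNorm (z : ℝ × ℝ) : HasFDerivAt sqNorm
    ((2 * z.1) • ContinuousLinearMap.fst ℝ ℝ ℝ + (2 * z.2) • ContinuousLinearMap.snd ℝ ℝ ℝ) z := by
  have h := (hasFDerivAt_fst (𝕜 := ℝ) (p := z)).pow 2 |>.add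
    ((hasFDerivAt_snd (𝕜 := ℝ) (p := z)).pow 2)
  refine h.congr_fderiv ?_
  ext <;> simp

/-- In polar coordinates the twist is the shear `(r, α) ↦ (r, α + θ (r²))`, so the terms containing
the derivative of `θ` cancel in the Jacobian. -/
lemma exists_hasFDerivAt_twist {θ : ℝ → ℝ} (hθ : Differentiable ℝ θ) (z : ℝ × ℝ) :
    ∃ L : ℝ × ℝ →L[ℝ] ℝ × ℝ, HasFDerivAt (twist θ) L z ∧ L.det = 1 := by
  set q := deriv θ (sqNorm z)
  have h0 : HasFDerivAt (fun w => θ (sqNorm w)) (q • ((2 * z.1) • ContinuousLinearMap.fst ℝ ℝ ℝ +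
      (2 * z.2) • ContinuousLinearMap.snd ℝ ℝ ℝ)) z :=
    (hθ (sqNorm z)).hasDerivAt.comp_hasFDerivAt z (hasFDerivAt_sqNorm z)
  have hc := h0.cos
  have hs := h0.sin
  have h1 := hasFDerivAt_fst (𝕜 := ℝ) (p := z)
  have h2 := hasFDerivAt_snd (𝕜 := ℝ) (p := z)
  have hX := (hc.mul h1).sub (hs.mul h2)
  have hY := (hs.mul h1).add (hc.mul h2)
  set c := Real.cos (θ (sqNorm z))
  set s := Real.sin (θ (sqNorm z))
  have hcs : s ^ 2 + c ^ 2 = 1 := Real.sin_sq_add_cos_sq _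
  refine ⟨matCLM (c - 2 * q * z.1 * (s * z.1 + c * z.2)) (-s - 2 * q * z.2 * (s * z.1 + c * z.2))
    (s + 2 * q * z.1 * (c * z.1 - s * z.2)) (c + 2 * q * z.2 * (c * z.1 - s * z.2)), ?_, ?_⟩
  · have := hX.prodMk hY
    refine this.congr_fderiv ?_
    ext <;> simp [matCLM] <;> ring
  · rw [det_matCLM]
    linear_combination hcs

lemma twist_twist_neg (θ : ℝ → ℝ) (z : ℝ × ℝ) : twist θ (twist (fun s => - θ s) z) = z := by
  simp only [twist, sqNorm_rot, rot_rot_neg]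

/-- The area `∫₀ˣ √(1 - s²) ds`. -/
noncomputable def discArea (x : ℝ) : ℝ := (x * √(1 - x ^ 2) + Real.arcsin x) / 2

lemma one_sub_sq_pos {x : ℝ} (hx : x ∈ Ioo (-1 : ℝ) 1) : 0 < 1 - x ^ 2 := by
  nlinarith [hx.1, hx.2]

lemma hasDerivAt_discArea {x : ℝ} (hx : x ∈ Ioo (-1 : ℝ) 1) :
    HasDerivAt discArea (√(1 - x ^ 2)) x := by
  have hp := one_sub_sq_pos hx
  have h1 : HasDerivAt (fun x : ℝ => 1 - x ^ 2) (-(2 * x)) x := by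
    simpa using ((hasDerivAt_id x).pow 2).const_sub 1
  have h2 := h1.sqrt hp.ne'
  have h3 := Real.hasDerivAt_arcsin (x := x) (by linarith [hx.1]) (by linarith [hx.2])
  have h4 := (((hasDerivAt_id x).mul h2).add h3).div_const 2
  refine h4.congr_deriv ?_
  have hs : √(1 - x ^ 2) ≠ 0 := (Real.sqrt_pos.2 hp).ne'
  have hss := Real.sq_sqrt hp.le
  simp only [id]
  field_simp
  linear_combination (-1 : ℝ) * hss

lemma continuous_discArea : Continuous discArea := by
  unfold discArea
  have := Real.continuous_arcsin
  fun_prop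

lemma strictMonoOn_discArea : StrictMonoOn discArea (Icc (-1) 1) := by
  refine strictMonoOn_of_deriv_pos (convex_Icc _ _) continuous_discArea.continuousOn ?_
  intro x hx
  rw [interior_Icc] at hx
  rw [(hasDerivAt_discArea hx).deriv]
  exact Real.sqrt_pos.2 (one_sub_sq_pos hx)

lemma contDiffAt_discArea {x : ℝ} (hx : x ∈ Ioo (-1 : ℝ) 1) :
    ContDiffAt ℝ (⊤ : ℕ∞) discArea x := by
  have h1 : ContDiffAt ℝ (⊤ : ℕ∞) (fun x : ℝ => 1 - x ^ 2) x := by fun_prop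
  have h2 := h1.sqrt (one_sub_sq_pos hx).ne'
  have h3 : ContDiffAt ℝ (⊤ : ℕ∞) Real.arcsin x :=
    Real.contDiffAt_arcsin (by linarith [hx.1]) (by linarith [hx.2])
  exact ((contDiffAt_id.mul h2).add h3).div_const 2

lemma discArea_one : discArea 1 = Real.pi / 4 := by
  simp [discArea]; ring

lemma discArea_neg_one : discArea (-1) = -(Real.pi / 4) := by
  simp [discArea]; ring

lemma discArea_image : discArea '' Ioo (-1) 1 = Ioo (-(Real.pi / 4)) (Real.pi / 4) := by
  rw [← discArea_neg_one, ← discArea_one]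
  refine Subset.antisymm ?_ (intermediate_value_Ioo (by norm_num) continuous_discArea.continuousOn)
  rintro _ ⟨x, hx, rfl⟩
  exact ⟨strictMonoOn_discArea (by simp) (Ioo_subset_Icc_self hx) hx.1,
    strictMonoOn_discArea (Ioo_subset_Icc_self hx) (by simp) hx.2⟩

/-- Strict monotonicity gives one global inverse; since the derivative `√(1 - x²)` vanishes only at
the endpoints, it agrees near each interior value with the smooth local inverse of the inverse
function theorem. -/
lemma exists_smooth_inverse_discArea : ∃ g : ℝ → ℝ, (∀ x ∈ Ioo (-1 : ℝ) 1, g (discArea x) = x) ∧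
    (∀ y ∈ Ioo (-(Real.pi / 4)) (Real.pi / 4), g y ∈ Ioo (-1 : ℝ) 1 ∧ discArea (g y) = y ∧
      ContDiffAt ℝ (⊤ : ℕ∞) g y) := by
  have hinj : InjOn discArea (Ioo (-1) 1) :=
    strictMonoOn_discArea.injOn.mono Ioo_subset_Icc_self
  refine ⟨Function.invFunOn discArea (Ioo (-1) 1), fun x hx => hinj.leftInvOn_invFunOn hx, ?_⟩
  intro y hy
  rw [← discArea_image] at hy
  refine ⟨Function.invFunOn_mem hy, Function.invFunOn_eq hy, ?_⟩
  obtain ⟨x, hx, rfl⟩ := hy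
  have hd : √(1 - x ^ 2) ≠ 0 := (Real.sqrt_pos.2 (one_sub_sq_pos hx)).ne'
  have hf := contDiffAt_discArea hx
  set f' : ℝ ≃L[ℝ] ℝ := ContinuousLinearEquiv.unitsEquivAut ℝ (Units.mk0 _ hd)
  have hf' : HasFDerivAt discArea (f' : ℝ →L[ℝ] ℝ) x := by
    refine (hasDerivAt_discArea hx).hasFDerivAt.congr_fderiv ?_
    ext
    simp [f']
  have hn : ((⊤ : ℕ∞) : WithTop ℕ∞) ≠ 0 := by simp
  have hli := hf.to_localInverse hf' hn
  refine hli.congr_of_eventuallyEq ?_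
  have hcont := hli.continuousAt
  have hst := hf.hasStrictFDerivAt' hf' hn
  have hval : hf.localInverse hf' hn (discArea x) = x := hf.localInverse_apply_image hf' hn
  have h1 : ∀ᶠ y in 𝓝 (discArea x), hf.localInverse hf' hn y ∈ Ioo (-1 : ℝ) 1 := by
    apply hcont.eventually_mem
    rw [hval]
    exact isOpen_Ioo.mem_nhds hx
  have h2 : ∀ᶠ y in 𝓝 (discArea x), discArea (hf.localInverse hf' hn y) = y :=
    hst.eventually_right_inverse
  filter_upwards [h1, h2] with y hy1 hy2
  conv_lhs => rw [← hy2]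
  exact hinj.leftInvOn_invFunOn hy1

end SquareTwist

/-! ### An area-preserving isotopy of the square ending close to the half-turn. -/

section SquareTwistFamily

/-- The open square `(-1, 1)²`. -/
def openSquare : Set (ℝ × ℝ) := Ioo (-1) 1 ×ˢ Ioo (-1) 1

/-- The open unit disc of `ℝ × ℝ`. -/
def openDisc : Set (ℝ × ℝ) := {z | sqNorm z < 1}

lemma continuous_sqNorm : Continuous sqNorm := by
  unfold sqNorm; fun_prop

lemma isOpen_openDisc : IsOpen openDisc := isOpen_lt continuous_sqNorm continuous_const

lemma isOpen_openSquare : IsOpen openSquare := isOpen_Ioo.prod isOpen_Ioo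

/-- The map of the open unit disc onto the open square with constant Jacobian. -/
noncomputable def discToSquare (z : ℝ × ℝ) : ℝ × ℝ :=
  (4 / Real.pi * discArea z.1, z.2 / √(1 - z.1 ^ 2))

lemma fst_mem_of_mem_openDisc {z : ℝ × ℝ} (hz : z ∈ openDisc) : z.1 ∈ Ioo (-1 : ℝ) 1 := by
  have h : z.1 ^ 2 + z.2 ^ 2 < 1 := hz
  constructor <;> nlinarith [sq_nonneg z.2]

lemma discToSquare_mem {z : ℝ × ℝ} (hz : z ∈ openDisc) : discToSquare z ∈ openSquare := by
  have hx := fst_mem_of_mem_openDisc hz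
  have hp := one_sub_sq_pos hx
  have hs := Real.sqrt_pos.2 hp
  have hss := Real.sq_sqrt hp.le
  have hpi := Real.pi_pos
  have h : z.1 ^ 2 + z.2 ^ 2 < 1 := hz
  have hX : discArea z.1 ∈ Ioo (-(Real.pi / 4)) (Real.pi / 4) :=
    discArea_image ▸ mem_image_of_mem _ hx
  have hy : |z.2| < √(1 - z.1 ^ 2) := by
    rw [← Real.sqrt_sq_eq_abs]
    exact Real.sqrt_lt_sqrt (sq_nonneg _) (by linarith)
  rw [abs_lt] at hy
  refine ⟨⟨?_, ?_⟩, ⟨?_, ?_⟩⟩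
  · have : 4 / Real.pi * (-(Real.pi / 4)) = -1 := by field_simp
    rw [← this]
    exact mul_lt_mul_of_pos_left hX.1 (by positivity)
  · have : 4 / Real.pi * (Real.pi / 4) = 1 := by field_simp
    rw [← this]
    exact mul_lt_mul_of_pos_left hX.2 (by positivity)
  · simp only [discToSquare]
    rw [lt_div_iff₀ hs]; linarith
  · simp only [discToSquare]
    rw [div_lt_iff₀ hs]; linarith

lemma contDiffAt_discToSquare {z : ℝ × ℝ} (hz : z ∈ openDisc) :
    ContDiffAt ℝ (⊤ : ℕ∞) discToSquare z := by
  have hx := fst_mem_of_mem_openDisc hz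
  have hp := one_sub_sq_pos hx
  have h1 : ContDiffAt ℝ (⊤ : ℕ∞) (fun z : ℝ × ℝ => discArea z.1) z :=
    (contDiffAt_discArea hx).comp z contDiffAt_fst
  have h2 : ContDiffAt ℝ (⊤ : ℕ∞) (fun z : ℝ × ℝ => 1 - z.1 ^ 2) z := by fun_prop
  exact (contDiffAt_const.mul h1).prodMk
    (contDiffAt_snd.div (h2.sqrt hp.ne') (Real.sqrt_pos.2 hp).ne')

lemma measurable_discToSquare : Measurable discToSquare := by
  unfold discToSquare
  have := continuous_discArea.measurable
  fun_prop

/-- The derivative is triangular with diagonal entries `4 / π * √(1 - x²)` and its complement `1 /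
√(1 - x²)`. The off-diagonal entry does not enter the determinant and can stay an unevaluated
`deriv`. -/
lemma exists_hasFDerivAt_discToSquare {z : ℝ × ℝ} (hz : z ∈ openDisc) :
    ∃ L : ℝ × ℝ →L[ℝ] ℝ × ℝ, HasFDerivAt discToSquare L z ∧ L.det = 4 / Real.pi := by
  have hx := fst_mem_of_mem_openDisc hz
  have hp := one_sub_sq_pos hx
  have hs := (Real.sqrt_pos.2 hp).ne'
  have h1 : HasFDerivAt (fun z : ℝ × ℝ => discArea z.1)
      (√(1 - z.1 ^ 2) • ContinuousLinearMap.fst ℝ ℝ ℝ) z :=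
    (hasDerivAt_discArea hx).comp_hasFDerivAt z hasFDerivAt_fst
  have hd : DifferentiableAt ℝ (fun x : ℝ => (√(1 - x ^ 2))⁻¹) z.1 := by
    refine DifferentiableAt.inv (DifferentiableAt.sqrt (by fun_prop) hp.ne') hs
  have h2 : HasFDerivAt (fun z : ℝ × ℝ => (√(1 - z.1 ^ 2))⁻¹)
      (deriv (fun x : ℝ => (√(1 - x ^ 2))⁻¹) z.1 • ContinuousLinearMap.fst ℝ ℝ ℝ) z :=
    hd.hasDerivAt.comp_hasFDerivAt z hasFDerivAt_fst
  have h3 := (h1.const_mul (4 / Real.pi)).prodMk ((hasFDerivAt_snd (p := z)).mul h2)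
  refine ⟨matCLM (4 / Real.pi * √(1 - z.1 ^ 2)) 0
    (z.2 * deriv (fun x : ℝ => (√(1 - x ^ 2))⁻¹) z.1) (√(1 - z.1 ^ 2))⁻¹, ?_, ?_⟩
  · have h4 : HasFDerivAt discToSquare _ z := h3
    refine h4.congr_fderiv ?_
    ext <;> simp [matCLM]
  · rw [det_matCLM]
    field_simp
    ring

lemma exists_inverse_discToSquare : ∃ Φ : ℝ × ℝ → ℝ × ℝ,
    (∀ z ∈ openDisc, Φ (discToSquare z) = z) ∧
    ∀ w ∈ openSquare, Φ w ∈ openDisc ∧ discToSquare (Φ w) = w ∧ ContDiffAt ℝ (⊤ : ℕ∞) Φ w := by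
  obtain ⟨g, hg1, hg2⟩ := exists_smooth_inverse_discArea
  have hpi := Real.pi_pos
  refine ⟨fun w => (g (Real.pi / 4 * w.1), w.2 * √(1 - g (Real.pi / 4 * w.1) ^ 2)), ?_, ?_⟩
  · intro z hz
    have hx := fst_mem_of_mem_openDisc hz
    have hs := (Real.sqrt_pos.2 (one_sub_sq_pos hx)).ne'
    have : Real.pi / 4 * (4 / Real.pi * discArea z.1) = discArea z.1 := by field_simp
    simp only [discToSquare, this, hg1 _ hx]
    ext
    · rfl
    · simp only; field_simp
  · rintro w ⟨⟨h1, h2⟩, ⟨h3, h4⟩⟩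
    have hw : Real.pi / 4 * w.1 ∈ Ioo (-(Real.pi / 4)) (Real.pi / 4) := by
      constructor <;> nlinarith
    obtain ⟨ha, hb, hc⟩ := hg2 _ hw
    have hp := one_sub_sq_pos ha
    have hs := (Real.sqrt_pos.2 hp).ne'
    refine ⟨?_, ?_, ?_⟩
    · change g (Real.pi / 4 * w.1) ^ 2 + (w.2 * √(1 - g (Real.pi / 4 * w.1) ^ 2)) ^ 2 < 1
      rw [mul_pow, Real.sq_sqrt hp.le]
      have h5 : w.2 ^ 2 < 1 := by nlinarith
      nlinarith [mul_pos (sub_pos.2 h5) hp]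
    · simp only [discToSquare, hb]
      ext
      · simp only; field_simp
      · simp only; exact mul_div_cancel_right₀ _ hs
    · have h5 : ContDiffAt ℝ (⊤ : ℕ∞) (fun w : ℝ × ℝ => g (Real.pi / 4 * w.1)) w := by
        refine ContDiffAt.comp w (g := g) (f := fun w : ℝ × ℝ => Real.pi / 4 * w.1) hc ?_
        fun_prop
      refine h5.prodMk (contDiffAt_snd.mul (ContDiffAt.sqrt ?_ hp.ne'))
      exact contDiffAt_const.sub (h5.pow 2)

lemma volume_image_of_det {s : Set (ℝ × ℝ)} (hs : MeasurableSet s) {f : ℝ × ℝ → ℝ × ℝ} {c : ℝ}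
    (hf : ∀ z ∈ s, ∃ L : ℝ × ℝ →L[ℝ] ℝ × ℝ, HasFDerivAt f L z ∧ L.det = c) (hinj : InjOn f s) :
    volume (f '' s) = ENNReal.ofReal |c| * volume s := by
  have h1 : ∀ z ∈ s, HasFDerivWithinAt f (fderiv ℝ f z) s z := by
    intro z hz
    obtain ⟨L, hL, -⟩ := hf z hz
    rw [hL.fderiv]
    exact hL.hasFDerivWithinAt
  rw [← lintegral_abs_det_fderiv_eq_addHaar_image volume hs h1 hinj,
    setLIntegral_congr_fun (g := fun _ => ENNReal.ofReal |c|) hs, setLIntegral_const]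
  intro z hz
  obtain ⟨L, hL, hd⟩ := hf z hz
  simp only [hL.fderiv, hd]

lemma volume_image_discToSquare {s : Set (ℝ × ℝ)} (hs : MeasurableSet s) (hsD : s ⊆ openDisc) :
    volume (discToSquare '' s) = ENNReal.ofReal |4 / Real.pi| * volume s := by
  obtain ⟨Φ, hΦ, -⟩ := exists_inverse_discToSquare
  refine volume_image_of_det hs (fun z hz => exists_hasFDerivAt_discToSquare (hsD hz)) ?_
  intro a ha b hb hab
  rw [← hΦ a (hsD ha), hab, hΦ b (hsD hb)]

lemma bijective_twist (θ : ℝ → ℝ) : Function.Bijective (twist θ) := by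
  refine ⟨Function.LeftInverse.injective (g := twist (fun s => -θ s)) ?_,
    Function.RightInverse.surjective (g := twist (fun s => -θ s)) (twist_twist_neg θ)⟩
  intro z
  have := twist_twist_neg (fun s => -θ s) z
  simpa using this

lemma volume_image_twist {θ : ℝ → ℝ} (hθ : Differentiable ℝ θ) {s : Set (ℝ × ℝ)}
    (hs : MeasurableSet s) : volume (twist θ '' s) = volume s := by
  rw [volume_image_of_det hs (fun z _ => exists_hasFDerivAt_twist hθ z)
    (bijective_twist θ).1.injOn]
  simp

/-- The rotation angle: `π` up to squared radius `a`, and `0` from squared radius `b` on. -/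
noncomputable def cutoffAngle (a b s : ℝ) : ℝ :=
  Real.pi * Real.smoothTransition ((b - s) / (b - a))

lemma contDiff_cutoffAngle (a b : ℝ) : ContDiff ℝ (⊤ : ℕ∞) (cutoffAngle a b) := by
  refine contDiff_const.mul (Real.smoothTransition.contDiff.comp ?_)
  fun_prop

lemma cutoffAngle_of_le {a b s : ℝ} (hab : a < b) (hs : s ≤ a) : cutoffAngle a b s = Real.pi := by
  rw [cutoffAngle, Real.smoothTransition.one_of_one_le, mul_one]
  rw [le_div_iff₀ (by linarith)]; linarith

lemma cutoffAngle_of_ge {a b s : ℝ} (hab : a < b) (hs : b ≤ s) : cutoffAngle a b s = 0 := by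
  rw [cutoffAngle, Real.smoothTransition.zero_of_nonpos, mul_zero]
  exact div_nonpos_of_nonpos_of_nonneg (by linarith) (by linarith)

lemma contDiff_twist_family {θ : ℝ → ℝ} (hθ : ContDiff ℝ (⊤ : ℕ∞) θ) :
    ContDiff ℝ (⊤ : ℕ∞) (fun q : ℝ × (ℝ × ℝ) => twist (fun s => q.1 * θ s) q.2) := by
  have h1 : ContDiff ℝ (⊤ : ℕ∞) (fun q : ℝ × (ℝ × ℝ) => q.1 * θ (sqNorm q.2)) := by
    refine contDiff_fst.mul (hθ.comp ?_)
    unfold sqNorm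
    fun_prop
  unfold twist rot
  have h2 := h1.cos
  have h3 := h1.sin
  fun_prop

/-- Oddness is what turns the rotation of the disc by `π` into the point reflection of the square.
-/
lemma discToSquare_neg (z : ℝ × ℝ) : discToSquare (-z) = - discToSquare z := by
  ext
  · simp [discToSquare, discArea, Real.arcsin_neg]; ring
  · simp [discToSquare, neg_div]

/-- The annuli decrease to the empty set inside a set of finite area. The factor `4 / π` is the
Jacobian of `discToSquare`, so the bound is one for the image in the square. -/
lemma exists_thin_annulus {ε : ENNReal} (hε : 0 < ε) : ∃ a < (1 : ℝ),
    ENNReal.ofReal |4 / Real.pi| * volume {z | a ≤ sqNorm z ∧ sqNorm z < 1} ≤ ε := by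
  have hlim : Tendsto (fun n : ℕ => volume {z | 1 - 1 / ((n : ℝ) + 1) ≤ sqNorm z ∧ sqNorm z < 1})
      atTop (𝓝 (volume (⋂ n : ℕ, {z | 1 - 1 / ((n : ℝ) + 1) ≤ sqNorm z ∧ sqNorm z < 1}))) := by
    refine tendsto_measure_iInter_atTop ?_ ?_ ⟨0, ?_⟩
    · intro n
      exact ((measurableSet_le measurable_const continuous_sqNorm.measurable).inter
        (measurableSet_lt continuous_sqNorm.measurable measurable_const)).nullMeasurableSet
    · intro m n hmn z hz
      refine ⟨le_trans ?_ hz.1, hz.2⟩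
      have : (m : ℝ) ≤ n := by exact_mod_cast hmn
      gcongr
    · have : {z : ℝ × ℝ | 1 - 1 / (((0 : ℕ) : ℝ) + 1) ≤ sqNorm z ∧ sqNorm z < 1} ⊆
          Icc (-1) 1 ×ˢ Icc (-1) 1 := by
        rintro z ⟨-, hz⟩
        have h : z.1 ^ 2 + z.2 ^ 2 < 1 := hz
        refine ⟨⟨?_, ?_⟩, ⟨?_, ?_⟩⟩ <;> nlinarith [sq_nonneg z.1, sq_nonneg z.2]
      exact ((measure_mono this).trans_lt (isCompact_Icc.prod isCompact_Icc).measure_lt_top).ne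
  have hempty : (⋂ n : ℕ, {z | 1 - 1 / ((n : ℝ) + 1) ≤ sqNorm z ∧ sqNorm z < 1}) = ∅ := by
    rw [eq_empty_iff_forall_notMem]
    intro z hz
    rw [mem_iInter] at hz
    have h1 : sqNorm z < 1 := (hz 0).2
    obtain ⟨n, hn⟩ := exists_nat_one_div_lt (sub_pos.2 h1)
    have := (hz n).1
    linarith
  rw [hempty, measure_empty] at hlim
  have hlim2 := ENNReal.Tendsto.const_mul (a := ENNReal.ofReal |4 / Real.pi|) hlim
    (Or.inr ENNReal.ofReal_ne_top)
  rw [mul_zero] at hlim2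
  obtain ⟨n, hn⟩ := ((tendsto_order.1 hlim2).2 ε hε).exists
  exact ⟨1 - 1 / ((n : ℝ) + 1), by have : (0 : ℝ) < 1 / ((n : ℝ) + 1) := by positivity
                                   linarith, hn.le⟩

set_option maxHeartbeats 800000 in
open Classical in
-- The twist of the disc is conjugated by `discToSquare`. Its angle is `t * π` up to squared radius
-- `a` and zero from squared radius `b` on, with `a < b < 1`, so the support stays away from the
-- boundary and the time-one map fails to be `-z` only over the annulus.
lemma exists_square_twist {ε : ENNReal} (hε : 0 < ε) :
    ∃ (T : ℝ → ℝ × ℝ → ℝ × ℝ) (K : Set (ℝ × ℝ)), IsCompact K ∧ K ⊆ openSquare ∧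
      ContDiff ℝ (⊤ : ℕ∞) (fun q : ℝ × (ℝ × ℝ) => T q.1 q.2) ∧
      (∀ t, ∀ z ∉ K, T t z = z) ∧ (∀ t z, T t (T (-t) z) = z) ∧ (∀ z, T 0 z = z) ∧
      (∀ t, MeasurePreserving (T t) volume volume) ∧
      volume {z ∈ openSquare | T 1 z ≠ -z} ≤ ε := by
  obtain ⟨Φ, hΦ1, hΦ2⟩ := exists_inverse_discToSquare
  obtain ⟨a, ha1, ha⟩ := exists_thin_annulus hε
  obtain ⟨b, hab, hb1⟩ := exists_between ha1
  set θ := cutoffAngle a b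
  have hθ : ContDiff ℝ (⊤ : ℕ∞) θ := contDiff_cutoffAngle a b
  set τ : ℝ → ℝ × ℝ → ℝ × ℝ := fun t => twist (fun s => t * θ s) with hτ
  have hτD : ∀ t z, z ∈ openDisc → τ t z ∈ openDisc := fun t z hz => by
    change sqNorm _ < 1
    rw [hτ]; simp only [twist, sqNorm_rot]; exact hz
  have hτinv : ∀ t z, τ t (τ (-t) z) = z := fun t z => by
    have := twist_twist_neg (fun s => t * θ s) z
    simpa [hτ] using this
  set T : ℝ → ℝ × ℝ → ℝ × ℝ := fun t w =>
    if w ∈ openSquare then discToSquare (τ t (Φ w)) else w with hT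
  have hTin : ∀ t w, w ∈ openSquare → T t w = discToSquare (τ t (Φ w)) := fun t w hw => by
    simp [hT, hw]
  have hTout : ∀ t w, w ∉ openSquare → T t w = w := fun t w hw => by
    simp [hT, hw]
  set K : Set (ℝ × ℝ) := discToSquare '' {z | sqNorm z ≤ b} with hK
  have hbD : {z | sqNorm z ≤ b} ⊆ openDisc := fun z hz => lt_of_le_of_lt hz hb1
  have hKcomp : IsCompact K := by
    refine IsCompact.image_of_continuousOn ?_
      fun z hz => (contDiffAt_discToSquare (hbD hz)).continuousAt.continuousWithinAt
    refine IsCompact.of_isClosed_subset (isCompact_Icc.prod isCompact_Icc :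
      IsCompact (Icc (-1 : ℝ) 1 ×ˢ Icc (-1 : ℝ) 1))
      (isClosed_le continuous_sqNorm continuous_const) ?_
    intro z hz
    have h : z.1 ^ 2 + z.2 ^ 2 < 1 := hbD hz
    refine ⟨⟨?_, ?_⟩, ⟨?_, ?_⟩⟩ <;> nlinarith [sq_nonneg z.1, sq_nonneg z.2]
  have hKS : K ⊆ openSquare := by
    rintro _ ⟨z, hz, rfl⟩
    exact discToSquare_mem (hbD hz)
  have hTK : ∀ t, ∀ z ∉ K, T t z = z := by
    intro t w hw
    by_cases hwS : w ∈ openSquare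
    · rw [hTin t w hwS]
      obtain ⟨h1, h2, -⟩ := hΦ2 w hwS
      have h3 : b ≤ sqNorm (Φ w) := by
        by_contra! hlt
        exact hw ⟨Φ w, hlt.le, h2⟩
      have : τ t (Φ w) = Φ w := by
        simp only [hτ, twist]
        rw [show θ (sqNorm (Φ w)) = 0 from cutoffAngle_of_ge hab h3, mul_zero, rot_zero]
      rw [this, h2]
    · exact hTout t w hwS
  have hTS : ∀ t w, w ∈ openSquare → T t w ∈ openSquare := fun t w hw => by
    rw [hTin t w hw]
    exact discToSquare_mem (hτD t _ (hΦ2 w hw).1)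
  have hTinv : ∀ t z, T t (T (-t) z) = z := by
    intro t w
    by_cases hwS : w ∈ openSquare
    · rw [hTin t _ (hTS _ _ hwS), hTin _ w hwS, hΦ1 _ (hτD _ _ (hΦ2 w hwS).1), hτinv,
        (hΦ2 w hwS).2.1]
    · rw [hTout (-t) w hwS, hTout t w hwS]
  have hcd : ContDiff ℝ (⊤ : ℕ∞) (fun q : ℝ × (ℝ × ℝ) => T q.1 q.2) := by
    -- Two open sets cover the plane: the open square, where the conjugation formula is smooth, and
    -- the complement of `K`, where the map is the identity.
    rw [contDiff_iff_contDiffAt]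
    rintro ⟨t, w⟩
    by_cases hw : w ∈ K
    · have hwS := hKS hw
      have h1 : ContDiffAt ℝ (⊤ : ℕ∞)
          (fun q : ℝ × (ℝ × ℝ) => discToSquare (τ q.1 (Φ q.2))) (t, w) := by
        have h2 : ContDiffAt ℝ (⊤ : ℕ∞) (fun q : ℝ × (ℝ × ℝ) => τ q.1 (Φ q.2)) (t, w) := by
          refine ContDiffAt.comp (t, w) (g := fun q : ℝ × (ℝ × ℝ) => τ q.1 q.2)
            (f := fun q : ℝ × (ℝ × ℝ) => (q.1, Φ q.2)) (contDiff_twist_family hθ).contDiffAt ?_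
          exact contDiffAt_fst.prodMk
            (ContDiffAt.comp (t, w) (g := Φ) (hΦ2 w hwS).2.2 contDiffAt_snd)
        exact ContDiffAt.comp (t, w) (g := discToSquare)
          (contDiffAt_discToSquare (hτD _ _ (hΦ2 w hwS).1)) h2
      refine h1.congr_of_eventuallyEq ?_
      have : ∀ᶠ q : ℝ × (ℝ × ℝ) in 𝓝 (t, w), q.2 ∈ openSquare :=
        continuous_snd.continuousAt.eventually_mem (isOpen_openSquare.mem_nhds hwS)
      filter_upwards [this] with q hq
      exact hTin _ _ hq
    · have h1 : ContDiffAt ℝ (⊤ : ℕ∞) (fun q : ℝ × (ℝ × ℝ) => q.2) (t, w) := contDiffAt_snd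
      refine h1.congr_of_eventuallyEq ?_
      have : ∀ᶠ q : ℝ × (ℝ × ℝ) in 𝓝 (t, w), q.2 ∈ Kᶜ :=
        continuous_snd.continuousAt.eventually_mem (hKcomp.isClosed.isOpen_compl.mem_nhds hw)
      filter_upwards [this] with q hq
      exact hTK _ _ hq
  have hTcont : ∀ t, Continuous (T t) := fun t =>
    hcd.continuous.comp (Continuous.prodMk_right t)
  refine ⟨T, K, hKcomp, hKS, hcd, hTK, hTinv, ?_, ?_, ?_⟩
  · intro w
    by_cases hwS : w ∈ openSquare
    · rw [hTin _ _ hwS]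
      simp only [hτ, twist, zero_mul, rot_zero]
      exact (hΦ2 w hwS).2.1
    · exact hTout _ _ hwS
  · intro t
    refine ⟨(hTcont t).measurable, ?_⟩
    ext B hB
    rw [Measure.map_apply (hTcont t).measurable hB]
    have hinv' : ∀ z, T (-t) (T t z) = z := fun z => by simpa using hTinv (-t) z
    rw [← measure_inter_add_sdiff _ isOpen_openSquare.measurableSet,
      ← measure_inter_add_sdiff B isOpen_openSquare.measurableSet]
    congr 1
    -- Within the square, `B` and its preimage are the images under `discToSquare` of `A` and of a
    -- twist of `A`. Both areas acquire the same constant factor, and the twist preserves area.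
    · set A := openDisc ∩ discToSquare ⁻¹' B with hA
      have hAm : MeasurableSet A :=
        isOpen_openDisc.measurableSet.inter (measurable_discToSquare hB)
      have hAD : A ⊆ openDisc := inter_subset_left
      have e1 : B ∩ openSquare = discToSquare '' A := by
        ext w
        constructor
        · rintro ⟨hw1, hw2⟩
          exact ⟨Φ w, ⟨(hΦ2 w hw2).1, by rw [mem_preimage, (hΦ2 w hw2).2.1]; exact hw1⟩,
            (hΦ2 w hw2).2.1⟩
        · rintro ⟨z, hz, rfl⟩
          exact ⟨hz.2, discToSquare_mem hz.1⟩
      have e2 : T t ⁻¹' B ∩ openSquare = discToSquare '' (τ (-t) '' A) := by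
        ext w
        constructor
        · rintro ⟨hw1, hw2⟩
          refine ⟨Φ w, ⟨τ t (Φ w), ⟨hτD _ _ (hΦ2 w hw2).1, ?_⟩, ?_⟩, (hΦ2 w hw2).2.1⟩
          · rw [mem_preimage, ← hTin t w hw2]; exact hw1
          · simpa using hτinv (-t) (Φ w)
        · rintro ⟨_, ⟨z, hz, rfl⟩, rfl⟩
          have hS := discToSquare_mem (hτD (-t) z hz.1)
          refine ⟨?_, hS⟩
          rw [mem_preimage, hTin t _ hS, hΦ1 _ (hτD (-t) z hz.1), hτinv]
          exact hz.2
      have hτA : MeasurableSet (τ (-t) '' A) := by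
        have : τ (-t) '' A = τ t ⁻¹' A := by
          refine congrFun (image_eq_preimage_of_inverse ?_ ?_) A
          · intro z; exact hτinv t z
          · intro z; simpa using hτinv (-t) z
        rw [this]
        have hc : Continuous (τ t) :=
          (contDiff_twist_family hθ).continuous.comp (Continuous.prodMk_right t)
        exact hc.measurable hAm
      have hτAD : τ (-t) '' A ⊆ openDisc := by
        rintro _ ⟨z, hz, rfl⟩
        exact hτD _ _ hz.1
      rw [e1, e2, volume_image_discToSquare hτA hτAD, volume_image_discToSquare hAm hAD,
        volume_image_twist _ hAm]
      exact (contDiff_const.mul hθ).differentiable (by simp)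
    · congr 1
      ext w
      constructor
      · rintro ⟨h1, h2⟩
        rw [mem_preimage, hTout t w h2] at h1
        exact ⟨h1, h2⟩
      · rintro ⟨h1, h2⟩
        refine ⟨?_, h2⟩
        rw [mem_preimage, hTout t w h2]
        exact h1
  · refine le_trans (measure_mono (t := discToSquare '' {z | a ≤ sqNorm z ∧ sqNorm z < 1}) ?_) ?_
    · rintro w ⟨hw, hne⟩
      obtain ⟨h1, h2, -⟩ := hΦ2 w hw
      refine ⟨Φ w, ⟨?_, h1⟩, h2⟩
      by_contra! hlt
      apply hne
      rw [hTin _ _ hw]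
      simp only [hτ, twist, one_mul]
      rw [show θ (sqNorm (Φ w)) = Real.pi from cutoffAngle_of_le hab hlt.le, rot_pi,
        discToSquare_neg, h2]
    · rw [volume_image_discToSquare _ (fun z hz => hz.2)]
      · exact ha
      · exact (measurableSet_le measurable_const continuous_sqNorm.measurable).inter
          (measurableSet_lt continuous_sqNorm.measurable measurable_const)

end SquareTwistFamily

/-! ### Transport of the isotopy to arbitrary rectangles. -/

section RectTwist

/-- The open rectangle with lower left corner `p` and side lengths `d`. -/
def rect (p d : Plane) : Set Plane := {x | ∀ i, p i < x i ∧ x i < p i + d i}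

lemma isOpen_rect (p d : Plane) : IsOpen (rect p d) := by
  have h : rect p d = ⋂ i, {x : Plane | p i < x i ∧ x i < p i + d i} := by
    ext x; simp [rect]
  rw [h]
  refine isOpen_iInter_of_finite fun i => IsOpen.inter ?_ ?_
  · exact isOpen_lt continuous_const (PiLp.continuous_apply 2 _ i)
  · exact isOpen_lt (PiLp.continuous_apply 2 _ i) continuous_const

/-- The linear isomorphism `ℝ × ℝ → ℝ²` that scales the coordinates by the halves of `d`. -/
noncomputable def halfScale (d : Plane) (hd : ∀ i, 0 < d i) : (ℝ × ℝ) ≃L[ℝ] Plane :=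
  LinearEquiv.toContinuousLinearEquiv
    { toFun := fun z => !₂[d 0 / 2 * z.1, d 1 / 2 * z.2]
      invFun := fun x => (2 / d 0 * x 0, 2 / d 1 * x 1)
      map_add' := fun z w => by ext i; fin_cases i <;> simp <;> ring
      map_smul' := fun c z => by ext i; fin_cases i <;> simp <;> ring
      left_inv := fun z => by
        have h0 := (hd 0).ne'
        have h1 := (hd 1).ne'
        ext <;> simp <;> field_simp
      right_inv := fun x => by
        have h0 := (hd 0).ne'
        have h1 := (hd 1).ne'
        ext i; fin_cases i <;> simp <;> field_simp }

lemma halfScale_apply_zero (d : Plane) (hd : ∀ i, 0 < d i) (z : ℝ × ℝ) :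
    halfScale d hd z 0 = d 0 / 2 * z.1 := rfl

lemma halfScale_apply_one (d : Plane) (hd : ∀ i, 0 < d i) (z : ℝ × ℝ) :
    halfScale d hd z 1 = d 1 / 2 * z.2 := rfl

lemma halfScale_mem_rect_iff (p d : Plane) (hd : ∀ i, 0 < d i) (z : ℝ × ℝ) :
    p + (1 / 2 : ℝ) • d + halfScale d hd z ∈ rect p d ↔ z ∈ openSquare := by
  have h0 := hd 0
  have h1 := hd 1
  simp only [rect, mem_ofPred_eq, Fin.forall_fin_two, PiLp.add_apply, PiLp.smul_apply,
    halfScale_apply_zero, halfScale_apply_one, openSquare, mem_prod, mem_Ioo, smul_eq_mul]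
  constructor
  · rintro ⟨⟨a1, a2⟩, a3, a4⟩
    refine ⟨⟨?_, ?_⟩, ?_, ?_⟩ <;> nlinarith
  · rintro ⟨⟨a1, a2⟩, a3, a4⟩
    refine ⟨⟨?_, ?_⟩, ?_, ?_⟩ <;> nlinarith

lemma exists_rect_twist (p d : Plane) (hd : ∀ i, 0 < d i) {ε : ENNReal} (hε : 0 < ε) :
    ∃ (T : ℝ → Plane → Plane) (K : Set Plane), IsCompact K ∧ K ⊆ rect p d ∧
      ContDiff ℝ (⊤ : ℕ∞) (fun q : ℝ × Plane => T q.1 q.2) ∧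
      (∀ t, ∀ z ∉ K, T t z = z) ∧ (∀ t z, T t (T (-t) z) = z) ∧ (∀ z, T 0 z = z) ∧
      (∀ t, MeasurePreserving (T t) volume volume) ∧
      volume {z ∈ rect p d | T 1 z ≠ p + p + d - z} ≤ ε := by
  set L := halfScale d hd
  set c : Plane := p + (1 / 2 : ℝ) • d with hc
  set m : Measure Plane := (volume : Measure (ℝ × ℝ)).map L with hm
  have hmhaar : m.IsAddHaarMeasure := L.isAddHaarMeasure_map volume
  -- The area factor of `L` is never computed: uniqueness of Haar measure provides it as `κ`, and
  -- the tolerance `ε / κ` for the square absorbs it.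
  obtain ⟨κ, hκ⟩ : ∃ κ : NNReal, (volume : Measure Plane) = κ • m :=
    ⟨_, Measure.isAddLeftInvariant_eq_smul volume m⟩
  have hLmp : MeasurePreserving L volume m := ⟨L.continuous.measurable, rfl⟩
  have hLinv : MeasurePreserving L.symm m volume := by
    refine ⟨L.symm.continuous.measurable, ?_⟩
    rw [hm, Measure.map_map L.symm.continuous.measurable L.continuous.measurable]
    have : L.symm ∘ L = id := funext fun z => L.symm_apply_apply z
    rw [this, Measure.map_id]
  obtain ⟨T, K, hK, hKs, hcd, hTK, hTinv, hT0, hTmp, hT1⟩ :=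
    exists_square_twist (ε := ε / κ) (ENNReal.div_pos hε.ne' ENNReal.coe_ne_top)
  have hmem : ∀ x, x ∈ rect p d ↔ L.symm (x - c) ∈ openSquare := by
    intro x
    rw [← halfScale_mem_rect_iff p d hd]
    have : p + (1 / 2 : ℝ) • d + halfScale d hd (L.symm (x - c)) = x := by
      change c + L (L.symm (x - c)) = x
      simp
    rw [this]
  refine ⟨fun t x => c + L (T t (L.symm (x - c))), (fun z => c + L z) '' K,
    hK.image (by fun_prop), ?_, ?_, ?_, ?_, ?_, ?_, ?_⟩
  · rintro _ ⟨z, hz, rfl⟩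
    exact (halfScale_mem_rect_iff p d hd z).2 (hKs hz)
  · have h1 : ContDiff ℝ (⊤ : ℕ∞) (fun q : ℝ × Plane => (q.1, L.symm (q.2 - c))) :=
      contDiff_fst.prodMk (L.symm.contDiff.comp (contDiff_snd.sub contDiff_const))
    exact contDiff_const.add (L.contDiff.comp (hcd.comp h1))
  · intro t x hx
    have : L.symm (x - c) ∉ K := fun h => hx ⟨_, h, by simp⟩
    simp only [hTK t _ this]
    simp
  · intro t x
    simp [hTinv]
  · intro x
    simp [hT0]
  · intro t
    have h1 : MeasurePreserving (fun x => L (T t (L.symm x))) m m :=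
      hLmp.comp ((hTmp t).comp hLinv)
    have h2 : MeasurePreserving (fun x => L (T t (L.symm x))) volume volume := by
      rw [hκ]
      exact h1.smul_measure κ
    exact (measurePreserving_add_left volume c).comp
      (h2.comp (measurePreserving_sub_right volume c))
  · have h2 : volume {z ∈ rect p d | c + L (T 1 (L.symm (z - c))) ≠ p + p + d - z} ≤
        κ * (ε / κ) := by
      set B := {z ∈ openSquare | T 1 z ≠ -z} with hB
      have hBm : MeasurableSet B := by
        have : Continuous (T 1) := hcd.continuous.comp (Continuous.prodMk_right 1)
        exact isOpen_openSquare.measurableSet.inter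
          (measurableSet_eq_fun this.measurable measurable_neg).compl
      have h3 : {z ∈ rect p d | c + L (T 1 (L.symm (z - c))) ≠ p + p + d - z} ⊆
          (fun x => x - c) ⁻¹' (L.symm ⁻¹' B) := by
        rintro x ⟨hx1, hx2⟩
        refine ⟨(hmem x).1 hx1, fun h => hx2 ?_⟩
        have h4 : p + p + d = c + c := by rw [hc]; module
        rw [h, map_neg, ContinuousLinearEquiv.apply_symm_apply, h4]
        beta_reduce
        abel
      refine (measure_mono h3).trans ?_
      rw [(measurePreserving_sub_right volume c).measure_preimage
        (L.symm.continuous.measurable hBm).nullMeasurableSet, hκ, Measure.smul_apply,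
        hLinv.measure_preimage hBm.nullMeasurableSet, ENNReal.smul_def, smul_eq_mul]
      gcongr
    exact h2.trans ENNReal.mul_div_le

end RectTwist

/-! ### The covering map, the Dirichlet cell and the area of the quotient. -/

section SurfaceBasics

open scoped Pointwise

variable {Λ : AddSubgroup Plane}

lemma continuous_proj : Continuous (proj Λ) := continuous_quot_mk

lemma isOpenMap_proj : IsOpenMap (proj Λ) := QuotientAddGroup.isOpenMap_coe

lemma measurable_proj : Measurable (proj Λ) := measurable_quot_mk

lemma surjective_proj : Function.Surjective (proj Λ) := Quotient.mk_surjective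

lemma proj_eq_iff {x y : Plane} : proj Λ x = proj Λ y ↔ x - y ∈ Λ := by
  unfold proj
  rw [eq_comm, QuotientAddGroup.eq, neg_add_eq_sub]

lemma proj_add_of_mem {v : Plane} (hv : v ∈ Λ) (x : Plane) : proj Λ (x + v) = proj Λ x := by
  rw [proj_eq_iff]; simpa using hv

lemma measurableSet_surface_iff {B : Set (Surface Λ)} :
    MeasurableSet B ↔ MeasurableSet (proj Λ ⁻¹' B) := Iff.rfl

lemma preimage_image_proj (E : Set Plane) : proj Λ ⁻¹' (proj Λ '' E) = ⋃ v : Λ, v +ᵥ E := by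
  ext x
  simp only [mem_preimage, mem_image, mem_iUnion, mem_vadd_set]
  constructor
  · rintro ⟨y, hy, hxy⟩
    refine ⟨⟨x - y, proj_eq_iff.1 hxy.symm⟩, y, hy, ?_⟩
    change x - y + y = x
    abel
  · rintro ⟨v, y, hy, rfl⟩
    refine ⟨y, hy, ?_⟩
    change proj Λ y = proj Λ ((v : Plane) + y)
    rw [add_comm, proj_add_of_mem v.2]

/-- Two distinct points of the cell differing by a lattice vector would each be strictly shorter
than the other. -/
lemma injOn_proj_dirichletCell : InjOn (proj Λ) (dirichletCell Λ) := by
  intro x hx y hy hxy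
  by_contra hne
  have h := proj_eq_iff.1 hxy
  have h1 := hx _ h (sub_ne_zero.2 hne)
  have h2 := hy _ (neg_mem h) (neg_ne_zero.2 (sub_ne_zero.2 hne))
  simp only [sub_sub_cancel] at h1
  simp only [sub_neg_eq_add, add_sub_cancel] at h2
  linarith

lemma area_apply {B : Set (Surface Λ)} (hB : MeasurableSet B) :
    area Λ B = volume (proj Λ ⁻¹' B ∩ dirichletCell Λ) := by
  rw [area, Measure.map_apply measurable_proj hB, Measure.restrict_apply (measurable_proj hB)]

variable [DiscreteTopology Λ]

lemma countable_lattice : Countable Λ :=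
  TopologicalSpace.separableSpace_iff_countable.1 inferInstance

lemma finite_lattice_inter (R : ℝ) : {v : Plane | v ∈ Λ ∧ ‖v‖ ≤ R}.Finite := by
  have hc : IsClosed (Λ : Set Plane) := inferInstance
  have h : IsCompact (Metric.closedBall (0 : Plane) R ∩ Λ) :=
    (isCompact_closedBall 0 R).inter_right hc
  have hd : IsDiscrete (Metric.closedBall (0 : Plane) R ∩ Λ) := by
    have : IsDiscrete (Λ : Set Plane) := ⟨inferInstanceAs (DiscreteTopology Λ)⟩
    exact this.mono inter_subset_right
  refine (h.finite hd).subset ?_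
  rintro v ⟨h1, h2⟩
  exact ⟨by simpa using h2, h1⟩

/-- Within distance one of `x`, lattice vectors longer than `2 * (‖x‖ + 1)` satisfy the condition
automatically by the triangle inequality, so locally only finitely many open conditions remain. -/
lemma isOpen_dirichletCell : IsOpen (dirichletCell Λ) := by
  rw [isOpen_iff_mem_nhds]
  intro x hx
  set F := {v : Plane | v ∈ Λ ∧ ‖v‖ ≤ 2 * (‖x‖ + 1)} with hF
  have hfin : F.Finite := finite_lattice_inter _
  have h1 : ∀ᶠ y in 𝓝 x, ∀ v ∈ F, v ≠ 0 → ‖y‖ < ‖y - v‖ := by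
    rw [hfin.eventually_all]
    intro v hv
    by_cases hv0 : v = 0
    · simp [hv0]
    · have : IsOpen {y : Plane | ‖y‖ < ‖y - v‖} := isOpen_lt (by fun_prop) (by fun_prop)
      filter_upwards [this.mem_nhds (hx v hv.1 hv0)] with y hy _
      exact hy
  filter_upwards [h1, Metric.ball_mem_nhds x one_pos] with y hy hyx v hv hv0
  by_cases hvF : ‖v‖ ≤ 2 * (‖x‖ + 1)
  · exact hy v ⟨hv, hvF⟩ hv0
  · have h2 : ‖y‖ < ‖x‖ + 1 := by
      have := norm_sub_norm_le y x
      rw [mem_ball_iff_norm] at hyx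
      linarith
    have h3 := norm_sub_norm_le v y
    rw [norm_sub_rev] at h3
    push Not at hvF
    linarith

lemma volume_setOf_norm_sub_eq {a b : Plane} (hab : a ≠ b) :
    volume {x : Plane | ‖x - a‖ = ‖x - b‖} = 0 := by
  have h : {x : Plane | ‖x - a‖ = ‖x - b‖} = (AffineSubspace.perpBisector a b : Set Plane) := by
    ext x
    simp [AffineSubspace.mem_perpBisector_iff_dist_eq, dist_eq_norm]
  rw [h]
  refine Measure.addHaar_affineSubspace volume _ ?_
  rwa [Ne, AffineSubspace.perpBisector_eq_top]

lemma exists_nearest_lattice (x : Plane) : ∃ v ∈ Λ, ∀ w ∈ Λ, ‖x - v‖ ≤ ‖x - w‖ := by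
  have hne : {v : Plane | v ∈ Λ ∧ ‖v‖ ≤ 2 * ‖x‖}.Nonempty := ⟨0, Λ.zero_mem, by simp⟩
  obtain ⟨v, hv, hmin⟩ := (finite_lattice_inter (Λ := Λ) (2 * ‖x‖)).exists_minimalFor
    (fun v => ‖x - v‖) _ hne
  refine ⟨v, hv.1, fun w hw => ?_⟩
  by_cases hw2 : ‖w‖ ≤ 2 * ‖x‖
  · by_contra! hlt
    exact absurd (hmin ⟨hw, hw2⟩ hlt.le) (not_le.2 hlt)
  · have h0 : ‖x - v‖ ≤ ‖x - 0‖ := by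
      by_contra! hlt
      exact absurd (hmin ⟨Λ.zero_mem, by simp⟩ hlt.le) (not_le.2 hlt)
    have := norm_sub_norm_le w x
    rw [norm_sub_rev] at this
    rw [sub_zero] at h0
    linarith

/-- Subtracting a nearest lattice vector moves a point into the cell unless two lattice points are
equidistant from it. The exceptional points lie on countably many perpendicular bisectors, hence
form a null set. -/
lemma isAddFundamentalDomain_dirichletCell :
    IsAddFundamentalDomain Λ (dirichletCell Λ) (volume : Measure Plane) := by
  have := countable_lattice (Λ := Λ)
  refine IsAddFundamentalDomain.mk'' isOpen_dirichletCell.measurableSet.nullMeasurableSet ?_ ?_ ?_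
  · have h : ∀ᵐ x : Plane, ∀ a b : Λ, a ≠ b → ‖x - a‖ ≠ ‖x - b‖ := by
      rw [ae_all_iff]; intro a
      rw [ae_all_iff]; intro b
      by_cases hab : a = b
      · simp [hab]
      · have := volume_setOf_norm_sub_eq (a := (a : Plane)) (b := b) (by simpa using hab)
        filter_upwards [measure_eq_zero_iff_ae_notMem.1 this] with x hx _
        exact hx
    filter_upwards [h] with x hx
    obtain ⟨v, hv, hmin⟩ := exists_nearest_lattice (Λ := Λ) x
    refine ⟨⟨-v, neg_mem hv⟩, ?_⟩
    change -v + x ∈ dirichletCell Λ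
    intro w hw hw0
    rw [neg_add_eq_sub, sub_sub]
    refine lt_of_le_of_ne (hmin _ (add_mem hv hw)) ?_
    exact hx ⟨v, hv⟩ ⟨v + w, add_mem hv hw⟩ (by simpa using hw0)
  · intro g hg
    refine Disjoint.aedisjoint ?_
    rw [Set.disjoint_left]
    rintro _ ⟨y, hy, rfl⟩ hx
    have h1 : proj Λ ((g : Plane) + y) = proj Λ y := by rw [add_comm, proj_add_of_mem g.2]
    have := injOn_proj_dirichletCell hx hy h1
    have h2 : (g : Plane) + y = y := this
    exact hg (Subtype.ext (by simpa using h2))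
  · intro g
    exact (measurePreserving_vadd g volume).quasiMeasurePreserving

lemma measurableSet_image_proj {E : Set Plane} (hE : MeasurableSet E) :
    MeasurableSet (proj Λ '' E) := by
  have := countable_lattice (Λ := Λ)
  rw [measurableSet_surface_iff, preimage_image_proj]
  exact MeasurableSet.iUnion fun v => hE.const_vadd v

/-- Area may be measured on any set that projects injectively: the fundamental domain cuts `E` into
pieces whose translates are disjoint in the cell. All later computations of area on the surface are
thereby done in the plane. -/
lemma area_image_proj {E : Set Plane} (hE : MeasurableSet E) (hinj : InjOn (proj Λ) E) :
    area Λ (proj Λ '' E) = volume E := by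
  have := countable_lattice (Λ := Λ)
  rw [area_apply (measurableSet_image_proj hE), preimage_image_proj, iUnion_inter, measure_iUnion,
    (isAddFundamentalDomain_dirichletCell (Λ := Λ)).measure_eq_tsum E]
  · intro v w hvw
    refine Disjoint.mono inter_subset_left inter_subset_left ?_
    rw [Set.disjoint_left]
    rintro _ ⟨y, hy, rfl⟩ ⟨z, hz, hyz⟩
    change (w : Plane) + z = v + y at hyz
    have h1 : proj Λ z = proj Λ y := by
      rw [← proj_add_of_mem w.2 z, ← proj_add_of_mem v.2 y, add_comm z, hyz, add_comm y]
    have h2 := hinj hz hy h1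
    rw [h2] at hyz
    exact hvw (Subtype.ext (add_right_cancel hyz)).symm
  · intro v
    exact (hE.const_vadd v).inter isOpen_dirichletCell.measurableSet

lemma area_inter_image_proj {E : Set Plane} (hE : MeasurableSet E) (hinj : InjOn (proj Λ) E)
    {B : Set (Surface Λ)} (hB : MeasurableSet B) :
    area Λ (B ∩ proj Λ '' E) = volume (proj Λ ⁻¹' B ∩ E) := by
  rw [← image_preimage_inter, area_image_proj ((measurable_proj hB).inter hE)
    (hinj.mono inter_subset_right)]

end SurfaceBasics

/-! ### Maps of the surface induced by maps of an injectively projected plane set. -/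

section PushMap

variable {Λ : AddSubgroup Plane}

open Classical in
/-- The map of the surface that moves the points over `E` according to `T` and fixes all
others. -/
noncomputable def pushMap (Λ : AddSubgroup Plane) (E : Set Plane) (T : Plane → Plane)
    (q : Surface Λ) : Surface Λ :=
  if h : ∃ x ∈ E, proj Λ x = q then proj Λ (T h.choose) else q

lemma pushMap_proj {E : Set Plane} (hinj : InjOn (proj Λ) E) (T : Plane → Plane) {x : Plane}
    (hx : x ∈ E) : pushMap Λ E T (proj Λ x) = proj Λ (T x) := by
  have h : ∃ y ∈ E, proj Λ y = proj Λ x := ⟨x, hx, rfl⟩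
  rw [pushMap, dif_pos h, hinj h.choose_spec.1 hx h.choose_spec.2]

lemma pushMap_of_notMem {E : Set Plane} (T : Plane → Plane) {q : Surface Λ}
    (hq : q ∉ proj Λ '' E) : pushMap Λ E T q = q := by
  rw [pushMap, dif_neg]
  rintro ⟨x, hx, h⟩
  exact hq ⟨x, hx, h⟩

end PushMap

/-! ### Area-preserving isotopies supported in the interior, and their limits in measure. -/

section Isotopies

variable {Λ : AddSubgroup Plane}

/-- `(t, q) ↦ Φ t q` is jointly smooth on the whole surface. -/
def SmoothFamily (Φ : ℝ → Surface Λ → Surface Λ) : Prop :=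
  ∀ (t : ℝ) (x : Plane), ∃ F : ℝ × Plane → Plane, ContDiffAt ℝ (⊤ : ℕ∞) F (t, x) ∧
    ∀ᶠ p in 𝓝 (t, x), proj Λ (F p) = Φ p.1 (proj Λ p.2)

lemma SmoothFamily.comp {Φ Ψ : ℝ → Surface Λ → Surface Λ} (hΦ : SmoothFamily Φ)
    (hΨ : SmoothFamily Ψ) : SmoothFamily (fun t q => Φ t (Ψ t q)) := by
  intro t x
  obtain ⟨G, hG, hG2⟩ := hΨ t x
  obtain ⟨F, hF, hF2⟩ := hΦ t (G (t, x))
  have hc : ContDiffAt ℝ (⊤ : ℕ∞) (fun p : ℝ × Plane => (p.1, G p)) (t, x) :=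
    contDiffAt_fst.prodMk hG
  refine ⟨fun p => F (p.1, G p), ContDiffAt.comp (t, x) (g := F) hF hc, ?_⟩
  have h1 : ∀ᶠ p in 𝓝 (t, x), proj Λ (F (p.1, G p)) = Φ p.1 (proj Λ (G p)) :=
    hc.continuousAt.eventually hF2
  filter_upwards [h1, hG2] with p hp1 hp2
  rw [hp1, hp2]

lemma SmoothFamily.continuous {Φ : ℝ → Surface Λ → Surface Λ} (hΦ : SmoothFamily Φ) (t : ℝ) :
    Continuous (Φ t) := by
  rw [(isOpenMap_proj.isQuotientMap continuous_proj surjective_proj).continuous_iff,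
    continuous_iff_continuousAt]
  intro x
  obtain ⟨F, hF, hF2⟩ := hΦ t x
  have hi : ContinuousAt (fun y : Plane => (t, y)) x :=
    (Continuous.prodMk_right t).continuousAt
  have h1 : ContinuousAt (fun y => proj Λ (F (t, y))) x :=
    continuous_proj.continuousAt.comp (ContinuousAt.comp (g := F) hF.continuousAt hi)
  refine h1.congr ?_
  exact hi.eventually hF2

lemma SmoothFamily.smoothFamilyOn {Φ : ℝ → Surface Λ → Surface Λ} (hΦ : SmoothFamily Φ)
    (M : Set (Surface Λ)) : SmoothFamilyOn M Φ := by
  intro t _ x _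
  obtain ⟨F, hF, hF2⟩ := hΦ t x
  exact ⟨F, hF.contDiffWithinAt, hF2.filter_mono nhdsWithin_le_nhds⟩

lemma SmoothFamily.smoothOn {Φ : ℝ → Surface Λ → Surface Λ} (hΦ : SmoothFamily Φ)
    (M : Set (Surface Λ)) (t : ℝ) : SmoothOn M (Φ t) := by
  intro x _
  obtain ⟨F, hF, hF2⟩ := hΦ t x
  have hi : ContDiffAt ℝ (⊤ : ℕ∞) (fun y : Plane => (t, y)) x :=
    contDiffAt_const.prodMk contDiffAt_id
  refine ⟨fun y => F (t, y), (ContDiffAt.comp x (g := F) hF hi).contDiffWithinAt, ?_⟩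
  exact (hi.continuousAt.eventually hF2).filter_mono nhdsWithin_le_nhds

/-- `φ` is the time-one map of a smooth isotopy of area-preserving diffeomorphisms of the whole
surface that moves only interior points of `M`. -/
def IsInteriorIsotopic (M : Set (Surface Λ)) (φ : Surface Λ → Surface Λ) : Prop :=
  ∃ Φ Ψ : ℝ → Surface Λ → Surface Λ, SmoothFamily Φ ∧ SmoothFamily Ψ ∧
    (∀ t q, Φ t (Ψ t q) = q) ∧ (∀ t q, Ψ t (Φ t q) = q) ∧
    (∀ t, MeasurePreserving (Φ t) (area Λ) (area Λ)) ∧ (∀ t, ∀ q ∉ interior M, Φ t q = q) ∧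
    (∀ q, Φ 0 q = q) ∧ Φ 1 = φ

lemma isInteriorIsotopic_id (M : Set (Surface Λ)) : IsInteriorIsotopic M id := by
  have h : SmoothFamily (fun (_ : ℝ) (q : Surface Λ) => q) := fun t x =>
    ⟨Prod.snd, contDiffAt_snd, Eventually.of_forall fun _ => rfl⟩
  exact ⟨fun _ q => q, fun _ q => q, h, h, fun _ _ => rfl, fun _ _ => rfl,
    fun _ => MeasurePreserving.id _, fun _ _ _ => rfl, fun _ => rfl, rfl⟩

lemma IsInteriorIsotopic.comp {M : Set (Surface Λ)} {φ ψ : Surface Λ → Surface Λ}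
    (hφ : IsInteriorIsotopic M φ) (hψ : IsInteriorIsotopic M ψ) :
    IsInteriorIsotopic M (φ ∘ ψ) := by
  obtain ⟨Φ, Φ', h1, h2, h3, h4, h5, h6, h7, h8⟩ := hφ
  obtain ⟨Ψ, Ψ', k1, k2, k3, k4, k5, k6, k7, k8⟩ := hψ
  refine ⟨fun t q => Φ t (Ψ t q), fun t q => Ψ' t (Φ' t q), h1.comp k1, k2.comp h2, ?_, ?_, ?_,
    ?_, ?_, ?_⟩
  · intro t q; dsimp only; rw [k3, h3]
  · intro t q; dsimp only; rw [h4, k4]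
  · intro t; exact (h5 t).comp (k5 t)
  · intro t q hq; dsimp only; rw [k6 t q hq, h6 t q hq]
  · intro q; dsimp only; rw [k7, h7]
  · rw [← h8, ← k8]; rfl

lemma ae_eq_interior {M : Set (Surface Λ)} (hM : IsBoundedDomain M) :
    M =ᵐ[area Λ] interior M := by
  refine ae_eq_set.2 ⟨hM.boundary_null, ?_⟩
  rw [sdiff_eq_empty.2 interior_subset, measure_empty]

lemma areaOn_eq_restrict_interior {M : Set (Surface Λ)} (hM : IsBoundedDomain M) :
    areaOn M = (area Λ).restrict (interior M) := by
  exact Measure.restrict_congr_set (ae_eq_interior hM)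

lemma area_inter_eq_area_inter_interior {M : Set (Surface Λ)} (hM : IsBoundedDomain M)
    (B : Set (Surface Λ)) : area Λ (M ∩ B) = area Λ (interior M ∩ B) := by
  exact measure_congr ((ae_eq_interior hM).inter (ae_eq_refl B))

/-- If an interior point `q` had `φ q` outside the interior, then `φ q` would be fixed, and
injectivity would force `φ q = q`. -/
lemma preimage_interior_of_bijective {M : Set (Surface Λ)} {φ ψ : Surface Λ → Surface Λ}
    (h1 : ∀ q, ψ (φ q) = q) (h3 : ∀ q ∉ interior M, φ q = q) :
    φ ⁻¹' interior M = interior M := by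
  ext q
  by_cases hq : q ∈ interior M
  · refine iff_of_true ?_ hq
    by_contra hn
    have h4 := h3 (φ q) hn
    have h5 : φ q = q := by rw [← h1 (φ q), h4, h1]
    rw [mem_preimage, h5] at hn
    exact hn hq
  · refine iff_of_false ?_ hq
    rw [mem_preimage, h3 q hq]
    exact hq

lemma IsInteriorIsotopic.measurePreserving [DiscreteTopology Λ] {M : Set (Surface Λ)}
    (hM : IsBoundedDomain M)
    {φ : Surface Λ → Surface Λ} (hφ : IsInteriorIsotopic M φ) :
    MeasurePreserving φ (areaOn M) (areaOn M) := by
  obtain ⟨Φ, Ψ, h1, h2, h3, h4, h5, h6, h7, rfl⟩ := hφ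
  rw [areaOn_eq_restrict_interior hM]
  have := (h5 1).restrict_preimage (s := interior M) isOpen_interior.measurableSet
  rwa [preimage_interior_of_bijective (h4 1) (h6 1)] at this

/-- The isotopy fixes every point outside the interior, so it preserves `M` whichever boundary
points `M` contains, and smoothness up to the boundary comes for free. -/
lemma IsInteriorIsotopic.mem_areaPreservingDiffeos [DiscreteTopology Λ] {M : Set (Surface Λ)}
    (hM : IsBoundedDomain M)
    {φ : Surface Λ → Surface Λ} (hφ : IsInteriorIsotopic M φ) :
    φ ∈ areaPreservingDiffeos M := by
  obtain ⟨Φ, Ψ, h1, h2, h3, h4, h5, h6, h7, rfl⟩ := hφ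
  have hpre : ∀ t, Φ t ⁻¹' interior M = interior M := fun t =>
    preimage_interior_of_bijective (h4 t) (h6 t)
  have hmaps : ∀ t, MapsTo (Φ t) M M := by
    intro t q hq
    by_cases hqi : q ∈ interior M
    · exact interior_subset ((hpre t).ge hqi)
    · rwa [h6 t q hqi]
  have h6' : ∀ t, ∀ q ∉ interior M, Ψ t q = q := by
    intro t q hq
    conv_lhs => rw [← h6 t q hq]
    exact h4 t q
  have hpre' : ∀ t, Ψ t ⁻¹' interior M = interior M := fun t =>
    preimage_interior_of_bijective (h3 t) (h6' t)
  have hmaps' : ∀ t, MapsTo (Ψ t) M M := by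
    intro t q hq
    by_cases hqi : q ∈ interior M
    · exact interior_subset ((hpre' t).ge hqi)
    · rwa [h6' t q hqi]
  refine ⟨Φ, h1.smoothFamilyOn M, fun t _ => ⟨⟨Ψ t, hmaps t, hmaps' t,
    ⟨fun q _ => h4 t q, fun q _ => h3 t q⟩, h1.smoothOn M t, h2.smoothOn M t⟩, ?_⟩,
    fun q _ => h7 q, fun q _ => rfl⟩
  intro B hB
  rw [area_inter_eq_area_inter_interior hM, area_inter_eq_area_inter_interior hM,
    ← (h5 t).measure_preimage (isOpen_interior.measurableSet.inter hB).nullMeasurableSet,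
    preimage_inter, hpre]

/-- `σ` agrees with time-one maps of area-preserving isotopies up to sets of arbitrarily small
area. -/
def IsIsotopyLimit (M : Set (Surface Λ)) (σ : Surface Λ → Surface Λ) : Prop :=
  ∀ ε : ENNReal, 0 < ε → ∃ φ, IsInteriorIsotopic M φ ∧ areaOn M {q | φ q ≠ σ q} ≤ ε

lemma isIsotopyLimit_id (M : Set (Surface Λ)) : IsIsotopyLimit M id := fun ε _ =>
  ⟨id, isInteriorIsotopic_id M, by simp⟩

lemma IsIsotopyLimit.comp [DiscreteTopology Λ] {M : Set (Surface Λ)} (hM : IsBoundedDomain M)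
    {σ τ : Surface Λ → Surface Λ} (hσ : IsIsotopyLimit M σ) (hτ : IsIsotopyLimit M τ) :
    IsIsotopyLimit M (σ ∘ τ) := by
  intro ε hε
  have hε2 : 0 < ε / 2 := ENNReal.half_pos hε.ne'
  obtain ⟨φ, hφ, h1⟩ := hσ (ε / 2) hε2
  obtain ⟨ψ, hψ, h2⟩ := hτ (ε / 2) hε2
  refine ⟨φ ∘ ψ, hφ.comp hψ, ?_⟩
  set A := {q | φ q ≠ σ q}
  -- A point is bad if `ψ` errs there or if `ψ` carries it to a point where `φ` errs. The second set
  -- has unchanged measure because `ψ` preserves area; the measurable hull is taken because `σ` need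
  -- not be measurable.
  have hsub : {q | (φ ∘ ψ) q ≠ (σ ∘ τ) q} ⊆
      ψ ⁻¹' (toMeasurable (areaOn M) A) ∪ {q | ψ q ≠ τ q} := by
    intro q hq
    by_cases hq2 : ψ q = τ q
    · left
      refine subset_toMeasurable _ _ ?_
      change φ (ψ q) ≠ σ (ψ q)
      rw [hq2]
      simpa [hq2] using hq
    · exact Or.inr hq2
  calc areaOn M _ ≤ areaOn M (ψ ⁻¹' (toMeasurable (areaOn M) A)) + areaOn M {q | ψ q ≠ τ q} :=
        (measure_mono hsub).trans (measure_union_le _ _)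
    _ ≤ ε / 2 + ε / 2 := by
        gcongr
        rw [(hψ.measurePreserving hM).measure_preimage
          (measurableSet_toMeasurable _ _).nullMeasurableSet, measure_toMeasurable]
        exact h1
    _ = ε := ENNReal.add_halves ε

lemma IsIsotopyLimit.congr {M : Set (Surface Λ)} {σ τ : Surface Λ → Surface Λ}
    (hσ : IsIsotopyLimit M σ) (h : σ =ᵐ[areaOn M] τ) : IsIsotopyLimit M τ := by
  intro ε hε
  obtain ⟨φ, hφ, h1⟩ := hσ ε hε
  refine ⟨φ, hφ, le_trans (le_of_eq ?_) h1⟩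
  refine measure_congr ?_
  filter_upwards [h] with q hq
  exact propext (by change φ q ≠ τ q ↔ φ q ≠ σ q; rw [hq])

variable [DiscreteTopology Λ]

lemma measurePreserving_pushMap {U : Set Plane} (hU : MeasurableSet U) (hinj : InjOn (proj Λ) U)
    {T : Plane → Plane} (hT : MeasurePreserving T volume volume) (hTU : T ⁻¹' U = U)
    (hm : Measurable (pushMap Λ U T)) :
    MeasurePreserving (pushMap Λ U T) (area Λ) (area Λ) := by
  refine ⟨hm, ?_⟩
  ext B hB
  rw [Measure.map_apply hm hB,
    ← measure_inter_add_sdiff _ (measurableSet_image_proj (Λ := Λ) hU),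
    ← measure_inter_add_sdiff B (measurableSet_image_proj (Λ := Λ) hU)]
  congr 1
  · rw [area_inter_image_proj hU hinj hB, area_inter_image_proj hU hinj (hm hB),
      ← hT.measure_preimage ((measurable_proj hB).inter hU).nullMeasurableSet]
    congr 1
    ext x
    rw [preimage_inter, hTU]
    simp only [mem_inter_iff, mem_preimage]
    refine and_congr_left fun hx => ?_
    rw [pushMap_proj hinj T hx]
  · congr 1
    ext q
    refine and_congr_left fun hq => ?_
    rw [mem_preimage, pushMap_of_notMem T hq]

/-- Over the image of `K`, a smooth lift is `T` precomposed with a lattice translation into `U`. Off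
this image, which is closed by compactness, the map is the identity. -/
lemma smoothFamily_pushMap {U K : Set Plane} (hU : IsOpen U) (hinj : InjOn (proj Λ) U)
    (hK : IsCompact K) (hKU : K ⊆ U) {T : ℝ → Plane → Plane}
    (hT : ContDiff ℝ (⊤ : ℕ∞) (fun q : ℝ × Plane => T q.1 q.2)) (hTK : ∀ t, ∀ z ∉ K, T t z = z) :
    SmoothFamily (fun t => pushMap Λ U (T t)) := by
  intro t x
  by_cases hx : proj Λ x ∈ proj Λ '' K
  · obtain ⟨y, hy, hyx⟩ := hx
    set v := x - y with hv
    have hvΛ : v ∈ Λ := proj_eq_iff.1 hyx.symm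
    refine ⟨fun p => T p.1 (p.2 - v), ?_, ?_⟩
    · exact ContDiff.contDiffAt (hT.comp (contDiff_fst.prodMk (contDiff_snd.sub contDiff_const)))
    · have hc : ContinuousAt (fun p : ℝ × Plane => p.2 - v) (t, x) := by fun_prop
      have hmem : U ∈ 𝓝 (x - v) := by
        rw [hv, sub_sub_cancel]
        exact hU.mem_nhds (hKU hy)
      filter_upwards [hc.eventually_mem hmem] with p hp
      have : proj Λ p.2 = proj Λ (p.2 - v) := by rw [proj_eq_iff]; simpa using hvΛ
      rw [this, pushMap_proj hinj _ hp]
  · have hcl : IsClosed (proj Λ '' K) := (hK.image continuous_proj).isClosed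
    refine ⟨Prod.snd, contDiffAt_snd, ?_⟩
    have hc : ContinuousAt (fun p : ℝ × Plane => proj Λ p.2) (t, x) :=
      (continuous_proj.comp continuous_snd).continuousAt
    filter_upwards [hc.eventually_mem (hcl.isOpen_compl.mem_nhds hx)] with p hp
    by_cases hpU : proj Λ p.2 ∈ proj Λ '' U
    · obtain ⟨y, hy, hyp⟩ := hpU
      rw [← hyp, pushMap_proj hinj _ hy, hTK]
      intro hyK
      exact hp ⟨y, hyK, hyp⟩
    · rw [pushMap_of_notMem _ hpU]

/-- Point reflections of rectangles inside the domain are limits of isotopies. -/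
lemma isIsotopyLimit_reflection {M : Set (Surface Λ)} {p d : Plane} (hd : ∀ i, 0 < d i)
    (hM : rect p d ⊆ proj Λ ⁻¹' interior M) (hinj : InjOn (proj Λ) (rect p d)) :
    IsIsotopyLimit M (pushMap Λ (rect p d) (fun x => p + p + d - x)) := by
  intro ε hε
  obtain ⟨T, K, hK, hKU, hcd, hTK, hTinv, hT0, hTmp, hT1⟩ := exists_rect_twist p d hd hε
  set U := rect p d
  have hTinv' : ∀ t z, T (-t) (T t z) = z := fun t z => by simpa using hTinv (-t) z
  have hUo : IsOpen U := isOpen_rect p d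
  have hTU : ∀ t z, z ∈ U → T t z ∈ U := by
    intro t z hz
    by_contra hn
    have h1 := hTK (-t) (T t z) (fun h => hn (hKU h))
    rw [hTinv'] at h1
    exact hn (h1 ▸ hz)
  have hpre : ∀ t, T t ⁻¹' U = U := by
    intro t
    ext z
    refine ⟨fun h => ?_, hTU t z⟩
    have := hTU (-t) _ h
    rwa [hTinv'] at this
  have hsm : SmoothFamily (fun t => pushMap Λ U (T t)) := smoothFamily_pushMap hUo hinj hK hKU hcd hTK
  have hsm' : SmoothFamily (fun t => pushMap Λ U (T (-t))) := by
    refine smoothFamily_pushMap (T := fun t => T (-t)) hUo hinj hK hKU ?_ (fun t => hTK (-t))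
    exact hcd.comp ((contDiff_fst.neg).prodMk contDiff_snd)
  have hinv : ∀ t q, pushMap Λ U (T t) (pushMap Λ U (T (-t)) q) = q := by
    intro t q
    by_cases hq : q ∈ proj Λ '' U
    · obtain ⟨x, hx, rfl⟩ := hq
      rw [pushMap_proj hinj _ hx, pushMap_proj hinj _ (hTU _ _ hx), hTinv]
    · rw [pushMap_of_notMem _ hq, pushMap_of_notMem _ hq]
  refine ⟨pushMap Λ U (T 1), ⟨fun t => pushMap Λ U (T t), fun t => pushMap Λ U (T (-t)), hsm, hsm',
    hinv, fun t q => by simpa using hinv (-t) q, fun t => ?_, ?_, ?_, rfl⟩, ?_⟩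
  · exact measurePreserving_pushMap hUo.measurableSet hinj (hTmp t) (hpre t)
      (hsm.continuous t).measurable
  · intro t q hq
    refine pushMap_of_notMem _ ?_
    rintro ⟨x, hx, rfl⟩
    exact hq (hM hx)
  · intro q
    dsimp only
    by_cases hq : q ∈ proj Λ '' U
    · obtain ⟨x, hx, rfl⟩ := hq
      rw [pushMap_proj hinj _ hx, hT0]
    · rw [pushMap_of_notMem _ hq]
  · have hTm : Measurable (T 1) := (hTmp 1).measurable
    have hBm : MeasurableSet {z ∈ U | T 1 z ≠ p + p + d - z} :=
      hUo.measurableSet.inter (measurableSet_eq_fun hTm (by fun_prop)).compl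
    calc areaOn M {q | pushMap Λ U (T 1) q ≠ pushMap Λ U (fun x => p + p + d - x) q}
        ≤ areaOn M (proj Λ '' {z ∈ U | T 1 z ≠ p + p + d - z}) := by
          refine measure_mono ?_
          intro q hq
          by_cases hqU : q ∈ proj Λ '' U
          · obtain ⟨x, hx, rfl⟩ := hqU
            refine ⟨x, ⟨hx, fun h => hq ?_⟩, rfl⟩
            rw [pushMap_proj hinj _ hx, pushMap_proj hinj _ hx, h]
          · exact absurd (by rw [pushMap_of_notMem _ hqU, pushMap_of_notMem _ hqU]) hq
      _ ≤ area Λ (proj Λ '' {z ∈ U | T 1 z ≠ p + p + d - z}) := Measure.restrict_apply_le _ _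
      _ ≤ ε := by
          rw [area_image_proj hBm (hinj.mono (fun z hz => hz.1))]
          exact hT1

end Isotopies

/-! ### Permutations of disjoint small squares by translations. -/

section CellPermutations

variable {Λ : AddSubgroup Plane} {ι : Type*}

/-- The half-open square `[0, ε)²`. -/
def cell (ε : ℝ) : Set Plane := {u | ∀ k, 0 ≤ u k ∧ u k < ε}

/-- The squares of side `ε` with lower left corners `p i` project injectively and disjointly to
the surface. -/
def Separated (Λ : AddSubgroup Plane) (p : ι → Plane) (ε : ℝ) : Prop :=
  ∀ i j, ∀ u ∈ cell ε, ∀ v ∈ cell ε, proj Λ (p i + u) = proj Λ (p j + v) → i = j ∧ u = v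

open Classical in
/-- The map of the surface that permutes the squares with corners `p i` by translations. -/
noncomputable def cellPerm (Λ : AddSubgroup Plane) (p : ι → Plane) (ε : ℝ) (τ : Equiv.Perm ι)
    (q : Surface Λ) : Surface Λ :=
  if h : ∃ a : ι × Plane, a.2 ∈ cell ε ∧ proj Λ (p a.1 + a.2) = q then
    proj Λ (p (τ h.choose.1) + h.choose.2) else q

lemma cellPerm_proj {p : ι → Plane} {ε : ℝ} (hp : Separated Λ p ε) (τ : Equiv.Perm ι) (i : ι)
    {u : Plane} (hu : u ∈ cell ε) :
    cellPerm Λ p ε τ (proj Λ (p i + u)) = proj Λ (p (τ i) + u) := by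
  have h : ∃ a : ι × Plane, a.2 ∈ cell ε ∧ proj Λ (p a.1 + a.2) = proj Λ (p i + u) :=
    ⟨(i, u), hu, rfl⟩
  obtain ⟨h1, h2⟩ := hp _ _ _ h.choose_spec.1 _ hu h.choose_spec.2
  rw [cellPerm, dif_pos h, h1, h2]

lemma cellPerm_of_forall_ne {p : ι → Plane} {ε : ℝ} (τ : Equiv.Perm ι) {q : Surface Λ}
    (hq : ∀ i, ∀ u ∈ cell ε, proj Λ (p i + u) ≠ q) : cellPerm Λ p ε τ q = q := by
  rw [cellPerm, dif_neg]
  rintro ⟨a, h1, h2⟩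
  exact hq _ _ h1 h2

/-- Only the classes of the corners modulo `Λ` matter, so the lifts of the corners can be chosen to
suit a chart. -/
lemma cellPerm_congr {p p' : ι → Plane} (h : ∀ i, p i - p' i ∈ Λ) (ε : ℝ) (τ : Equiv.Perm ι) :
    cellPerm Λ p ε τ = cellPerm Λ p' ε τ := by
  classical
  -- The definition involves a choice; identifying the parametrizations as functions makes the two
  -- choices literally the same.
  have h1 : (fun i u => proj Λ (p i + u)) = fun i u => proj Λ (p' i + u) := by
    funext i u
    rw [proj_eq_iff, add_sub_add_right_eq_sub]
    exact h i
  funext q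
  exact congrArg (fun f : ι → Plane → Surface Λ =>
    if h : ∃ a : ι × Plane, a.2 ∈ cell ε ∧ f a.1 a.2 = q then
      f (τ h.choose.1) h.choose.2 else q) h1

lemma cellPerm_mul {p : ι → Plane} {ε : ℝ} (hp : Separated Λ p ε) (σ τ : Equiv.Perm ι) :
    cellPerm Λ p ε (σ * τ) = cellPerm Λ p ε σ ∘ cellPerm Λ p ε τ := by
  funext q
  by_cases h : ∃ i, ∃ u ∈ cell ε, proj Λ (p i + u) = q
  · obtain ⟨i, u, hu, rfl⟩ := h
    rw [Function.comp_apply, cellPerm_proj hp _ _ hu, cellPerm_proj hp _ _ hu,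
      cellPerm_proj hp _ _ hu]
    rfl
  · push Not at h
    rw [Function.comp_apply, cellPerm_of_forall_ne _ h, cellPerm_of_forall_ne _ h,
      cellPerm_of_forall_ne _ h]

lemma cellPerm_one {p : ι → Plane} {ε : ℝ} (hp : Separated Λ p ε) :
    cellPerm Λ p ε 1 = id := by
  funext q
  by_cases h : ∃ i, ∃ u ∈ cell ε, proj Λ (p i + u) = q
  · obtain ⟨i, u, hu, rfl⟩ := h
    rw [cellPerm_proj hp _ _ hu]
    rfl
  · push Not at h
    rw [cellPerm_of_forall_ne _ h]
    rfl

/-- The exchange of the squares with corners `x` and `y`. -/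
noncomputable def swapMap (Λ : AddSubgroup Plane) (x y : Plane) (ε : ℝ) :
    Surface Λ → Surface Λ :=
  cellPerm Λ ![x, y] ε (Equiv.swap 0 1)

lemma Separated.comp {κ : Type*} {p : ι → Plane} {ε : ℝ} (hp : Separated Λ p ε) {f : κ → ι}
    (hf : Function.Injective f) : Separated Λ (p ∘ f) ε := by
  intro i j u hu v hv h
  obtain ⟨h1, h2⟩ := hp _ _ u hu v hv h
  exact ⟨hf h1, h2⟩

lemma Separated.pair {p : ι → Plane} {ε : ℝ} (hp : Separated Λ p ε) {i j : ι} (hij : i ≠ j) :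
    Separated Λ ![p i, p j] ε := by
  have h : ![p i, p j] = p ∘ ![i, j] := by
    ext k; fin_cases k <;> rfl
  rw [h]
  refine hp.comp ?_
  intro a b hab
  fin_cases a <;> fin_cases b <;> simp_all

lemma swapMap_left {x y : Plane} {ε : ℝ} (h : Separated Λ ![x, y] ε) {u : Plane}
    (hu : u ∈ cell ε) : swapMap Λ x y ε (proj Λ (x + u)) = proj Λ (y + u) := by
  have := cellPerm_proj h (Equiv.swap 0 1) 0 hu
  simpa [swapMap] using this

lemma swapMap_right {x y : Plane} {ε : ℝ} (h : Separated Λ ![x, y] ε) {u : Plane}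
    (hu : u ∈ cell ε) : swapMap Λ x y ε (proj Λ (y + u)) = proj Λ (x + u) := by
  have := cellPerm_proj h (Equiv.swap 0 1) 1 hu
  simpa [swapMap] using this

lemma swapMap_of_ne {x y : Plane} {ε : ℝ} {q : Surface Λ}
    (hx : ∀ u ∈ cell ε, proj Λ (x + u) ≠ q) (hy : ∀ u ∈ cell ε, proj Λ (y + u) ≠ q) :
    swapMap Λ x y ε q = q := by
  refine cellPerm_of_forall_ne _ ?_
  rw [Fin.forall_fin_two]
  exact ⟨hx, hy⟩

/-- The effect of a transposition does not depend on the family of squares in which it is taken, so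
exchanges obtained for pairs can be composed inside a larger family. -/
lemma cellPerm_swap [DecidableEq ι] {p : ι → Plane} {ε : ℝ} (hp : Separated Λ p ε) {i j : ι}
    (hij : i ≠ j) : cellPerm Λ p ε (Equiv.swap i j) = swapMap Λ (p i) (p j) ε := by
  funext q
  by_cases h : ∃ k, ∃ u ∈ cell ε, proj Λ (p k + u) = q
  · obtain ⟨k, u, hu, rfl⟩ := h
    rw [cellPerm_proj hp _ _ hu]
    by_cases hki : k = i
    · rw [hki, swapMap_left (hp.pair hij) hu, Equiv.swap_apply_left]
    by_cases hkj : k = j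
    · rw [hkj, swapMap_right (hp.pair hij) hu, Equiv.swap_apply_right]
    rw [Equiv.swap_apply_of_ne_of_ne hki hkj, swapMap_of_ne]
    · exact fun v hv h => hki (hp _ _ v hv u hu h).1.symm
    · exact fun v hv h => hkj (hp _ _ v hv u hu h).1.symm
  · push Not at h
    rw [cellPerm_of_forall_ne _ h, swapMap_of_ne (h i) (h j)]

lemma swapMap_comm (x y : Plane) {ε : ℝ} (h : Separated Λ ![x, y] ε) :
    swapMap Λ x y ε = swapMap Λ y x ε := by
  rw [swapMap, Equiv.swap_comm, cellPerm_swap h (by simp)]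
  rfl

variable [DiscreteTopology Λ]

/-- The permutations of separated squares that are limits of isotopies contain a transposition
`(i k)` with `(i j)` and `(j k)`. -/
lemma isIsotopyLimit_swap_trans {M : Set (Surface Λ)} (hM : IsBoundedDomain M) {p : ι → Plane}
    {ε : ℝ} (hp : Separated Λ p ε) {i j k : ι} (hik : i ≠ k) (hij : i ≠ j) (hjk : j ≠ k)
    (h1 : IsIsotopyLimit M (swapMap Λ (p i) (p j) ε))
    (h2 : IsIsotopyLimit M (swapMap Λ (p j) (p k) ε)) :
    IsIsotopyLimit M (swapMap Λ (p i) (p k) ε) := by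
  classical
  rw [← cellPerm_swap hp hik]
  rw [← cellPerm_swap hp hij] at h1
  rw [← cellPerm_swap hp hjk] at h2
  have h3 := (h1.comp hM h2).comp hM h1
  rw [← cellPerm_mul hp, ← cellPerm_mul hp] at h3
  have h4 : Equiv.swap i j * Equiv.swap j k * Equiv.swap i j = Equiv.swap i k := by
    rw [Equiv.swap_comm i j, Equiv.swap_comm j k,
      Equiv.swap_mul_swap_mul_swap hjk.symm hik.symm]
  rwa [h4] at h3

/-- If all transpositions of separated squares are limits of isotopies, so are all
permutations. -/
lemma isIsotopyLimit_cellPerm [Finite ι] {M : Set (Surface Λ)} (hM : IsBoundedDomain M)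
    {p : ι → Plane} {ε : ℝ} (hp : Separated Λ p ε)
    (h : ∀ i j, i ≠ j → IsIsotopyLimit M (swapMap Λ (p i) (p j) ε)) (τ : Equiv.Perm ι) :
    IsIsotopyLimit M (cellPerm Λ p ε τ) := by
  classical
  have hτ : τ ∈ Submonoid.closure { σ : Equiv.Perm ι | σ.IsSwap } := by
    rw [Equiv.Perm.mclosure_isSwap]; trivial
  induction hτ using Submonoid.closure_induction with
  | mem σ hσ =>
    obtain ⟨i, j, hij, rfl⟩ := hσ
    rw [cellPerm_swap hp hij]
    exact h i j hij
  | one => rw [cellPerm_one hp]; exact isIsotopyLimit_id M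
  | mul σ ρ _ _ h1 h2 => rw [cellPerm_mul hp]; exact h1.comp hM h2

end CellPermutations

/-! ### Exchange of two squares in one row or column by four half-turns. -/

section AdjacentSwap

variable {Λ : AddSubgroup Plane} [DiscreteTopology Λ]

/-- The vector with coordinate `b` in direction `i` and `ε` in the other direction. -/
noncomputable def side (i : Fin 2) (b ε : ℝ) : Plane := WithLp.toLp 2 fun k => if k = i then b else ε

lemma side_self (i : Fin 2) (b ε : ℝ) : side i b ε i = b := by simp [side]

lemma side_ne {i j : Fin 2} (hij : j ≠ i) (b ε : ℝ) : side i b ε j = ε := by simp [side, hij]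

lemma forall_fin_two_of_ne {i j : Fin 2} (hij : j ≠ i) {P : Fin 2 → Prop} :
    (∀ k, P k) ↔ P i ∧ P j := by
  refine ⟨fun h => ⟨h i, h j⟩, fun h k => ?_⟩
  have : k = i ∨ k = j := by omega
  rcases this with rfl | rfl
  exacts [h.1, h.2]

/-- Degenerate rectangles are allowed because the gap between two adjacent squares is empty. -/
lemma isIsotopyLimit_reflection' {M : Set (Surface Λ)} {p d : Plane}
    (hM : rect p d ⊆ proj Λ ⁻¹' interior M) (hinj : InjOn (proj Λ) (rect p d)) :
    IsIsotopyLimit M (pushMap Λ (rect p d) (fun x => p + p + d - x)) := by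
  by_cases hd : ∀ i, 0 < d i
  · exact isIsotopyLimit_reflection hd hM hinj
  · push Not at hd
    obtain ⟨i, hi⟩ := hd
    have : rect p d = ∅ := by
      rw [eq_empty_iff_forall_notMem]
      intro x hx
      have := hx i
      linarith
    have h2 : pushMap Λ (rect p d) (fun x => p + p + d - x) = id := by
      funext q
      rw [pushMap_of_notMem, id]
      simp [this]
    rw [h2]
    exact isIsotopyLimit_id M

omit [DiscreteTopology Λ] in
lemma pushMap_proj_of_injOn {W U : Set Plane} (hW : InjOn (proj Λ) W) (hUW : U ⊆ W)
    (T : Plane → Plane) {z : Plane} (hz : z ∈ W) (hzU : z ∉ U) :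
    pushMap Λ U T (proj Λ z) = proj Λ z := by
  refine pushMap_of_notMem _ ?_
  rintro ⟨y, hy, hyz⟩
  exact hzU (hW (hUW hy) hz hyz ▸ hy)

lemma volume_setOf_coord_eq (k : Fin 2) (c : ℝ) : volume {z : Plane | z k = c} = 0 := by
  have h1 : volume ((Function.eval k : (Fin 2 → ℝ) → ℝ) ⁻¹' {c}) = 0 := by
    rw [volume_pi]
    exact (Measure.quasiMeasurePreserving_eval (fun _ : Fin 2 => (volume : Measure ℝ)) k).preimage_null
      Real.volume_singleton
  have h2 := (EuclideanSpace.volume_preserving_symm_measurableEquiv_toLp (Fin 2)).measure_preimage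
    ((measurable_pi_apply k (measurableSet_singleton c)).nullMeasurableSet)
  rw [h1] at h2
  exact h2

/-- Two squares in the same row or column can be exchanged. -/
lemma isIsotopyLimit_swapMap_axis {M : Set (Surface Λ)} (hM : IsBoundedDomain M) {W : Set Plane}
    (hWM : W ⊆ proj Λ ⁻¹' interior M) (hW : InjOn (proj Λ) W) {x : Plane} {i : Fin 2} {a ε : ℝ}
    (ha : ε ≤ a)
    (hull : ∀ z : Plane, (∀ k, x k ≤ z k ∧ z k ≤ x k + side i (a + ε) ε k) → z ∈ W)
    (hsep : Separated Λ ![x, x + side i a 0] ε) :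
    IsIsotopyLimit M (swapMap Λ x (x + side i a 0) ε) := by
  obtain ⟨j, hij⟩ : ∃ j : Fin 2, j ≠ i := exists_ne i
  set y := x + side i a 0 with hy
  set g := x + side i ε 0 with hg
  have hyi : y i = x i + a := by simp [hy, side_self]
  have hyj : y j = x j := by simp [hy, side_ne hij]
  have hgi : g i = x i + ε := by simp [hg, side_self]
  have hgj : g j = x j := by simp [hg, side_ne hij]
  have hmem : ∀ (p z : Plane) (b : ℝ), z ∈ rect p (side i b ε) ↔
      (p i < z i ∧ z i < p i + b) ∧ p j < z j ∧ z j < p j + ε := by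
    intro p z b
    change (∀ k, _) ↔ _
    rw [forall_fin_two_of_ne hij, side_self, side_ne hij]
  have hull' : ∀ z : Plane, x i ≤ z i → z i ≤ x i + (a + ε) → x j ≤ z j → z j ≤ x j + ε → z ∈ W := by
    intro z h1 h2 h3 h4
    refine hull z ?_
    rw [forall_fin_two_of_ne hij, side_self, side_ne hij]
    exact ⟨⟨h1, h2⟩, h3, h4⟩
  set H := rect x (side i (a + ε) ε)
  set Q := rect x (side i ε ε)
  set Q' := rect y (side i ε ε)
  set G := rect g (side i (a - ε) ε)
  have hHW : H ⊆ W := fun z hz => by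
    have := (hmem _ _ _).1 hz
    exact hull' z (by linarith) (by linarith) (by linarith) (by linarith)
  have hQW : Q ⊆ W := fun z hz => by
    have := (hmem _ _ _).1 hz
    exact hull' z (by linarith) (by linarith) (by linarith) (by linarith)
  have hQW' : Q' ⊆ W := fun z hz => by
    have := (hmem _ _ _).1 hz
    exact hull' z (by linarith) (by linarith) (by linarith) (by linarith)
  have hGW : G ⊆ W := fun z hz => by
    have := (hmem _ _ _).1 hz
    exact hull' z (by linarith) (by linarith) (by linarith) (by linarith)
  have lim : ∀ (p d : Plane), rect p d ⊆ W →
      IsIsotopyLimit M (pushMap Λ (rect p d) (fun x => p + p + d - x)) := fun p d h =>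
    isIsotopyLimit_reflection' (h.trans hWM) (hW.mono h)
  -- The half-turns of `Q`, `Q'`, the gap `G` and the hull `H` are composed in this order. `G` and
  -- `H` have the same centre, so their half-turns cancel on the gap; on each square the half-turn
  -- of the square followed by that of the hull is the translation onto the other square.
  have hcomp := (((lim _ _ hHW).comp hM (lim _ _ hGW)).comp hM (lim _ _ hQW')).comp hM (lim _ _ hQW)
  refine hcomp.congr ?_
  -- The rectangles are open and the cells half-open, so the identity is claimed only off the lines
  -- carrying the relevant edges.
  set N : Set Plane := {z | z i = x i} ∪ {z | z i = x i + ε} ∪ {z | z i = x i + a} ∪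
    {z | z j = x j} with hN
  have hN0 : volume N = 0 := by
    simp only [hN, measure_union_null_iff, volume_setOf_coord_eq, and_self]
  have hclosed : ∀ (k : Fin 2) (c : ℝ), MeasurableSet {z : Plane | z k = c} := fun k c =>
    (isClosed_eq (PiLp.continuous_apply 2 _ k) continuous_const).measurableSet
  have hNm : MeasurableSet N :=
    (((hclosed _ _).union (hclosed _ _)).union (hclosed _ _)).union (hclosed _ _)
  have hnull : areaOn M (proj Λ '' N) = 0 := by
    have h1 : area Λ (proj Λ '' N) = 0 := by
      have := countable_lattice (Λ := Λ)
      rw [area_apply (measurableSet_image_proj hNm), preimage_image_proj]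
      refine measure_mono_null inter_subset_left ?_
      rw [measure_iUnion_null_iff]
      intro v
      rw [measure_vadd, hN0]
    exact le_antisymm ((Measure.restrict_apply_le _ _).trans h1.le) zero_le
  filter_upwards [measure_eq_zero_iff_ae_notMem.1 hnull] with q hq
  simp only [Function.comp_apply]
  have hcell : ∀ u : Plane, u ∈ cell ε ↔ (0 ≤ u i ∧ u i < ε) ∧ 0 ≤ u j ∧ u j < ε := by
    intro u
    exact forall_fin_two_of_ne hij
  by_cases hqH : q ∈ proj Λ '' H
  · obtain ⟨z, hz, rfl⟩ := hqH
    have hzN : z ∉ N := fun h => hq ⟨z, h, rfl⟩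
    simp only [hN, mem_union, not_or] at hzN
    obtain ⟨⟨⟨n1, n2⟩, n3⟩, n4⟩ := hzN
    have n1' : z i ≠ x i := n1
    have n2' : z i ≠ x i + ε := n2
    have n3' : z i ≠ x i + a := n3
    have n4' : z j ≠ x j := n4
    have hzH := (hmem _ _ _).1 hz
    rcases lt_or_gt_of_ne n2' with hlt | hgt
    · have hzQ : z ∈ Q := (hmem _ _ _).2 ⟨⟨by linarith, by linarith⟩, by linarith, by linarith⟩
      have hzQ2 : x + x + side i ε ε - z ∈ Q := by
        rw [hmem]
        simp only [PiLp.sub_apply, PiLp.add_apply, side_self, side_ne hij]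
        refine ⟨⟨?_, ?_⟩, ?_, ?_⟩ <;> linarith
      have hq2 := (hmem _ _ _).1 hzQ2
      have e1 : x + x + side i ε ε - z ∉ Q' := fun h => by
        have := (hmem _ _ _).1 h
        linarith
      have e2 : x + x + side i ε ε - z ∉ G := fun h => by
        have := (hmem _ _ _).1 h
        linarith
      have e3 : x + x + side i ε ε - z ∈ H :=
        (hmem _ _ _).2 ⟨⟨by linarith, by linarith⟩, by linarith, by linarith⟩
      rw [pushMap_proj (hW.mono hQW) _ hzQ, pushMap_proj_of_injOn hW hQW' _ (hQW hzQ2) e1,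
        pushMap_proj_of_injOn hW hGW _ (hQW hzQ2) e2, pushMap_proj (hW.mono hHW) _ e3]
      have hu : z - x ∈ cell ε := by
        rw [hcell]
        simp only [PiLp.sub_apply]
        refine ⟨⟨?_, ?_⟩, ?_, ?_⟩ <;> linarith
      have h3 := swapMap_left hsep hu
      rw [add_sub_cancel] at h3
      rw [h3]
      congr 1
      ext k
      revert k
      rw [forall_fin_two_of_ne hij]
      simp only [PiLp.sub_apply, PiLp.add_apply, side_self, side_ne hij, hyi, hyj]
      constructor <;> ring
    · have hzQ : z ∉ Q := fun h => by
        have := (hmem _ _ _).1 h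
        linarith
      rw [pushMap_proj_of_injOn hW hQW _ (hHW hz) hzQ]
      rcases lt_or_gt_of_ne n3' with hlt3 | hgt3
      · have hzQ' : z ∉ Q' := fun h => by
          have := (hmem _ _ _).1 h
          linarith
        have hzG : z ∈ G := (hmem _ _ _).2 ⟨⟨by linarith, by linarith⟩, by linarith, by linarith⟩
        have e3 : g + g + side i (a - ε) ε - z ∈ H := by
          rw [hmem]
          simp only [PiLp.sub_apply, PiLp.add_apply, side_self, side_ne hij, hgi, hgj]
          refine ⟨⟨?_, ?_⟩, ?_, ?_⟩ <;> linarith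
        rw [pushMap_proj_of_injOn hW hQW' _ (hHW hz) hzQ', pushMap_proj (hW.mono hGW) _ hzG,
          pushMap_proj (hW.mono hHW) _ e3, swapMap_of_ne]
        · congr 1
          ext k
          revert k
          rw [forall_fin_two_of_ne hij]
          simp only [PiLp.sub_apply, PiLp.add_apply, side_self, side_ne hij, hgi, hgj]
          constructor <;> ring
        · intro u hu h
          have hu' := (hcell u).1 hu
          have h5 := hW (hull' (x + u) (by simp; linarith) (by simp; linarith) (by simp; linarith)
            (by simp; linarith)) (hHW hz) h
          have h6 : x i + u i = z i := by rw [← h5]; rfl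
          linarith
        · intro u hu h
          have hu' := (hcell u).1 hu
          have h5 := hW (hull' (y + u) (by simp [hyi]; linarith) (by simp [hyi]; linarith)
            (by simp [hyj]; linarith) (by simp [hyj]; linarith)) (hHW hz) h
          have h6 : y i + u i = z i := by rw [← h5]; rfl
          linarith
      · have hzQ' : z ∈ Q' := (hmem _ _ _).2 ⟨⟨by linarith, by linarith⟩, by linarith, by linarith⟩
        have hzQ2 : y + y + side i ε ε - z ∈ Q' := by
          rw [hmem]
          simp only [PiLp.sub_apply, PiLp.add_apply, side_self, side_ne hij]
          refine ⟨⟨?_, ?_⟩, ?_, ?_⟩ <;> linarith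
        have hq2 := (hmem _ _ _).1 hzQ2
        have e2 : y + y + side i ε ε - z ∉ G := fun h => by
          have := (hmem _ _ _).1 h
          linarith
        have e3 : y + y + side i ε ε - z ∈ H :=
          (hmem _ _ _).2 ⟨⟨by linarith, by linarith⟩, by linarith, by linarith⟩
        rw [pushMap_proj (hW.mono hQW') _ hzQ', pushMap_proj_of_injOn hW hGW _ (hQW' hzQ2) e2,
          pushMap_proj (hW.mono hHW) _ e3]
        have hu : z - y ∈ cell ε := by
          rw [hcell]
          simp only [PiLp.sub_apply]
          refine ⟨⟨?_, ?_⟩, ?_, ?_⟩ <;> linarith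
        have h3 := swapMap_right hsep hu
        rw [add_sub_cancel] at h3
        rw [h3]
        congr 1
        ext k
        revert k
        rw [forall_fin_two_of_ne hij]
        simp only [PiLp.sub_apply, PiLp.add_apply, side_self, side_ne hij, hyi, hyj]
        constructor <;> ring
  · have hsub : Q ⊆ H ∧ Q' ⊆ H ∧ G ⊆ H := by
      refine ⟨fun z hz => ?_, fun z hz => ?_, fun z hz => ?_⟩ <;>
      · have := (hmem _ _ _).1 hz
        exact (hmem _ _ _).2 ⟨⟨by linarith, by linarith⟩, by linarith, by linarith⟩
    rw [pushMap_of_notMem _ (fun h => hqH (image_mono hsub.1 h)),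
      pushMap_of_notMem _ (fun h => hqH (image_mono hsub.2.1 h)),
      pushMap_of_notMem _ (fun h => hqH (image_mono hsub.2.2 h)), pushMap_of_notMem _ hqH,
      swapMap_of_ne]
    · rintro u hu rfl
      have hu' := (hcell u).1 hu
      by_cases hN' : x + u ∈ N
      · exact hq ⟨_, hN', rfl⟩
      · simp only [hN, mem_union, not_or] at hN'
        obtain ⟨⟨⟨n1, n2⟩, n3⟩, n4⟩ := hN'
        have n1' : x i + u i ≠ x i := n1
        have n4' : x j + u j ≠ x j := n4
        have p1 : 0 < u i := lt_of_le_of_ne hu'.1.1 fun h => n1' (by rw [← h, add_zero])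
        have p2 : 0 < u j := lt_of_le_of_ne hu'.2.1 fun h => n4' (by rw [← h, add_zero])
        refine hqH ⟨_, (hmem _ _ _).2 ?_, rfl⟩
        simp only [PiLp.add_apply]
        refine ⟨⟨?_, ?_⟩, ?_, ?_⟩ <;> linarith
    · rintro u hu rfl
      have hu' := (hcell u).1 hu
      by_cases hN' : y + u ∈ N
      · exact hq ⟨_, hN', rfl⟩
      · simp only [hN, mem_union, not_or] at hN'
        obtain ⟨⟨⟨n1, n2⟩, n3⟩, n4⟩ := hN'
        have n3' : y i + u i ≠ x i + a := n3
        have n4' : y j + u j ≠ x j := n4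
        have p1 : 0 < u i := lt_of_le_of_ne hu'.1.1 fun h => n3' (by rw [← h, add_zero, hyi])
        have p2 : 0 < u j := lt_of_le_of_ne hu'.2.1 fun h => n4' (by rw [← h, add_zero, hyj])
        refine hqH ⟨_, (hmem _ _ _).2 ?_, rfl⟩
        simp only [PiLp.add_apply]
        refine ⟨⟨?_, ?_⟩, ?_, ?_⟩ <;> linarith

end AdjacentSwap

/-! ### Exchange of small squares at arbitrary interior points. -/

section Connectivity

variable {Λ : AddSubgroup Plane}

lemma norm_lt_of_forall_abs_lt {w : Plane} {r : ℝ} (h : ∀ k, |w k| < r) : ‖w‖ < 2 * r := by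
  have h0 := h 0
  have h1 := h 1
  have hr : 0 < r := (abs_nonneg _).trans_lt h0
  rw [EuclideanSpace.norm_eq, Real.sqrt_lt' (by linarith), Fin.sum_univ_two]
  simp only [Real.norm_eq_abs]
  nlinarith [abs_nonneg (w 0), abs_nonneg (w 1)]

/-- The open coordinate square with centre `c` and half side `r`. -/
def box (c : Plane) (r : ℝ) : Set Plane := {z | ∀ k, |z k - c k| < r}

lemma isOpen_box (c : Plane) (r : ℝ) : IsOpen (box c r) := by
  have h : box c r = ⋂ k, {z : Plane | |z k - c k| < r} := by
    ext x; simp [box]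
  rw [h]
  refine isOpen_iInter_of_finite fun k => ?_
  exact isOpen_lt (((PiLp.continuous_apply 2 _ k).sub continuous_const).abs) continuous_const

lemma separated_of_injOn_box {ι : Type*} {c : Plane} {r ε : ℝ} (hinj : InjOn (proj Λ) (box c r))
    {p : ι → Plane} (hp : ∀ i k, c k - r < p i k ∧ p i k + ε < c k + r)
    (hne : ∀ i j, i ≠ j → ∃ k, ε ≤ |p i k - p j k|) : Separated Λ p ε := by
  have hmem : ∀ i, ∀ u ∈ cell ε, p i + u ∈ box c r := by
    intro i u hu k
    have h1 := hp i k
    have h2 := hu k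
    rw [PiLp.add_apply, abs_lt]
    constructor <;> linarith
  intro i j u hu v hv h
  have h1 := hinj (hmem i u hu) (hmem j v hv) h
  by_cases hij : i = j
  · subst hij
    exact ⟨rfl, add_left_cancel h1⟩
  · exfalso
    obtain ⟨k, hk⟩ := hne i j hij
    have h2 : p i k + u k = p j k + v k := by
      rw [← PiLp.add_apply, h1, PiLp.add_apply]
    have hu' := hu k
    have hv' := hv k
    rw [le_abs] at hk
    rcases hk with hk | hk <;> linarith

variable [DiscreteTopology Λ] {M : Set (Surface Λ)}

lemma isIsotopyLimit_swapMap_box_axis (hM : IsBoundedDomain M) {c : Plane} {r ε : ℝ}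
    (hinj : InjOn (proj Λ) (box c r)) (hsub : box c r ⊆ proj Λ ⁻¹' interior M)
    {x y : Plane} (hx : ∀ k, c k - r < x k ∧ x k + ε < c k + r)
    (hy : ∀ k, c k - r < y k ∧ y k + ε < c k + r) {i : Fin 2} (hi : ε ≤ |x i - y i|)
    (hne : ∀ k, k ≠ i → x k = y k) : IsIsotopyLimit M (swapMap Λ x y ε) := by
  wlog hxy : x i ≤ y i generalizing x y with H
  · have h1 : IsIsotopyLimit M (swapMap Λ y x ε) :=
      H hy hx (by rwa [abs_sub_comm]) (fun k hk => (hne k hk).symm) (by linarith)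
    rwa [swapMap_comm]
    refine separated_of_injOn_box hinj (p := ![x, y]) (Fin.forall_fin_two.2 ⟨hx, hy⟩) ?_
    intro a b hab
    refine ⟨i, ?_⟩
    fin_cases a <;> fin_cases b
    exacts [absurd rfl hab, hi, by rw [abs_sub_comm]; exact hi, absurd rfl hab]
  have hy' : y = x + side i (y i - x i) 0 := by
    ext k
    by_cases hk : k = i
    · rw [hk, PiLp.add_apply, side_self]; ring
    · rw [PiLp.add_apply, side_ne hk, hne k hk, add_zero]
  have hsep : Separated Λ ![x, y] ε := by
    refine separated_of_injOn_box hinj (p := ![x, y]) (Fin.forall_fin_two.2 ⟨hx, hy⟩) ?_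
    intro a b hab
    refine ⟨i, ?_⟩
    fin_cases a <;> fin_cases b
    exacts [absurd rfl hab, hi, by rw [abs_sub_comm]; exact hi, absurd rfl hab]
  rw [hy'] at hsep ⊢
  rw [abs_sub_comm, abs_of_nonneg (by linarith)] at hi
  refine isIsotopyLimit_swapMap_axis hM hsub hinj hi ?_ hsep
  intro z hz k
  have h1 := hx k
  have h2 := hy k
  have h3 := hz k
  rw [abs_lt]
  by_cases hk : k = i
  · subst hk
    rw [side_self] at h3
    constructor <;> linarith
  · rw [side_ne hk] at h3
    constructor <;> linarith

/-- Any two grid squares inside a coordinate square can be exchanged. -/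
lemma isIsotopyLimit_swapMap_box (hM : IsBoundedDomain M) {c : Plane} {r ε : ℝ}
    (hinj : InjOn (proj Λ) (box c r)) (hsub : box c r ⊆ proj Λ ⁻¹' interior M)
    {x y : Plane} (hx : ∀ k, c k - r < x k ∧ x k + ε < c k + r)
    (hy : ∀ k, c k - r < y k ∧ y k + ε < c k + r) (hxy : x ≠ y)
    (hk : ∀ k, x k = y k ∨ ε ≤ |x k - y k|) : IsIsotopyLimit M (swapMap Λ x y ε) := by
  rcases hk 0 with h0 | h0
  · rcases hk 1 with h1 | h1
    · exact absurd (by ext k; fin_cases k <;> assumption) hxy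
    · refine isIsotopyLimit_swapMap_box_axis hM hinj hsub hx hy h1 ?_
      intro k hk
      fin_cases k
      · exact h0
      · simp at hk
  · rcases hk 1 with h1 | h1
    · refine isIsotopyLimit_swapMap_box_axis hM hinj hsub hx hy h0 ?_
      intro k hk
      fin_cases k
      · simp at hk
      · exact h1
    -- The intermediate square is the corner of an L-shaped path: it shares a row with one square
    -- and a column with the other.
    · set z : Plane := !₂[y 0, x 1] with hz
      have z0 : z 0 = y 0 := rfl
      have z1 : z 1 = x 1 := rfl
      have hzb : ∀ k, c k - r < z k ∧ z k + ε < c k + r := by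
        rw [Fin.forall_fin_two, z0, z1]
        exact ⟨hy 0, hx 1⟩
      have s1 : IsIsotopyLimit M (swapMap Λ x z ε) := by
        refine isIsotopyLimit_swapMap_box_axis hM hinj hsub hx hzb (i := 0) (by rwa [z0]) ?_
        intro k hk
        fin_cases k
        · simp at hk
        · rfl
      have s2 : IsIsotopyLimit M (swapMap Λ z y ε) := by
        refine isIsotopyLimit_swapMap_box_axis hM hinj hsub hzb hy (i := 1) (by rwa [z1]) ?_
        intro k hk
        fin_cases k
        · rfl
        · simp at hk
      have hsep : Separated Λ ![x, z, y] ε := by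
        refine separated_of_injOn_box hinj (p := ![x, z, y]) ?_ ?_
        · intro i
          fin_cases i
          exacts [hx, hzb, hy]
        · intro i j hij
          fin_cases i <;> fin_cases j
          · exact absurd rfl hij
          · exact ⟨0, h0⟩
          · exact ⟨0, h0⟩
          · exact ⟨0, by rw [abs_sub_comm]; exact h0⟩
          · exact absurd rfl hij
          · exact ⟨1, h1⟩
          · exact ⟨0, by rw [abs_sub_comm]; exact h0⟩
          · exact ⟨1, by rw [abs_sub_comm]; exact h1⟩
          · exact absurd rfl hij
      exact isIsotopyLimit_swap_trans hM hsep (i := 0) (j := 1) (k := 2) (by decide) (by decide)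
        (by decide) s1 s2

/-- An overlap of the squares puts `p i - p j + w` into `Λ` with `‖w‖ < 2 * ε`. For small `ε` this
is excluded, when `i ≠ j` because `Λ` is closed and when `i = j` and `w ≠ 0` because it is discrete.
Finiteness of the family makes `ε` uniform. -/
lemma eventually_separated {ι : Type*} [Finite ι] {p : ι → Plane}
    (hp : Function.Injective (proj Λ ∘ p)) : ∀ᶠ ε in 𝓝[>] (0 : ℝ), Separated Λ p ε := by
  have hcl : IsClosed (Λ : Set Plane) := inferInstance
  have key : ∀ i j, ∀ᶠ ε in 𝓝[>] (0 : ℝ), ∀ u ∈ cell ε, ∀ v ∈ cell ε,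
      proj Λ (p i + u) = proj Λ (p j + v) → i = j ∧ u = v := by
    intro i j
    obtain ⟨s, hs, hs2⟩ : ∃ s > 0, ∀ w : Plane, ‖w‖ < s → p i - p j + w ∈ Λ → i = j ∧ w = 0 := by
      by_cases hij : i = j
      · subst hij
        obtain ⟨s, hs, hs2⟩ := Metric.exists_ball_inter_eq_singleton_of_mem_discrete
          (s := (Λ : Set Plane)) ⟨inferInstanceAs (DiscreteTopology Λ)⟩ (x := 0) Λ.zero_mem
        refine ⟨s, hs, fun w hw hwΛ => ⟨rfl, ?_⟩⟩
        rw [sub_self, zero_add] at hwΛ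
        have : w ∈ Metric.ball (0 : Plane) s ∩ Λ := ⟨by simpa using hw, hwΛ⟩
        rw [hs2] at this
        exact this
      · have hn : p i - p j ∈ (Λ : Set Plane)ᶜ := fun h => hij (hp (proj_eq_iff.2 h))
        obtain ⟨s, hs, hs2⟩ := Metric.isOpen_iff.1 hcl.isOpen_compl _ hn
        refine ⟨s, hs, fun w hw hwΛ => absurd hwΛ (hs2 ?_)⟩
        rw [mem_ball_iff_norm]
        simpa using hw
    have h1 : ∀ᶠ ε in 𝓝[>] (0 : ℝ), ε < s / 2 :=
      nhdsWithin_le_nhds (Iio_mem_nhds (by linarith))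
    filter_upwards [h1] with ε hε u hu v hv h
    have h2 : p i - p j + (u - v) ∈ Λ := by
      have := proj_eq_iff.1 h
      rwa [show p i - p j + (u - v) = p i + u - (p j + v) by abel]
    have h3 : ‖u - v‖ < 2 * ε := by
      refine norm_lt_of_forall_abs_lt fun k => ?_
      rw [PiLp.sub_apply, abs_lt]
      have := hu k
      have := hv k
      constructor <;> linarith
    obtain ⟨h4, h5⟩ := hs2 _ (by linarith) h2
    exact ⟨h4, sub_eq_zero.1 h5⟩
  have := (eventually_all (ι := ι)).2 fun i => (eventually_all (ι := ι)).2 (key i)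
  exact this

lemma exists_chart {x : Plane} (hx : proj Λ x ∈ interior M) :
    ∃ r > 0, InjOn (proj Λ) (box x r) ∧ box x r ⊆ proj Λ ⁻¹' interior M := by
  obtain ⟨s, hs, hs2⟩ := Metric.exists_ball_inter_eq_singleton_of_mem_discrete
    (s := (Λ : Set Plane)) ⟨inferInstanceAs (DiscreteTopology Λ)⟩ (x := 0) Λ.zero_mem
  obtain ⟨s', hs', hs2'⟩ := Metric.isOpen_iff.1 (isOpen_interior.preimage continuous_proj) x hx
  have hnorm : ∀ r, ∀ z ∈ box x r, ‖z - x‖ < 2 * r := fun r z hz =>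
    norm_lt_of_forall_abs_lt fun k => by simpa using hz k
  -- A box of half side `r` lies in the ball of radius `2 * r`, so differences of its points have
  -- norm below `4 * r`.
  refine ⟨min (s / 4) (s' / 2), by positivity, ?_, ?_⟩
  · intro y hy z hz hyz
    have h1 := hnorm _ y hy
    have h2 := hnorm _ z hz
    have h3 := min_le_left (s / 4) (s' / 2)
    have h4 := norm_sub_le_norm_sub_add_norm_sub y x z
    rw [norm_sub_rev x z] at h4
    have : y - z ∈ Metric.ball (0 : Plane) s ∩ Λ :=
      ⟨by rw [mem_ball_zero_iff]; linarith, proj_eq_iff.1 hyz⟩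
    rw [hs2] at this
    exact sub_eq_zero.1 this
  · intro z hz
    refine hs2' ?_
    rw [mem_ball_iff_norm]
    have h2 := hnorm _ z hz
    have h3 := min_le_right (s / 4) (s' / 2)
    linarith

/-- Once `ε` is below every nonzero coordinate difference of `x` and `y`, both squares sit in the
chart like squares of one grid. -/
lemma eventually_swap_in_chart (hM : IsBoundedDomain M) {x : Plane} {r : ℝ}
    (hinj : InjOn (proj Λ) (box x r)) (hsub : box x r ⊆ proj Λ ⁻¹' interior M)
    {y : Plane} (hy : y ∈ box x r) (hxy : x ≠ y) :
    ∀ᶠ ε in 𝓝[>] (0 : ℝ), IsIsotopyLimit M (swapMap Λ x y ε) := by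
  have small : ∀ a : ℝ, 0 < a → ∀ᶠ ε in 𝓝[>] (0 : ℝ), ε < a := fun a ha =>
    nhdsWithin_le_nhds (Iio_mem_nhds ha)
  have hr : 0 < r := (abs_nonneg _).trans_lt (hy 0)
  have h1 : ∀ᶠ ε in 𝓝[>] (0 : ℝ), ∀ k, y k + ε < x k + r := by
    rw [eventually_all]
    intro k
    filter_upwards [small (x k + r - y k) (by have := (abs_lt.1 (hy k)).2; linarith)] with ε hε
    linarith
  have h2 : ∀ᶠ ε in 𝓝[>] (0 : ℝ), ∀ k, x k = y k ∨ ε ≤ |x k - y k| := by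
    rw [eventually_all]
    intro k
    by_cases hk : x k = y k
    · exact Eventually.of_forall fun _ => Or.inl hk
    · filter_upwards [small |x k - y k| (abs_pos.2 (sub_ne_zero.2 hk))] with ε hε
      exact Or.inr hε.le
  filter_upwards [h1, h2, small r hr] with ε e1 e2 e3
  refine isIsotopyLimit_swapMap_box hM hinj hsub ?_ ?_ hxy e2
  · intro k
    constructor <;> linarith
  · intro k
    have := (abs_lt.1 (hy k)).1
    exact ⟨by linarith, e1 k⟩

/-- Small squares at any two distinct interior points can be exchanged. -/
lemma eventually_isIsotopyLimit_swapMap (hM : IsBoundedDomain M) {x y : Plane}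
    (hx : proj Λ x ∈ interior M) (hy : proj Λ y ∈ interior M) (hxy : proj Λ x ≠ proj Λ y) :
    ∀ᶠ ε in 𝓝[>] (0 : ℝ), IsIsotopyLimit M (swapMap Λ x y ε) := by
  -- Quantifying over all lifts makes the relation depend on points of the surface only. Coinciding
  -- points are exempt, since a square cannot be exchanged with itself. The relation holds locally
  -- and is transitive and symmetric, so it spreads over the connected interior.
  let P : Surface Λ → Surface Λ → Prop := fun q q' => ∀ x y, proj Λ x = q → proj Λ y = q' →
    q ≠ q' → ∀ᶠ ε in 𝓝[>] (0 : ℝ), IsIsotopyLimit M (swapMap Λ x y ε)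
  suffices h : P (proj Λ x) (proj Λ y) from h x y rfl rfl hxy
  refine hM.connected.isPreconnected.induction₂ P ?_ ?_ ?_ hx hy
  · intro q hq
    obtain ⟨x, rfl⟩ := surjective_proj q
    obtain ⟨r, hr, hinj, hsub⟩ := exists_chart hq
    have hnb : proj Λ '' box x r ∈ 𝓝 (proj Λ x) := by
      refine (isOpenMap_proj _ (isOpen_box x r)).mem_nhds ⟨x, ?_, rfl⟩
      intro k
      simpa using hr
    filter_upwards [nhdsWithin_le_nhds hnb] with q' hq'
    obtain ⟨y, hy, rfl⟩ := hq'
    intro x' y' hx' hy' hne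
    have heq : ∀ ε, swapMap Λ x' y' ε = swapMap Λ x y ε := by
      intro ε
      refine cellPerm_congr ?_ _ _
      rw [Fin.forall_fin_two]
      exact ⟨proj_eq_iff.1 hx', proj_eq_iff.1 hy'⟩
    simp only [heq]
    exact eventually_swap_in_chart hM hinj hsub hy fun h => hne (by rw [h])
  · intro q q' q'' hq hq' hq'' h1 h2 x z hx hz hne
    by_cases e1 : q = q'
    · exact h2 x z (hx.trans e1) hz (e1 ▸ hne)
    by_cases e2 : q' = q''
    · exact h1 x z hx (hz.trans e2.symm) e1
    obtain ⟨y, hy⟩ := surjective_proj q'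
    have hsep : ∀ᶠ ε in 𝓝[>] (0 : ℝ), Separated Λ ![x, y, z] ε := by
      refine eventually_separated ?_
      intro i j hij
      have hne1 : proj Λ x ≠ proj Λ y := by rwa [hx, hy]
      have hne2 : proj Λ y ≠ proj Λ z := by rwa [hy, hz]
      have hne3 : proj Λ x ≠ proj Λ z := by rwa [hx, hz]
      fin_cases i <;> fin_cases j
      · rfl
      · exact absurd hij hne1
      · exact absurd hij hne3
      · exact absurd hij.symm hne1
      · rfl
      · exact absurd hij hne2
      · exact absurd hij.symm hne3
      · exact absurd hij.symm hne2
      · rfl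
    filter_upwards [hsep, h1 x y hx hy e1, h2 y z hy hz e2] with ε hs s1 s2
    exact isIsotopyLimit_swap_trans hM hs (i := 0) (j := 1) (k := 2) (by decide) (by decide)
      (by decide) s1 s2
  · intro q q' hq hq' h x y hx hy hne
    have hsep : ∀ᶠ ε in 𝓝[>] (0 : ℝ), Separated Λ ![x, y] ε := by
      refine eventually_separated ?_
      have hne1 : proj Λ x ≠ proj Λ y := by rw [hx, hy]; exact hne
      intro i j hij
      fin_cases i <;> fin_cases j
      · rfl
      · exact absurd hij hne1
      · exact absurd hij.symm hne1
      · rfl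
    filter_upwards [hsep, h y x hy hx hne.symm] with ε hs h1
    rwa [swapMap_comm _ _ hs]

end Connectivity

/-! ### Approximate majorization of finite vectors. -/

section FiniteMajorization

variable {ι : Type*} [Fintype ι]

/-- A permutation maximizing `∑ i, d i * a (σ i)` works: exchanging two wrongly ordered values would
increase the sum. -/
lemma exists_perm_monovary (a d : ι → ℝ) :
    ∃ σ : Equiv.Perm ι, ∀ i j, d j < d i → a (σ j) ≤ a (σ i) := by
  classical
  obtain ⟨σ, hσ⟩ := Finite.exists_max (fun σ : Equiv.Perm ι => ∑ i, d i * a (σ i))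
  refine ⟨σ, fun i j hd => ?_⟩
  by_contra! hlt
  have hij : i ≠ j := by rintro rfl; exact lt_irrefl _ hd
  have h1 := hσ (σ * Equiv.swap i j)
  have h2 : ∑ k, (d k * a ((σ * Equiv.swap i j) k) - d k * a (σ k)) =
      (d i * a (σ j) - d i * a (σ i)) + (d j * a (σ i) - d j * a (σ j)) := by
    rw [Fintype.sum_eq_add i j hij]
    · simp
    · rintro k ⟨hki, hkj⟩
      simp [Equiv.swap_apply_of_ne_of_ne hki hkj]
  rw [Finset.sum_sub_distrib] at h2
  nlinarith

/-- Layer-cake formula: `∑ i, (d i + D) * e i` is the integral over `t` from `-D` to `D` of the sums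
of `e` over `t ≤ d i`, hence at most `2 * D * δ`. Removing the shift by `D` costs another `D * δ`.
-/
lemma sum_mul_le_of_upper_sums {d e : ι → ℝ} {D δ : ℝ} (hD : ∀ i, |d i| ≤ D) (hD0 : 0 ≤ D)
    (h1 : ∀ t, ∑ i with t ≤ d i, e i ≤ δ) (h2 : -δ ≤ ∑ i, e i) :
    ∑ i, d i * e i ≤ 3 * D * δ := by
  have hint : ∀ i, ∫ t in (-D)..D, indicator {t | t ≤ d i} (fun _ => e i) t = (d i + D) * e i := by
    intro i
    rw [intervalIntegral.integral_indicator ⟨by linarith [(abs_le.1 (hD i)).1],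
      (abs_le.1 (hD i)).2⟩]
    simp
  have hii : ∀ i, IntervalIntegrable (indicator {t | t ≤ d i} (fun _ => e i)) volume (-D) D := by
    intro i
    rw [intervalIntegrable_iff]
    exact (integrableOn_const (by simp)).indicator measurableSet_Iic
  have h3 : ∑ i, (d i + D) * e i ≤ 2 * D * δ := by
    calc ∑ i, (d i + D) * e i = ∫ t in (-D)..D, ∑ i, indicator {t | t ≤ d i} (fun _ => e i) t := by
          rw [intervalIntegral.integral_finsetSum fun i _ => hii i]
          exact Finset.sum_congr rfl fun i _ => (hint i).symm
      _ ≤ ∫ _ in (-D)..D, δ := by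
          refine intervalIntegral.integral_mono_on (by linarith) ?_ intervalIntegrable_const ?_
          · rw [intervalIntegrable_iff]
            exact integrable_finsetSum _ fun i _ => intervalIntegrable_iff.1 (hii i)
          · intro t _
            refine le_trans (le_of_eq ?_) (h1 t)
            rw [Finset.sum_filter]
            rfl
      _ = 2 * D * δ := by rw [intervalIntegral.integral_const, smul_eq_mul]; ring
  have h4 : ∑ i, (d i + D) * e i = ∑ i, d i * e i + D * ∑ i, e i := by
    rw [Finset.mul_sum, ← Finset.sum_add_distrib]
    exact Finset.sum_congr rfl fun i _ => by ring
  nlinarith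

/-- An approximate form of the rearrangement inequality of Hardy, Littlewood and Pólya. -/
lemma exists_perm_sum_mul_le {a b d : ι → ℝ} {D δ : ℝ} (hδ : 0 ≤ δ) (ha : ∀ i, |a i| ≤ 1)
    (hD : ∀ i, |d i| ≤ D) (hD0 : 0 ≤ D)
    (h1 : ∀ c, |c| ≤ 1 → ∀ I : Finset ι, ∑ i ∈ I, (b i - c) ≤ ∑ i, max (a i - c) 0 + δ)
    (h2 : ∑ i, a i - δ ≤ ∑ i, b i) :
    ∃ σ : Equiv.Perm ι, ∑ i, d i * b i ≤ ∑ i, d i * a (σ i) + 3 * D * δ := by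
  obtain ⟨σ, hσ⟩ := exists_perm_monovary a d
  refine ⟨σ, ?_⟩
  have key : ∑ i, d i * (b i - a (σ i)) ≤ 3 * D * δ := by
    refine sum_mul_le_of_upper_sums hD hD0 ?_ ?_
    · intro t
      set I : Finset ι := Finset.univ.filter fun i => t ≤ d i with hI
      rcases I.eq_empty_or_nonempty with hemp | hne
      · rw [hemp, Finset.sum_empty]; exact hδ
      obtain ⟨i₀, hi₀, hmin⟩ := I.exists_min_image (fun i => a (σ i)) hne
      -- With `c` the least rearranged value on `I`, all values off `I` are at most `c`. The sum of
      -- positive parts is then exactly the sum over `I`, and the terms in `c` cancel.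
      set c := a (σ i₀) with hc
      have h3 := h1 c (ha _) I
      have h4 : ∑ i, max (a i - c) 0 = ∑ i ∈ I, (a (σ i) - c) := by
        rw [← Equiv.sum_comp σ]
        symm
        rw [← Finset.sum_subset (Finset.subset_univ I)]
        · refine Finset.sum_congr rfl fun i hi => ?_
          rw [max_eq_left]
          have := hmin i hi
          linarith
        · intro k _ hk
          have hdk : d k < t := by simpa [hI] using hk
          have hdi : t ≤ d i₀ := by simpa [hI] using hi₀
          have := hσ i₀ k (hdk.trans_le hdi)
          rw [max_eq_right]
          linarith
      rw [h4] at h3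
      rw [Finset.sum_sub_distrib] at h3 ⊢
      rw [Finset.sum_sub_distrib] at h3
      linarith
    · rw [Finset.sum_sub_distrib, Equiv.sum_comp σ a]
      linarith
  have : ∑ i, d i * (b i - a (σ i)) = ∑ i, d i * b i - ∑ i, d i * a (σ i) := by
    rw [← Finset.sum_sub_distrib]
    exact Finset.sum_congr rfl fun i _ => by ring
  linarith

/-- `b` is projected onto the convex hull of the permutations of `a`. If the residual `e` were
large, the linear functional `e` would separate `b` from all permutations of `a`, which the
approximate rearrangement inequality forbids. -/
lemma exists_weights_close [DecidableEq ι] {a b : ι → ℝ} {δ : ℝ} (hδ : 0 ≤ δ) (ha : ∀ i, |a i| ≤ 1)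
    (hb : ∀ i, |b i| ≤ 1)
    (h1 : ∀ c, |c| ≤ 1 → ∀ I : Finset ι, ∑ i ∈ I, (b i - c) ≤ ∑ i, max (a i - c) 0 + δ)
    (h2 : ∑ i, a i - δ ≤ ∑ i, b i) :
    ∃ w ∈ stdSimplex ℝ (Equiv.Perm ι),
      ∑ i, (b i - ∑ σ : Equiv.Perm ι, w σ * a (σ i)) ^ 2 ≤ 6 * δ := by
  classical
  let L : (Equiv.Perm ι → ℝ) →ₗ[ℝ] EuclideanSpace ℝ ι :=
    { toFun := fun w => WithLp.toLp 2 fun i => ∑ σ, w σ * a (σ i)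
      map_add' := fun v w => by
        ext i
        simp [add_mul, Finset.sum_add_distrib]
      map_smul' := fun c w => by
        ext i
        simp [mul_assoc, Finset.mul_sum] }
  set K := L '' stdSimplex ℝ (Equiv.Perm ι) with hK
  have hKc : Convex ℝ K := (convex_stdSimplex ℝ _).linear_image L
  have hKcomp : IsCompact K :=
    (isCompact_stdSimplex ℝ _).image L.continuous_of_finiteDimensional
  have hKne : K.Nonempty := ⟨_, mem_image_of_mem L (single_mem_stdSimplex ℝ (1 : Equiv.Perm ι))⟩
  set β : EuclideanSpace ℝ ι := WithLp.toLp 2 b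
  obtain ⟨p, hpK, hp⟩ := exists_norm_eq_iInf_of_complete_convex hKne hKcomp.isComplete hKc β
  rw [norm_eq_iInf_iff_real_inner_le_zero hKc hpK] at hp
  obtain ⟨w, hw, rfl⟩ := hpK
  refine ⟨w, hw, ?_⟩
  set e : ι → ℝ := fun i => b i - ∑ σ : Equiv.Perm ι, w σ * a (σ i) with he
  have hLe : ∀ i, |∑ σ : Equiv.Perm ι, w σ * a (σ i)| ≤ 1 := by
    intro i
    calc |∑ σ : Equiv.Perm ι, w σ * a (σ i)| ≤ ∑ σ : Equiv.Perm ι, |w σ * a (σ i)| :=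
          Finset.abs_sum_le_sum_abs _ _
      _ ≤ ∑ σ : Equiv.Perm ι, w σ := by
          refine Finset.sum_le_sum fun σ _ => ?_
          rw [abs_mul, abs_of_nonneg (hw.1 σ)]
          exact mul_le_of_le_one_right (hw.1 σ) (ha _)
      _ = 1 := hw.2
  -- The residual is a difference of vectors bounded by one, so `D = 2` and the bound `3 * D * δ`
  -- becomes `6 * δ`. The variational inequality of the projection, tested at this permutation,
  -- gives the same bound for the squared residual.
  obtain ⟨σ, hσ⟩ := exists_perm_sum_mul_le (d := e) (D := 2) hδ ha (fun i => by
    have h3 := abs_le.1 (hb i)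
    have h4 := abs_le.1 (hLe i)
    rw [abs_le]; constructor <;> simp only [he] <;> linarith) (by norm_num) h1 h2
  have h5 := hp _ (mem_image_of_mem L (single_mem_stdSimplex ℝ σ))
  have hLs : ∀ i, L (Pi.single σ 1) i = a (σ i) := by
    intro i
    change ∑ τ, (Pi.single σ 1 : Equiv.Perm ι → ℝ) τ * a (τ i) = _
    rw [Finset.sum_eq_single σ] <;> simp +contextual
  have h6 : inner ℝ (β - L w) (L (Pi.single σ 1) - L w) =
      ∑ i, e i * (a (σ i) - ∑ σ : Equiv.Perm ι, w σ * a (σ i)) := by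
    rw [PiLp.inner_apply]
    refine Finset.sum_congr rfl fun i _ => ?_
    rw [PiLp.sub_apply, PiLp.sub_apply, hLs]
    simp only [RCLike.inner_apply, conj_trivial]
    rw [mul_comm]
    rfl
  rw [h6] at h5
  have h7 : ∑ i, (b i - ∑ σ : Equiv.Perm ι, w σ * a (σ i)) ^ 2 =
      (∑ i, e i * b i - ∑ i, e i * a (σ i)) +
        ∑ i, e i * (a (σ i) - ∑ σ : Equiv.Perm ι, w σ * a (σ i)) := by
    rw [← Finset.sum_sub_distrib, ← Finset.sum_add_distrib]
    refine Finset.sum_congr rfl fun i _ => ?_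
    simp only [he]
    ring
  linarith

/-- Each target `N * w k` is rounded down and that many elements are assigned to `k`; the leftovers
go to one fixed index. They are at most as many as there are indices, and so is the total rounding
loss, whence the factor two. -/
lemma exists_fun_fiber_card {κ F : Type*} [Fintype κ] [DecidableEq κ] [Nonempty κ] [Fintype F]
    {w : κ → ℝ} (hw : w ∈ stdSimplex ℝ κ) :
    ∃ s : F → κ, ∑ k, |((Finset.univ.filter fun f => s f = k).card : ℝ) - Fintype.card F * w k| ≤
      2 * Fintype.card κ := by
  classical
  set N : ℝ := (Fintype.card F : ℝ) with hN
  set n : κ → ℕ := fun k => ⌊N * w k⌋₊ with hn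
  have hpos : ∀ k, 0 ≤ N * w k := fun k => mul_nonneg (Nat.cast_nonneg _) (hw.1 k)
  have hn1 : ∀ k, (n k : ℝ) ≤ N * w k := fun k => Nat.floor_le (hpos k)
  have hn2 : ∀ k, N * w k < n k + 1 := fun k => Nat.lt_floor_add_one _
  have hsumw : ∑ k, N * w k = N := by rw [← Finset.mul_sum, hw.2, mul_one]
  have hcard : Fintype.card (Σ k, Fin (n k)) ≤ Fintype.card F := by
    rw [Fintype.card_sigma]
    simp only [Fintype.card_fin]
    have : ((∑ k, n k : ℕ) : ℝ) ≤ Fintype.card F := by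
      rw [Nat.cast_sum]
      exact (Finset.sum_le_sum fun k _ => hn1 k).trans hsumw.le
    exact_mod_cast this
  obtain ⟨g⟩ := Function.Embedding.nonempty_of_card_le hcard
  obtain ⟨k₀⟩ := ‹Nonempty κ›
  refine ⟨Function.extend g Sigma.fst (fun _ => k₀), ?_⟩
  set s : F → κ := Function.extend g Sigma.fst (fun _ => k₀)
  set m : κ → ℕ := fun k => (Finset.univ.filter fun f => s f = k).card
  have hm : ∀ k, n k ≤ m k := by
    intro k
    have h1 : (Finset.univ.image fun j : Fin (n k) => g ⟨k, j⟩) ⊆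
        Finset.univ.filter fun f => s f = k := by
      intro f hf
      obtain ⟨j, -, rfl⟩ := Finset.mem_image.1 hf
      simp [s, g.injective.extend_apply]
    have h2 := Finset.card_le_card h1
    rwa [Finset.card_image_of_injective, Finset.card_univ, Fintype.card_fin] at h2
    intro i j hij
    simpa using g.injective hij
  have hmsum : ∑ k, (m k : ℝ) = N := by
    rw [hN, ← Nat.cast_sum]
    congr 1
    rw [← Finset.card_univ, Finset.card_eq_sum_card_fiberwise (f := s) (t := Finset.univ)]
    simp
  have hb : ∀ k, |(m k : ℝ) - N * w k| ≤ (m k - n k) + (N * w k - n k) := by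
    intro k
    have h1 : (n k : ℝ) ≤ m k := by exact_mod_cast hm k
    have h2 := hn1 k
    rw [abs_le]
    constructor <;> linarith
  have hfin : ∑ k, (N * w k - n k) ≤ Fintype.card κ := by
    calc ∑ k, (N * w k - n k) ≤ ∑ _k : κ, (1 : ℝ) :=
          Finset.sum_le_sum fun k _ => by linarith [hn2 k]
      _ = Fintype.card κ := by simp
  calc ∑ k, |(m k : ℝ) - N * w k| ≤ ∑ k, ((m k - n k) + (N * w k - n k)) :=
        Finset.sum_le_sum fun k _ => hb k
    _ = 2 * ∑ k, (N * w k - n k) := by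
        rw [Finset.sum_add_distrib, Finset.sum_sub_distrib, Finset.sum_sub_distrib, hmsum, hsumw]
        ring
    _ ≤ 2 * Fintype.card κ := by linarith

/-- If `b` is approximately majorized by `a`, then `b` is approximated by averages of
permutations of `a`. -/
lemma exists_average_of_perms_close [DecidableEq ι] {a b : ι → ℝ} {δ : ℝ} (hδ : 0 ≤ δ) (ha : ∀ i, |a i| ≤ 1)
    (hb : ∀ i, |b i| ≤ 1)
    (h1 : ∀ c, |c| ≤ 1 → ∀ I : Finset ι, ∑ i ∈ I, (b i - c) ≤ ∑ i, max (a i - c) 0 + δ)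
    (h2 : ∑ i, a i - δ ≤ ∑ i, b i) :
    ∃ p : ι → ℝ, ∑ i, (b i - p i) ^ 2 ≤ 6 * δ ∧ ∃ C : ℝ, ∀ (F : Type) [Fintype F],
      ∃ s : F → Equiv.Perm ι, ∀ i, |∑ f, a (s f i) - Fintype.card F * p i| ≤ C := by
  classical
  obtain ⟨w, hw, hwb⟩ := exists_weights_close hδ ha hb h1 h2
  -- The error is independent of `F`, so after division by the number of pieces it tends to zero
  -- under refinement.
  refine ⟨_, hwb, 2 * Fintype.card (Equiv.Perm ι), fun F _ => ?_⟩
  obtain ⟨s, hs⟩ := exists_fun_fiber_card (F := F) hw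
  refine ⟨s, fun i => le_trans ?_ hs⟩
  have h3 : ∑ f, a (s f i) =
      ∑ σ : Equiv.Perm ι, ((Finset.univ.filter fun f => s f = σ).card : ℝ) * a (σ i) := by
    rw [← Finset.sum_fiberwise_of_maps_to (g := s) (t := Finset.univ) (fun _ _ => Finset.mem_univ _)]
    refine Finset.sum_congr rfl fun σ _ => ?_
    rw [Finset.sum_congr rfl (g := fun _ => a (σ i)), Finset.sum_const, nsmul_eq_mul]
    intro f hf
    rw [(Finset.mem_filter.1 hf).2]
  rw [h3, Finset.mul_sum, ← Finset.sum_sub_distrib]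
  refine (Finset.abs_sum_le_sum_abs _ _).trans (Finset.sum_le_sum fun σ _ => ?_)
  rw [← mul_assoc, ← sub_mul, abs_mul]
  exact mul_le_of_le_one_right (abs_nonneg _) (ha _)

end FiniteMajorization

/-! ### Square grids, their subdivisions, and permutations of the small squares. -/

section Grid

/-- The grid point `h k` of the grid of mesh `h`. -/
noncomputable def corner (h : ℝ) (k : Fin 2 → ℤ) : Plane := WithLp.toLp 2 fun i => h * k i

/-- The centre of the grid square with corner `h k`. -/
noncomputable def cellCenter (h : ℝ) (k : Fin 2 → ℤ) : Plane :=
  WithLp.toLp 2 fun i => h * k i + h / 2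

/-- The grid squares of mesh `h` whose concentric open squares of double size lie in `V`. -/
def gridIndex (V : Set Plane) (h : ℝ) : Set (Fin 2 → ℤ) := {k | box (cellCenter h k) h ⊆ V}

/-- The grid square with corner `h k`. -/
def gridCell (h : ℝ) (k : Fin 2 → ℤ) : Set Plane := {z | ∀ i, h * k i ≤ z i ∧ z i < h * k i + h}

lemma corner_add_mem_gridCell {h : ℝ} {k : Fin 2 → ℤ} {u : Plane} (hu : u ∈ cell h) :
    corner h k + u ∈ gridCell h k := by
  intro i
  have := hu i
  simp only [corner, PiLp.add_apply]
  constructor <;> linarith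

lemma sub_corner_mem_cell {h : ℝ} {k : Fin 2 → ℤ} {z : Plane} (hz : z ∈ gridCell h k) :
    z - corner h k ∈ cell h := by
  intro i
  have := hz i
  simp only [corner, PiLp.sub_apply]
  constructor <;> linarith

lemma gridCell_subset_box {h : ℝ} (hh : 0 < h) (k : Fin 2 → ℤ) :
    gridCell h k ⊆ box (cellCenter h k) h := by
  intro z hz i
  have := hz i
  simp only [cellCenter]
  rw [abs_lt]
  constructor <;> linarith

lemma measurableSet_gridCell (h : ℝ) (k : Fin 2 → ℤ) : MeasurableSet (gridCell h k) := by
  have : gridCell h k = ⋂ i, {z : Plane | h * k i ≤ z i ∧ z i < h * k i + h} := by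
    ext x; simp [gridCell]
  rw [this]
  refine MeasurableSet.iInter fun i => ?_
  have hm : Measurable fun z : Plane => z i := (PiLp.continuous_apply 2 _ i).measurable
  exact (measurableSet_le measurable_const hm).inter (measurableSet_lt hm measurable_const)

lemma volume_gridCell {h : ℝ} (hh : 0 ≤ h) (k : Fin 2 → ℤ) :
    volume (gridCell h k) = ENNReal.ofReal (h ^ 2) := by
  have h1 := (EuclideanSpace.volume_preserving_symm_measurableEquiv_toLp (Fin 2)).measure_preimage
    (s := Set.pi univ fun i : Fin 2 => Ico (h * k i) (h * k i + h))
    (MeasurableSet.univ_pi fun i => measurableSet_Ico).nullMeasurableSet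
  have h2 : (MeasurableEquiv.toLp 2 (Fin 2 → ℝ)).symm ⁻¹'
      (Set.pi univ fun i : Fin 2 => Ico (h * k i) (h * k i + h)) = gridCell h k := by
    ext z
    simp [gridCell]
  rw [h2, volume_pi_pi] at h1
  rw [h1, Fin.prod_univ_two]
  simp only [Real.volume_Ico, add_sub_cancel_left]
  rw [← ENNReal.ofReal_mul hh, sq]

lemma int_eq_of_mul_add_eq {ε u v : ℝ} {m m' : ℤ} (hu : 0 ≤ u ∧ u < ε) (hv : 0 ≤ v ∧ v < ε)
    (h : ε * m + u = ε * m' + v) : m = m' := by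
  have hε : 0 < ε := hu.1.trans_lt hu.2
  have h1 : ε * (m - m' : ℝ) < ε * 1 := by linarith [hu.1, hv.2]
  have h2 : ε * (m' - m : ℝ) < ε * 1 := by linarith [hu.2, hv.1]
  have h3 := lt_of_mul_lt_mul_left h1 hε.le
  have h4 := lt_of_mul_lt_mul_left h2 hε.le
  have h5 : m - m' < 1 := by exact_mod_cast h3
  have h6 : m' - m < 1 := by exact_mod_cast h4
  omega

lemma gridCell_index_unique {h : ℝ} {k k' : Fin 2 → ℤ} {z : Plane} (hz : z ∈ gridCell h k)
    (hz' : z ∈ gridCell h k') : k = k' := by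
  funext i
  have h1 := sub_corner_mem_cell hz i
  have h2 := sub_corner_mem_cell hz' i
  refine int_eq_of_mul_add_eq h1 h2 ?_
  simp [corner]

lemma finite_gridIndex {V : Set Plane} (hV : Bornology.IsBounded V) {h : ℝ} (hh : 0 < h) :
    (gridIndex V h).Finite := by
  obtain ⟨R, hR⟩ := hV.subset_ball 0
  obtain ⟨m, hm⟩ := exists_nat_gt (R / h)
  refine (Set.finite_Icc (fun _ : Fin 2 => -(m : ℤ)) (fun _ => (m : ℤ))).subset ?_
  intro k hk
  have h0 : (0 : Plane) ∈ cell h := fun i => by simpa using hh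
  have h1 : corner h k + 0 ∈ Metric.ball (0 : Plane) R :=
    hR (hk (gridCell_subset_box hh k (corner_add_mem_gridCell h0)))
  rw [add_zero, mem_ball_zero_iff] at h1
  have h2 : ∀ i, |h * k i| < h * m := by
    intro i
    rw [div_lt_iff₀ hh] at hm
    have := PiLp.norm_apply_le (corner h k) i
    rw [Real.norm_eq_abs] at this
    change |h * k i| ≤ _ at this
    linarith
  have h3 : ∀ i, |(k i : ℝ)| < m := by
    intro i
    have := h2 i
    rw [abs_mul, abs_of_pos hh] at this
    exact lt_of_mul_lt_mul_left this hh.le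
  constructor
  · intro i
    have := (abs_lt.1 (h3 i)).1
    have h4 : (-(m : ℤ) : ℤ) < k i := by exact_mod_cast this
    exact h4.le
  · intro i
    have := (abs_lt.1 (h3 i)).2
    have h4 : k i < (m : ℤ) := by exact_mod_cast this
    exact h4.le

/-- The grid squares inside an open set of finite area cover it up to small area. -/
lemma exists_grid_cover {V : Set Plane} (hV : IsOpen V) (hfin : volume V ≠ ⊤) {η : ENNReal}
    (hη : 0 < η) : ∃ h₀ > 0, ∀ h, 0 < h → h < h₀ →
      volume (V \ ⋃ k ∈ gridIndex V h, gridCell h k) ≤ η := by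
  have hfm : IsFiniteMeasure (volume.restrict V) := ⟨by simpa using hfin.lt_top⟩
  have hlim := tendsto_measure_thickening_of_isClosed (μ := volume.restrict V) (s := Vᶜ)
    ⟨1, one_pos, measure_ne_top _ _⟩ hV.isClosed_compl
  have h0 : (volume.restrict V) Vᶜ = 0 := by
    rw [Measure.restrict_apply hV.measurableSet.compl]; simp
  rw [h0] at hlim
  obtain ⟨r, hr, hr0⟩ := ((hlim.eventually (gt_mem_nhds hη)).and self_mem_nhdsWithin).exists
  have hr0' : 0 < r := hr0
  -- A point whose cell is not in the grid family lies within `4 * h` of the complement of `V`,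
  -- since the double box of its cell leaves `V`. It therefore lies in the `r`-thickening, which has
  -- small area in `V`.
  refine ⟨r / 4, by positivity, fun h hh hhr => ?_⟩
  refine le_trans ?_ hr.le
  rw [Measure.restrict_apply Metric.isOpen_thickening.measurableSet]
  refine measure_mono ?_
  rintro z ⟨hzV, hz⟩
  refine ⟨?_, hzV⟩
  by_contra hthick
  apply hz
  set k : Fin 2 → ℤ := fun i => ⌊z i / h⌋ with hk
  have hzk : z ∈ gridCell h k := by
    intro i
    have h1 := Int.floor_le (z i / h)
    have h2 := Int.lt_floor_add_one (z i / h)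
    rw [le_div_iff₀ hh] at h1
    rw [div_lt_iff₀ hh] at h2
    simp only [hk]
    constructor <;> linarith
  refine mem_iUnion₂.2 ⟨k, ?_, hzk⟩
  intro w hw
  by_contra hwV
  apply hthick
  rw [Metric.mem_thickening_iff]
  refine ⟨w, hwV, ?_⟩
  rw [dist_eq_norm]
  have : ‖z - w‖ < 2 * (2 * h) := by
    refine norm_lt_of_forall_abs_lt fun i => ?_
    have h1 := abs_lt.1 (gridCell_subset_box hh k hzk i)
    have h2 := abs_lt.1 (hw i)
    rw [PiLp.sub_apply, abs_lt]
    constructor <;> linarith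
  linarith

/-- The corner of the square `f` in the subdivision of the grid square `k` into `n²` squares. -/
noncomputable def fineCorner (V : Set Plane) (h : ℝ) (n : ℕ)
    (a : gridIndex V h × (Fin 2 → Fin n)) : Plane :=
  corner (h / n) fun i => n * (a.1 : Fin 2 → ℤ) i + (a.2 i : ℕ)

lemma fineCorner_apply (V : Set Plane) {h : ℝ} {n : ℕ} (hn : 0 < n)
    (a : gridIndex V h × (Fin 2 → Fin n)) (i : Fin 2) :
    fineCorner V h n a i = h * (a.1 : Fin 2 → ℤ) i + h / n * (a.2 i : ℕ) := by
  have : (n : ℝ) ≠ 0 := by positivity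
  simp only [fineCorner, corner]
  push_cast
  field_simp

lemma fineCorner_bounds (V : Set Plane) {h : ℝ} (hh : 0 < h) {n : ℕ} (hn : 0 < n)
    (a : gridIndex V h × (Fin 2 → Fin n)) (i : Fin 2) :
    h * (a.1 : Fin 2 → ℤ) i ≤ fineCorner V h n a i ∧
      fineCorner V h n a i + h / n ≤ h * (a.1 : Fin 2 → ℤ) i + h := by
  have hn' : (0 : ℝ) < n := by positivity
  have h1 : ((a.2 i : ℕ) : ℝ) + 1 ≤ n := by exact_mod_cast (a.2 i).2
  rw [fineCorner_apply V hn]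
  constructor
  · have : 0 ≤ h / n * ((a.2 i : ℕ) : ℝ) := by positivity
    linarith
  · have h2 : h / n * (((a.2 i : ℕ) : ℝ) + 1) ≤ h / n * n := by gcongr
    rw [div_mul_cancel₀ h hn'.ne'] at h2
    linarith

lemma fineCorner_add_mem (V : Set Plane) {h : ℝ} (hh : 0 < h) {n : ℕ} (hn : 0 < n)
    (a : gridIndex V h × (Fin 2 → Fin n)) {u : Plane} (hu : u ∈ cell (h / n)) :
    fineCorner V h n a + u ∈ gridCell h a.1 := by
  intro i
  have h1 := fineCorner_bounds V hh hn a i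
  have h2 := hu i
  rw [PiLp.add_apply]
  constructor <;> linarith

lemma exists_fineCorner_add_eq (V : Set Plane) {h : ℝ} (hh : 0 < h) {n : ℕ} (hn : 0 < n)
    (k : gridIndex V h) {z : Plane} (hz : z ∈ gridCell h k) :
    ∃ f : Fin 2 → Fin n, ∃ u ∈ cell (h / n), fineCorner V h n (k, f) + u = z := by
  have hn' : (0 : ℝ) < n := by positivity
  have hε : 0 < h / n := by positivity
  set m : Fin 2 → ℕ := fun i => ⌊(z i - h * (k : Fin 2 → ℤ) i) / (h / n)⌋₊ with hm
  have h0 : ∀ i, 0 ≤ (z i - h * (k : Fin 2 → ℤ) i) / (h / n) := fun i =>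
    div_nonneg (by linarith [(hz i).1]) hε.le
  have hmn : ∀ i, m i < n := by
    intro i
    rw [hm, Nat.floor_lt (h0 i), div_lt_iff₀ hε, mul_div_cancel₀ h hn'.ne']
    linarith [(hz i).2]
  refine ⟨fun i => ⟨m i, hmn i⟩, z - fineCorner V h n (k, fun i => ⟨m i, hmn i⟩), ?_, by abel⟩
  intro i
  have h1 := Nat.floor_le (h0 i)
  have h2 := Nat.lt_floor_add_one ((z i - h * (k : Fin 2 → ℤ) i) / (h / n))
  rw [le_div_iff₀ hε] at h1
  rw [div_lt_iff₀ hε] at h2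
  rw [PiLp.sub_apply, fineCorner_apply V hn]
  simp only [hm]
  constructor <;> linarith

variable {Λ : AddSubgroup Plane}

lemma separated_fineCorner {V : Set Plane} (hinj : InjOn (proj Λ) V) {h : ℝ} (hh : 0 < h) {n : ℕ}
    (hn : 0 < n) : Separated Λ (fineCorner V h n) (h / n) := by
  intro a b u hu v hv hab
  have hmem : ∀ (a : gridIndex V h × (Fin 2 → Fin n)), ∀ u ∈ cell (h / n),
      fineCorner V h n a + u ∈ V := fun a u hu =>
    a.1.2 (gridCell_subset_box hh _ (fineCorner_add_mem V hh hn a hu))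
  have h1 := hinj (hmem a u hu) (hmem b v hv) hab
  -- Both fine squares belong to the grid of mesh `h / n`; Euclidean division by `n` then recovers
  -- the coarse index and the position in the subdivision.
  have hidx : ∀ i, (n * (a.1 : Fin 2 → ℤ) i + (a.2 i : ℕ) : ℤ) =
      n * (b.1 : Fin 2 → ℤ) i + (b.2 i : ℕ) := by
    intro i
    refine int_eq_of_mul_add_eq (hu i) (hv i) ?_
    have : (fineCorner V h n a + u) i = (fineCorner V h n b + v) i := by rw [h1]
    exact this
  have hq : ∀ i, (a.1 : Fin 2 → ℤ) i = (b.1 : Fin 2 → ℤ) i ∧ (a.2 i : ℕ) = b.2 i := by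
    intro i
    have e1 := hidx i
    have ha := (a.2 i).2
    have hb := (b.2 i).2
    have hn0 : (0 : ℤ) < n := by exact_mod_cast hn
    have e2 : (a.1 : Fin 2 → ℤ) i = (b.1 : Fin 2 → ℤ) i := by
      have h3 : (n * (a.1 : Fin 2 → ℤ) i + (a.2 i : ℕ) : ℤ) / n = (a.1 : Fin 2 → ℤ) i := by
        rw [Int.mul_add_ediv_left _ _ hn0.ne', Int.ediv_eq_zero_of_lt (by positivity)
          (by exact_mod_cast ha), add_zero]
      have h4 : (n * (b.1 : Fin 2 → ℤ) i + (b.2 i : ℕ) : ℤ) / n = (b.1 : Fin 2 → ℤ) i := by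
        rw [Int.mul_add_ediv_left _ _ hn0.ne', Int.ediv_eq_zero_of_lt (by positivity)
          (by exact_mod_cast hb), add_zero]
      rw [← h3, e1, h4]
    refine ⟨e2, ?_⟩
    rw [e2] at e1
    exact_mod_cast add_left_cancel e1
  have hab' : a = b := by
    refine Prod.ext (Subtype.ext (funext fun i => (hq i).1)) (funext fun i => Fin.ext (hq i).2)
  refine ⟨hab', ?_⟩
  rw [hab'] at h1
  exact add_left_cancel h1

variable [DiscreteTopology Λ] {M : Set (Surface Λ)}

/-- All permutations of the squares of a fine enough subdivision are limits of isotopies. -/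
lemma eventually_isIsotopyLimit_fine_perm (hM : IsBoundedDomain M) {V : Set Plane}
    (hinj : InjOn (proj Λ) V) (hVM : V ⊆ proj Λ ⁻¹' interior M) (hVb : Bornology.IsBounded V)
    {h : ℝ} (hh : 0 < h) :
    ∀ᶠ n : ℕ in atTop, 0 < n ∧ ∀ τ : Equiv.Perm (gridIndex V h × (Fin 2 → Fin n)),
      IsIsotopyLimit M (cellPerm Λ (fineCorner V h n) (h / n) τ) := by
  have hfin : Finite (gridIndex V h) := finite_gridIndex hVb hh
  have hcV : ∀ k ∈ gridIndex V h, corner h k ∈ V := by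
    intro k hk
    have h0 : (0 : Plane) ∈ cell h := fun i => by simpa using hh
    have := gridCell_subset_box hh k (corner_add_mem_gridCell h0)
    rw [add_zero] at this
    exact hk this
  -- Exchanges between different coarse cells hold only for small `ε`, with a threshold depending on
  -- the two points. They are needed only at the coarse corners, of which there are finitely many,
  -- whatever `n` is.
  have hev : ∀ᶠ ε in 𝓝[>] (0 : ℝ), ∀ k k' : gridIndex V h, k ≠ k' →
      IsIsotopyLimit M (swapMap Λ (corner h k) (corner h k') ε) := by
    rw [eventually_all]; intro k
    rw [eventually_all]; intro k'
    by_cases hkk : k = k'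
    · exact Eventually.of_forall fun _ hne => absurd hkk hne
    · refine (eventually_isIsotopyLimit_swapMap hM (hVM (hcV k k.2)) (hVM (hcV k' k'.2)) ?_).mono
        fun ε hε _ => hε
      intro heq
      have h1 := hinj (hcV k k.2) (hcV k' k'.2) heq
      apply hkk
      refine Subtype.ext (funext fun i => ?_)
      have h2 : h * ((k : Fin 2 → ℤ) i : ℝ) = h * ((k' : Fin 2 → ℤ) i : ℝ) := by
        have : corner h k i = corner h k' i := by rw [h1]
        exact this
      exact_mod_cast mul_left_cancel₀ hh.ne' h2
  have hlim : Tendsto (fun n : ℕ => h / n) atTop (𝓝[>] 0) := by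
    rw [tendsto_nhdsWithin_iff]
    refine ⟨tendsto_const_div_atTop_nhds_zero_nat h, ?_⟩
    filter_upwards [eventually_gt_atTop 0] with n hn
    have : (0 : ℝ) < n := by exact_mod_cast hn
    exact div_pos hh this
  filter_upwards [hlim.eventually hev, eventually_gt_atTop 0] with n hn hn0
  refine ⟨hn0, ?_⟩
  have hn' : (0 : ℝ) < n := by exact_mod_cast hn0
  set ε := h / n with hε
  have hε0 : 0 < ε := div_pos hh hn'
  set P := fineCorner V h n
  have hsep : Separated Λ P ε := separated_fineCorner hinj hh hn0
  let r : gridIndex V h × (Fin 2 → Fin n) → gridIndex V h × (Fin 2 → Fin n) → Prop := fun a b =>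
    a = b ∨ IsIsotopyLimit M (swapMap Λ (P a) (P b) ε)
  have rtrans : ∀ a b c, r a b → r b c → r a c := by
    intro a b c h1 h2
    by_cases hab : a = b
    · rwa [hab]
    by_cases hbc : b = c
    · rwa [← hbc]
    by_cases hac : a = c
    · exact Or.inl hac
    exact Or.inr (isIsotopyLimit_swap_trans hM hsep hac hab hbc (h1.resolve_left hab)
      (h2.resolve_left hbc))
  have hinner : ∀ k f f', r (k, f) (k, f') := by
    intro k f f'
    by_cases hff : f = f'
    · exact Or.inl (by rw [hff])
    right
    have hb : ∀ (f : Fin 2 → Fin n) (i : Fin 2), cellCenter h k i - h < P (k, f) i ∧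
        P (k, f) i + ε < cellCenter h k i + h := by
      intro f i
      have := fineCorner_bounds V hh hn0 (k, f) i
      simp only [cellCenter, P]
      constructor <;> linarith
    -- Inside one coarse cell no smallness is needed: the cell lies strictly inside its double box,
    -- which is a chart contained in `V`.
    refine isIsotopyLimit_swapMap_box hM (hinj.mono k.2) (k.2.trans hVM) (hb f) (hb f') ?_ ?_
    · intro heq
      have h0 : (0 : Plane) ∈ cell ε := fun i => by simpa using hε0
      have := (hsep (k, f) (k, f') 0 h0 0 h0 (by rw [heq])).1
      exact hff (congrArg Prod.snd this)
    · intro i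
      simp only [P, fineCorner_apply V hn0]
      by_cases hfi : f i = f' i
      · left; rw [hfi]
      · right
        have h1 : (1 : ℝ) ≤ |((f i : ℕ) : ℝ) - (f' i : ℕ)| := by
          have h2 : ((f i : ℕ) : ℤ) - (f' i : ℕ) ≠ 0 := by
            intro h3
            exact hfi (Fin.ext (by omega))
          have := Int.one_le_abs h2
          exact_mod_cast this
        rw [add_sub_add_left_eq_sub, ← mul_sub, abs_mul, abs_of_pos hε0]
        exact le_mul_of_one_le_right hε0.le h1
  have hcross : ∀ k k', r (k, fun _ => ⟨0, hn0⟩) (k', fun _ => ⟨0, hn0⟩) := by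
    intro k k'
    by_cases hkk : k = k'
    · exact Or.inl (by rw [hkk])
    right
    have hP : ∀ k, P (k, fun _ => ⟨0, hn0⟩) = corner h k := by
      intro k
      ext i
      simp [P, fineCorner_apply V hn0, corner]
    rw [hP, hP]
    exact hn k k' hkk
  refine isIsotopyLimit_cellPerm hM hsep ?_
  rintro ⟨k, f⟩ ⟨k', f'⟩ hne
  -- The route from one fine square to another passes through the corner squares of their coarse
  -- cells.
  have := rtrans _ _ _ (rtrans _ _ _ (hinner k f _) (hcross k k')) (hinner k' _ f')
  exact this.resolve_left hne

end Grid

/-! ### Step functions on cells of equal measure and the errors of discretization. -/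

section StepFunctions

variable {S ι : Type*} [MeasurableSpace S] [Fintype ι] {U : ι → Set S}

/-- The step function with value `a k` on `U k` and value `0` elsewhere. -/
noncomputable def stepFun (U : ι → Set S) (a : ι → ℝ) (q : S) : ℝ :=
  ∑ k, (U k).indicator (fun _ => a k) q

omit [MeasurableSpace S] in
lemma stepFun_of_mem (hdisj : Pairwise (Function.onFun Disjoint U)) (a : ι → ℝ) {k : ι} {q : S}
    (hq : q ∈ U k) : stepFun U a q = a k := by
  rw [stepFun, Finset.sum_eq_single k]
  · simp [hq]
  · intro j _ hj
    exact indicator_of_notMem (fun h => (Set.disjoint_left.1 (hdisj hj) h) hq) _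
  · simp

omit [MeasurableSpace S] in
lemma stepFun_of_notMem (a : ι → ℝ) {q : S} (hq : ∀ k, q ∉ U k) : stepFun U a q = 0 :=
  Finset.sum_eq_zero fun k _ => indicator_of_notMem (hq k) _

omit [MeasurableSpace S] in
lemma abs_stepFun_le (hdisj : Pairwise (Function.onFun Disjoint U)) {a : ι → ℝ} {C : ℝ}
    (hC : 0 ≤ C) (ha : ∀ k, |a k| ≤ C) (q : S) : |stepFun U a q| ≤ C := by
  by_cases hq : ∃ k, q ∈ U k
  · obtain ⟨k, hk⟩ := hq
    rw [stepFun_of_mem hdisj a hk]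
    exact ha k
  · push Not at hq
    rw [stepFun_of_notMem a hq, abs_zero]
    exact hC

lemma measurable_stepFun (hU : ∀ k, MeasurableSet (U k)) (a : ι → ℝ) :
    Measurable (stepFun U a) :=
  Finset.measurable_fun_sum _ fun k _ => measurable_const.indicator (hU k)

variable {μ : Measure S} [IsFiniteMeasure μ]

lemma integrable_of_abs_le {f : S → ℝ} (hf : AEStronglyMeasurable f μ) {C : ℝ}
    (hC : ∀ᵐ q ∂μ, |f q| ≤ C) : Integrable f μ :=
  Integrable.of_bound hf C hC

lemma integrable_stepFun (hU : ∀ k, MeasurableSet (U k))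
    (hdisj : Pairwise (Function.onFun Disjoint U)) (a : ι → ℝ) : Integrable (stepFun U a) μ := by
  refine integrable_of_abs_le (measurable_stepFun hU a).aestronglyMeasurable
    (C := ∑ k, |a k|) (Eventually.of_forall fun q => ?_)
  exact abs_stepFun_le hdisj (Finset.sum_nonneg fun k _ => abs_nonneg _)
    (fun k => Finset.single_le_sum (f := fun k => |a k|) (fun k _ => abs_nonneg _)
      (Finset.mem_univ k)) q

omit [IsFiniteMeasure μ] in
lemma integral_stepFun_mul (hU : ∀ k, MeasurableSet (U k)) (a : ι → ℝ) {f : S → ℝ}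
    (hf : Integrable f μ) :
    ∫ q, stepFun U a q * f q ∂μ = ∑ k, a k * ∫ q in U k, f q ∂μ := by
  have h1 : ∀ q, stepFun U a q * f q = ∑ k, (U k).indicator (fun q => a k * f q) q := by
    intro q
    rw [stepFun, Finset.sum_mul]
    refine Finset.sum_congr rfl fun k _ => ?_
    by_cases hq : q ∈ U k <;> simp [hq]
  simp only [h1]
  rw [integral_finsetSum _ fun k _ => (hf.const_mul (a k)).indicator (hU k)]
  refine Finset.sum_congr rfl fun k _ => ?_
  rw [integral_indicator (hU k), integral_const_mul]

lemma integral_stepFun (hU : ∀ k, MeasurableSet (U k)) {κ : ℝ} (hκ : ∀ k, μ.real (U k) = κ)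
    (a : ι → ℝ) : ∫ q, stepFun U a q ∂μ = κ * ∑ k, a k := by
  have := integral_stepFun_mul (μ := μ) hU a (f := fun _ => 1) (integrable_const 1)
  simp only [mul_one] at this
  rw [this, Finset.mul_sum]
  refine Finset.sum_congr rfl fun k _ => ?_
  simp [hκ, mul_comm]

/-- Outside the cells the step function vanishes, and there the integrand `max (-c) 0` is at most
one. -/
lemma integral_max_stepFun_le (hU : ∀ k, MeasurableSet (U k))
    (hdisj : Pairwise (Function.onFun Disjoint U)) {κ : ℝ} (hκ : ∀ k, μ.real (U k) = κ)
    (a : ι → ℝ) {c : ℝ} (hc : |c| ≤ 1) :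
    ∫ q, max (stepFun U a q - c) 0 ∂μ ≤
      κ * ∑ k, max (a k - c) 0 + μ.real (⋃ k, U k)ᶜ := by
  have hm : MeasurableSet (⋃ k, U k)ᶜ := (MeasurableSet.iUnion hU).compl
  rw [← integral_stepFun hU hκ, ← integral_indicator_one hm, ← integral_add]
  · refine integral_mono ?_ ?_ ?_
    · exact ((integrable_stepFun hU hdisj a).sub (integrable_const c)).pos_part
    · exact (integrable_stepFun hU hdisj _).add ((integrable_const 1).indicator hm)
    · intro q
      dsimp only
      by_cases hq : ∃ k, q ∈ U k
      · obtain ⟨k, hk⟩ := hq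
        rw [stepFun_of_mem hdisj _ hk, stepFun_of_mem hdisj _ hk]
        have : 0 ≤ (⋃ k, U k)ᶜ.indicator (1 : S → ℝ) q :=
          indicator_nonneg (fun _ _ => zero_le_one) q
        simpa using this
      · push Not at hq
        have hq' : q ∈ (⋃ k, U k)ᶜ := by simpa using hq
        rw [stepFun_of_notMem _ hq, stepFun_of_notMem _ hq, indicator_of_mem hq']
        have := abs_le.1 hc
        refine max_le ?_ ?_ <;> norm_num
        linarith
  · exact integrable_stepFun hU hdisj _
  · exact (integrable_const 1).indicator hm

/-- Majorization passes to averages over cells, up to the error of the step approximation. -/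
lemma cell_average_majorization (hU : ∀ k, MeasurableSet (U k))
    (hdisj : Pairwise (Function.onFun Disjoint U)) {κ : ℝ} (hκ : ∀ k, μ.real (U k) = κ)
    (hκ0 : 0 < κ) {ω ω₀ : S → ℝ} (hω : Integrable ω μ) (hω₀ : Integrable ω₀ μ)
    (hω1 : ∀ᵐ q ∂μ, |ω q| ≤ 1)
    (hint : ∫ q, ω q ∂μ = ∫ q, ω₀ q ∂μ)
    (hmaj : ∀ c, ∫ q, max (ω q - c) 0 ∂μ ≤ ∫ q, max (ω₀ q - c) 0 ∂μ) {a : ι → ℝ}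
    {η η' : ℝ} (happrox : ∫ q, |ω₀ q - stepFun U a q| ∂μ ≤ η)
    (hcov : μ.real (⋃ k, U k)ᶜ ≤ η') :
    (∀ k, |κ⁻¹ * ∫ q in U k, ω q ∂μ| ≤ 1) ∧
    (∀ c, |c| ≤ 1 → ∀ I : Finset ι, ∑ k ∈ I, (κ⁻¹ * ∫ q in U k, ω q ∂μ - c) ≤
      ∑ k, max (a k - c) 0 + κ⁻¹ * (η + η')) ∧
    ∑ k, a k - κ⁻¹ * (η + η') ≤ ∑ k, κ⁻¹ * ∫ q in U k, ω q ∂μ := by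
  have hA := integrable_stepFun (μ := μ) hU hdisj a
  have hUint : ∀ I : Finset ι, ∑ k ∈ I, ∫ q in U k, ω q ∂μ = ∫ q in ⋃ k ∈ I, U k, ω q ∂μ := by
    intro I
    rw [integral_biUnion_finset I (fun k _ => hU k) (hdisj.set_pairwise _)
      fun k _ => hω.integrableOn]
  refine ⟨fun k => ?_, fun c hc I => ?_, ?_⟩
  · have h1 : |∫ q in U k, ω q ∂μ| ≤ 1 * μ.real (U k) := by
      have := norm_setIntegral_le_of_norm_le_const_ae (μ := μ) (s := U k) (f := ω) (C := 1)
        (measure_lt_top _ _) (ae_restrict_of_ae hω1)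
      simpa using this
    rw [abs_mul, abs_inv, abs_of_pos hκ0, inv_mul_le_iff₀ hκ0]
    rw [hκ] at h1
    linarith
  · have hmeas : MeasurableSet (⋃ k ∈ I, U k) := I.measurableSet_biUnion fun k _ => hU k
    have hωc : Integrable (fun q => ω q - c) μ := hω.sub (integrable_const c)
    have h1 : ∑ k ∈ I, (∫ q in U k, ω q ∂μ - κ * c) ≤ ∫ q, max (ω q - c) 0 ∂μ := by
      have e1 : ∑ k ∈ I, (∫ q in U k, ω q ∂μ - κ * c) = ∫ q in ⋃ k ∈ I, U k, (ω q - c) ∂μ := by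
        rw [integral_biUnion_finset I (fun k _ => hU k) (hdisj.set_pairwise _)
          fun k _ => hωc.integrableOn]
        refine Finset.sum_congr rfl fun k _ => ?_
        rw [integral_sub hω.integrableOn (integrable_const c)]
        simp [hκ]
      rw [e1]
      calc ∫ q in ⋃ k ∈ I, U k, (ω q - c) ∂μ ≤ ∫ q in ⋃ k ∈ I, U k, max (ω q - c) 0 ∂μ :=
            integral_mono hωc.integrableOn hωc.pos_part.integrableOn fun q => le_max_left _ _
        _ ≤ ∫ q, max (ω q - c) 0 ∂μ :=
            setIntegral_le_integral hωc.pos_part (Eventually.of_forall fun q => le_max_right _ _)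
    -- The positive part is 1-Lipschitz, so replacing `ω₀` by its step function costs at most their
    -- `L¹` distance.
    have h2 : ∫ q, max (ω₀ q - c) 0 ∂μ ≤ ∫ q, max (stepFun U a q - c) 0 ∂μ + η := by
      refine le_trans ?_ (add_le_add_right happrox _)
      rw [← integral_add]
      · refine integral_mono (hω₀.sub (integrable_const c)).pos_part ?_ fun q => ?_
        · exact (hA.sub (integrable_const c)).pos_part.add (hω₀.sub hA).abs
        · dsimp only
          refine max_le ?_ ?_
          · have h3 := le_abs_self (ω₀ q - stepFun U a q)
            have h4 := le_max_left (stepFun U a q - c) 0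
            linarith
          · exact add_nonneg (le_max_right _ _) (abs_nonneg _)
      · exact (hA.sub (integrable_const c)).pos_part
      · exact (hω₀.sub hA).abs
    have h3 := integral_max_stepFun_le hU hdisj hκ a hc
    have h4 := hmaj c
    have h5 : ∑ k ∈ I, (κ⁻¹ * ∫ q in U k, ω q ∂μ - c) =
        κ⁻¹ * ∑ k ∈ I, (∫ q in U k, ω q ∂μ - κ * c) := by
      rw [Finset.mul_sum]
      refine Finset.sum_congr rfl fun k _ => ?_
      field_simp
    rw [h5, inv_mul_le_iff₀ hκ0, mul_add, mul_inv_cancel_left₀ hκ0.ne']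
    linarith
  · rw [← Finset.mul_sum, hUint, sub_le_iff_le_add, ← mul_add, ← div_eq_inv_mul, le_div_iff₀ hκ0]
    have h1 : κ * ∑ k, a k ≤ ∫ q, ω₀ q ∂μ + η := by
      rw [← integral_stepFun hU hκ]
      have h2 : ∫ q, (stepFun U a q - ω₀ q) ∂μ ≤ ∫ q, |ω₀ q - stepFun U a q| ∂μ := by
        refine integral_mono (hA.sub hω₀) (hω₀.sub hA).abs fun q => ?_
        dsimp only
        rw [abs_sub_comm]
        exact le_abs_self _
      rw [integral_sub hA hω₀] at h2
      linarith
    have hmeas : MeasurableSet (⋃ k, U k) := MeasurableSet.iUnion hU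
    have h2 : ∫ q, ω q ∂μ ≤ ∫ q in ⋃ k, U k, ω q ∂μ + η' := by
      rw [← integral_add_compl hmeas hω]
      have h3 : ∫ q in (⋃ k, U k)ᶜ, ω q ∂μ ≤ 1 * μ.real (⋃ k, U k)ᶜ := by
        have := norm_setIntegral_le_of_norm_le_const_ae (μ := μ) (s := (⋃ k, U k)ᶜ) (f := ω) (C := 1)
          (measure_lt_top _ _) (ae_restrict_of_ae hω1)
        exact (le_abs_self _).trans this
      linarith
    simp only [Finset.mem_univ, iUnion_true]
    linarith

omit [MeasurableSpace S] in
-- On the refined cells the product is itself a step function, which yields its integral and its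
-- integrability without any measurability of `σ`.
lemma stepFun_mul_stepFun_comp {F : Type*} [Fintype F] {E : ι × F → Set S}
    (hEdisj : Pairwise (Function.onFun Disjoint E)) (hdisj : Pairwise (Function.onFun Disjoint U))
    (hEU : ∀ k, ∀ q ∈ U k, ∃ f, q ∈ E (k, f)) (hEU' : ∀ k f, E (k, f) ⊆ U k) {σ : S → S}
    {s : F → ι → ι} (hσ : ∀ k f, ∀ q ∈ E (k, f), σ q ∈ U (s f k)) (g a : ι → ℝ) :
    (fun q => stepFun U g q * stepFun U a (σ q)) =
      stepFun E (fun x => g x.1 * a (s x.2 x.1)) := by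
  funext q
  by_cases hq : ∃ k, q ∈ U k
  · obtain ⟨k, hk⟩ := hq
    obtain ⟨f, hf⟩ := hEU k q hk
    rw [stepFun_of_mem hdisj g hk, stepFun_of_mem hdisj a (hσ k f q hf),
      stepFun_of_mem hEdisj _ hf]
  · push Not at hq
    rw [stepFun_of_notMem g hq,
      stepFun_of_notMem (U := E) _ fun x hx => hq x.1 (hEU' x.1 x.2 hx), zero_mul]

/-- The error budget: `g` is replaced by its step function in both integrals (hence `2 * e₁`), `θ`
by the step function composed with `φ`, and `φ` by `σ`, where the integrands differ by at most `2 *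
Γ` on a small set. The last term is the purely combinatorial error. -/
lemma abs_integral_sub_integral_le {U : ι → Set S} (hU : ∀ k, MeasurableSet (U k))
    (hdisj : Pairwise (Function.onFun Disjoint U)) {g θ ω : S → ℝ} {φ σ : S → S}
    {γ a : ι → ℝ} {Γ e₁ e₂ e₃ e₄ : ℝ} (hΓ : 0 ≤ Γ) (hγ : ∀ k, |γ k| ≤ Γ) (ha : ∀ k, |a k| ≤ 1)
    (hg : Integrable g μ) (hθ : Integrable θ μ) (hω : Integrable ω μ) (hφ : Measurable φ)
    (hθ1 : ∀ᵐ q ∂μ, |θ q| ≤ 1) (hω1 : ∀ᵐ q ∂μ, |ω q| ≤ 1)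
    (hσ : Integrable (fun q => stepFun U γ q * stepFun U a (σ q)) μ)
    (h1 : ∫ q, |g q - stepFun U γ q| ∂μ ≤ e₁) (h2 : ∫ q, |θ q - stepFun U a (φ q)| ∂μ ≤ e₂)
    (h3 : μ.real {q | φ q ≠ σ q} ≤ e₃)
    (h4 : |∫ q, stepFun U γ q * stepFun U a (σ q) ∂μ - ∫ q, stepFun U γ q * ω q ∂μ| ≤ e₄) :
    |∫ q, g q * θ q ∂μ - ∫ q, g q * ω q ∂μ| ≤ 2 * e₁ + Γ * e₂ + 2 * Γ * e₃ + e₄ := by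
  set G := stepFun U γ with hG
  set A := stepFun U a with hA
  have hGi : Integrable G μ := integrable_stepFun hU hdisj γ
  have hGm : Measurable G := measurable_stepFun hU γ
  have hAm : Measurable A := measurable_stepFun hU a
  have hGb : ∀ q, |G q| ≤ Γ := abs_stepFun_le hdisj hΓ hγ
  have hAb : ∀ q, |A q| ≤ 1 := abs_stepFun_le hdisj zero_le_one ha
  have hAφ : Integrable (fun q => A (φ q)) μ :=
    integrable_of_abs_le (hAm.comp hφ).aestronglyMeasurable (Eventually.of_forall fun q => hAb _)
  have mulint : ∀ {f v : S → ℝ}, Integrable f μ → Integrable v μ → (∀ᵐ q ∂μ, |v q| ≤ 1) →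
      Integrable (fun q => f q * v q) μ := fun hf hv hb =>
    hf.mul_bdd hv.aestronglyMeasurable hb
  have replace_g : ∀ v : S → ℝ, Integrable v μ → (∀ᵐ q ∂μ, |v q| ≤ 1) →
      |∫ q, g q * v q ∂μ - ∫ q, G q * v q ∂μ| ≤ e₁ := by
    intro v hv hb
    rw [← integral_sub (mulint hg hv hb) (mulint hGi hv hb)]
    refine (abs_integral_le_integral_abs).trans (le_trans ?_ h1)
    refine integral_mono_ae ?_ (hg.sub hGi).abs ?_
    · exact ((mulint hg hv hb).sub (mulint hGi hv hb)).abs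
    · filter_upwards [hb] with q hq
      rw [← sub_mul, abs_mul]
      exact mul_le_of_le_one_right (abs_nonneg _) hq
  have hGθ : |∫ q, G q * θ q ∂μ - ∫ q, G q * A (φ q) ∂μ| ≤ Γ * e₂ := by
    have i1 := mulint hGi hθ hθ1
    have i2 := mulint hGi hAφ (Eventually.of_forall fun q => hAb _)
    rw [← integral_sub i1 i2]
    refine (abs_integral_le_integral_abs).trans ?_
    calc ∫ q, |G q * θ q - G q * A (φ q)| ∂μ ≤ ∫ q, Γ * |θ q - A (φ q)| ∂μ := by
          refine integral_mono (i1.sub i2).abs ((hθ.sub hAφ).abs.const_mul Γ) fun q => ?_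
          dsimp only
          rw [← mul_sub, abs_mul]
          exact mul_le_mul_of_nonneg_right (hGb q) (abs_nonneg _)
      _ ≤ Γ * e₂ := by
          rw [integral_const_mul]
          exact mul_le_mul_of_nonneg_left h2 hΓ
  have hGA : |∫ q, G q * A (φ q) ∂μ - ∫ q, G q * A (σ q) ∂μ| ≤ 2 * Γ * e₃ := by
    have i2 := mulint hGi hAφ (Eventually.of_forall fun q => hAb _)
    set D := toMeasurable μ {q | φ q ≠ σ q}
    have hDm : MeasurableSet D := measurableSet_toMeasurable _ _
    rw [← integral_sub i2 hσ]
    refine (abs_integral_le_integral_abs).trans ?_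
    calc ∫ q, |G q * A (φ q) - G q * A (σ q)| ∂μ
        ≤ ∫ q, D.indicator (fun _ => 2 * Γ) q ∂μ := by
          refine integral_mono (i2.sub hσ).abs ((integrable_const _).indicator hDm) fun q => ?_
          dsimp only
          by_cases hq : φ q = σ q
          · rw [hq, sub_self, abs_zero]
            exact indicator_nonneg (fun _ _ => by positivity) q
          · have hqD : q ∈ D := subset_toMeasurable _ _ hq
            rw [indicator_of_mem hqD, ← mul_sub, abs_mul]
            have h5 : |A (φ q) - A (σ q)| ≤ 2 := by
              have h6 := abs_le.1 (hAb (φ q))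
              have h7 := abs_le.1 (hAb (σ q))
              rw [abs_le]; constructor <;> linarith
            calc |G q| * |A (φ q) - A (σ q)| ≤ Γ * 2 :=
                  mul_le_mul (hGb q) h5 (abs_nonneg _) hΓ
              _ = 2 * Γ := by ring
      _ ≤ 2 * Γ * e₃ := by
          rw [integral_indicator hDm, setIntegral_const, smul_eq_mul, mul_comm, measureReal_def,
            measure_toMeasurable]
          exact mul_le_mul_of_nonneg_left h3 (by positivity)
  have r1 := abs_le.1 (replace_g θ hθ hθ1)
  have r2 := abs_le.1 (replace_g ω hω hω1)
  have r3 := abs_le.1 hGθ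
  have r4 := abs_le.1 hGA
  have r5 := abs_le.1 h4
  rw [abs_le]
  constructor <;> linarith

lemma integral_abs_sub_stepFun_le (hU : ∀ k, MeasurableSet (U k))
    (hdisj : Pairwise (Function.onFun Disjoint U)) {f : S → ℝ} (hf : Integrable f μ) {C ρ : ℝ}
    (hρ : 0 ≤ ρ) (hC : ∀ q, |f q| ≤ C) {v : ι → ℝ} (hv : ∀ k, ∀ q ∈ U k, |f q - v k| ≤ ρ) :
    ∫ q, |f q - stepFun U v q| ∂μ ≤ ρ * μ.real univ + C * μ.real (⋃ k, U k)ᶜ := by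
  have hm : MeasurableSet (⋃ k, U k)ᶜ := (MeasurableSet.iUnion hU).compl
  calc ∫ q, |f q - stepFun U v q| ∂μ
      ≤ ∫ q, (ρ + (⋃ k, U k)ᶜ.indicator (fun _ => C) q) ∂μ := by
        refine integral_mono (hf.sub (integrable_stepFun hU hdisj v)).abs
          ((integrable_const ρ).add ((integrable_const C).indicator hm)) fun q => ?_
        dsimp only
        by_cases hq : ∃ k, q ∈ U k
        · obtain ⟨k, hk⟩ := hq
          have : q ∉ (⋃ k, U k)ᶜ := fun h => h (mem_iUnion.2 ⟨k, hk⟩)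
          rw [stepFun_of_mem hdisj v hk, indicator_of_notMem this, add_zero]
          exact hv k q hk
        · push Not at hq
          have hq' : q ∈ (⋃ k, U k)ᶜ := by simpa using hq
          rw [stepFun_of_notMem v hq, indicator_of_mem hq', sub_zero]
          linarith [hC q]
    _ = ρ * μ.real univ + C * μ.real (⋃ k, U k)ᶜ := by
        rw [integral_add (integrable_const ρ) ((integrable_const C).indicator hm),
          integral_indicator hm, setIntegral_const, integral_const]
        simp only [smul_eq_mul]
        ring

end StepFunctions

/-! ### Realizing prescribed cell averages by permuting pieces. -/

section Rearrangement

variable {S ι F : Type*} [MeasurableSpace S] [Fintype ι] [Fintype F] {U : ι → Set S}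

/-- Young's inequality `|x| ≤ t / 2 + x² / (2 * t)` converts the quadratic bound of the projection
into an `L¹` bound, with `t` left free to balance the two terms. -/
lemma mul_sum_abs_le {κ t δ : ℝ} (hκ : 0 ≤ κ) (ht : 0 < t) {b p : ι → ℝ}
    (h : ∑ k, (b k - p k) ^ 2 ≤ 6 * δ) :
    κ * ∑ k, |b k - p k| ≤ t * (κ * Fintype.card ι) / 2 + 3 * (κ * δ) / t := by
  have h1 : ∑ k, |b k - p k| ≤ ∑ k, (t / 2 + (b k - p k) ^ 2 / (2 * t)) := by
    refine Finset.sum_le_sum fun k _ => ?_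
    rw [← sq_abs (b k - p k)]
    set x := |b k - p k|
    rw [← sub_nonneg]
    have : t / 2 + x ^ 2 / (2 * t) - x = (x - t) ^ 2 / (2 * t) := by field_simp; ring
    rw [this]
    positivity
  rw [Finset.sum_add_distrib, Finset.sum_const, Finset.card_univ, nsmul_eq_mul,
    ← Finset.sum_div] at h1
  calc κ * ∑ k, |b k - p k|
      ≤ κ * (Fintype.card ι * (t / 2) + 6 * δ / (2 * t)) := by
        refine mul_le_mul_of_nonneg_left (h1.trans ?_) hκ
        gcongr
    _ = t * (κ * Fintype.card ι) / 2 + 3 * (κ * δ) / t := by field_simp; ring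

variable {μ : Measure S} [IsFiniteMeasure μ]

/-- Permuting pieces of cells with prescribed frequencies realizes prescribed cell averages. -/
lemma abs_integral_stepFun_comp_sub_le {E : ι × F → Set S} (hU : ∀ k, MeasurableSet (U k))
    (hE : ∀ x, MeasurableSet (E x)) (hdisj : Pairwise (Function.onFun Disjoint U))
    (hEdisj : Pairwise (Function.onFun Disjoint E))
    (hEU : ∀ k, ∀ q ∈ U k, ∃ f, q ∈ E (k, f)) (hEU' : ∀ k f, E (k, f) ⊆ U k) {σ : S → S}
    {s : F → ι → ι} (hσ : ∀ k f, ∀ q ∈ E (k, f), σ q ∈ U (s f k)) {κ : ℝ} (hκ0 : 0 < κ)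
    (hF : 0 < Fintype.card F) (hκE : ∀ x, μ.real (E x) = κ / Fintype.card F)
    {a γ p : ι → ℝ} {Γ C t X m : ℝ} (hΓ : 0 ≤ Γ) (hγ : ∀ k, |γ k| ≤ Γ) {ω : S → ℝ}
    (hω : Integrable ω μ)
    (hfreq : ∀ k, |∑ f, a (s f k) - Fintype.card F * p k| ≤ C) (ht : 0 ≤ t)
    (hC : C / Fintype.card F ≤ t)
    (hX : κ * ∑ k, |κ⁻¹ * ∫ q in U k, ω q ∂μ - p k| ≤ X) (hm : κ * Fintype.card ι ≤ m) :
    Integrable (fun q => stepFun U γ q * stepFun U a (σ q)) μ ∧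
    |∫ q, stepFun U γ q * stepFun U a (σ q) ∂μ - ∫ q, stepFun U γ q * ω q ∂μ| ≤
      Γ * (t * m + X) := by
  have hN : (0 : ℝ) < Fintype.card F := by exact_mod_cast hF
  have heq := stepFun_mul_stepFun_comp hEdisj hdisj hEU hEU' hσ γ a
  rw [heq]
  refine ⟨integrable_stepFun hE hEdisj _, ?_⟩
  rw [integral_stepFun hE hκE, integral_stepFun_mul hU γ hω, Fintype.sum_prod_type]
  set b : ι → ℝ := fun k => κ⁻¹ * ∫ q in U k, ω q ∂μ with hb
  have hbk : ∀ k, ∫ q in U k, ω q ∂μ = κ * b k := fun k => by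
    rw [hb]; dsimp only; rw [mul_inv_cancel_left₀ hκ0.ne']
  -- The difference splits into the error of the frequencies, small when there are many pieces, and
  -- the distance of the cell averages `b` from the convex combination `p`.
  have h1 : κ / Fintype.card F * ∑ k, ∑ f, γ k * a (s f k) - ∑ k, γ k * ∫ q in U k, ω q ∂μ =
      κ * ∑ k, γ k * ((∑ f, a (s f k) - Fintype.card F * p k) / Fintype.card F -
        (b k - p k)) := by
    rw [Finset.mul_sum, Finset.mul_sum, ← Finset.sum_sub_distrib]
    refine Finset.sum_congr rfl fun k _ => ?_
    rw [hbk, ← Finset.mul_sum]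
    field_simp
    ring
  rw [h1, abs_mul, abs_of_pos hκ0]
  have h2 : |∑ k, γ k * ((∑ f, a (s f k) - Fintype.card F * p k) / Fintype.card F -
        (b k - p k))| ≤ ∑ k, Γ * (t + |b k - p k|) := by
    refine (Finset.abs_sum_le_sum_abs _ _).trans (Finset.sum_le_sum fun k _ => ?_)
    rw [abs_mul]
    refine mul_le_mul (hγ k) ?_ (abs_nonneg _) hΓ
    refine (abs_sub _ _).trans (add_le_add_left ?_ _)
    rw [abs_div, abs_of_pos hN]
    exact (div_le_div_of_nonneg_right (hfreq k) hN.le).trans hC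
  calc κ * _ ≤ κ * ∑ k, Γ * (t + |b k - p k|) := mul_le_mul_of_nonneg_left h2 hκ0.le
    _ = Γ * (t * (κ * Fintype.card ι) + κ * ∑ k, |b k - p k|) := by
      rw [← Finset.mul_sum, Finset.sum_add_distrib, Finset.sum_const, Finset.card_univ,
        nsmul_eq_mul]
      ring
    _ ≤ Γ * (t * m + X) := by gcongr

end Rearrangement

/-! ### A plane model of the domain and continuous approximation. -/

section Charts

variable {Λ : AddSubgroup Plane} [DiscreteTopology Λ] {M : Set (Surface Λ)}

/-- A bounded domain is, up to a null set, a bounded open piece of the plane. -/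
lemma exists_fundamental_chart (hM : IsBoundedDomain M) :
    ∃ V : Set Plane, IsOpen V ∧ Bornology.IsBounded V ∧ V ⊆ proj Λ ⁻¹' interior M ∧
      InjOn (proj Λ) V ∧ ∀ B, MeasurableSet B → areaOn M B = volume (proj Λ ⁻¹' B ∩ V) := by
  refine ⟨proj Λ ⁻¹' interior M ∩ dirichletCell Λ,
    (isOpen_interior.preimage continuous_proj).inter isOpen_dirichletCell, ?_,
    inter_subset_left, injOn_proj_dirichletCell.mono inter_subset_right, fun B hB => ?_⟩
  · obtain ⟨R, hR⟩ := hM.bounded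
    refine (Metric.isBounded_ball (x := (0 : Plane)) (r := R)).subset ?_
    rintro x ⟨hx, hxc⟩
    obtain ⟨y, hy, hyx⟩ := hR (interior_subset hx)
    rw [mem_ball_zero_iff] at hy ⊢
    have h := proj_eq_iff.1 hyx.symm
    by_cases h0 : x - y = 0
    · rwa [sub_eq_zero.1 h0]
    -- A point of the Dirichlet cell is the shortest in its class, so a representative of norm below
    -- `R` forces its own norm below `R`.
    · have := hxc _ h h0
      rw [sub_sub_cancel] at this
      exact this.trans hy
  · rw [areaOn_eq_restrict_interior hM, Measure.restrict_apply hB,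
      area_apply (hB.inter isOpen_interior.measurableSet), preimage_inter, inter_assoc]

lemma areaOn_image_proj {V : Set Plane} (hinj : InjOn (proj Λ) V)
    (harea : ∀ B, MeasurableSet B → areaOn M B = volume (proj Λ ⁻¹' B ∩ V)) {E : Set Plane}
    (hE : MeasurableSet E) (hEV : E ⊆ V) : areaOn M (proj Λ '' E) = volume E := by
  rw [harea _ (measurableSet_image_proj hE)]
  congr 1
  ext x
  constructor
  · rintro ⟨⟨y, hy, hyx⟩, hx⟩
    rwa [← hinj (hEV hy) hx hyx]
  · exact fun hx => ⟨mem_image_of_mem _ hx, hEV hx⟩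

lemma isFiniteMeasure_areaOn (hM : IsBoundedDomain M) : IsFiniteMeasure (areaOn M) := by
  obtain ⟨V, _, hVb, _, _, harea⟩ := exists_fundamental_chart hM
  refine ⟨?_⟩
  rw [harea _ MeasurableSet.univ]
  exact (measure_mono inter_subset_right).trans_lt hVb.measure_lt_top

/-- A continuous function varies little over small squares meeting a bounded set. -/
lemma eventually_oscillation_le {f : Plane → ℝ} (hf : Continuous f) {V : Set Plane}
    (hV : Bornology.IsBounded V) {ρ : ℝ} (hρ : 0 < ρ) :
    ∀ᶠ h in 𝓝[>] (0 : ℝ), ∀ x ∈ V, ∀ y ∈ V, ‖x - y‖ < 2 * h → |f x - f y| ≤ ρ := by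
  have hK : IsCompact (closure V) := hV.isCompact_closure
  obtain ⟨δ, hδ, h⟩ := Metric.uniformContinuousOn_iff.1
    (hK.uniformContinuousOn_of_continuous hf.continuousOn) ρ hρ
  have : Ioo (0 : ℝ) (δ / 2) ∈ 𝓝[>] (0 : ℝ) := Ioo_mem_nhdsGT (by positivity)
  filter_upwards [this] with r hr x hx y hy hxy
  have := h x (subset_closure hx) y (subset_closure hy) (by rw [dist_eq_norm]; linarith [hr.2])
  rw [Real.dist_eq] at this
  exact this.le

/-- Integrable functions bounded by one are limits of continuous functions bounded by one. -/
lemma exists_continuous_approx [IsFiniteMeasure (areaOn M)] {f : Surface Λ → ℝ}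
    (hf : Integrable f (areaOn M))
    (hf1 : ∀ᵐ q ∂areaOn M, |f q| ≤ 1) {ρ : ℝ} (hρ : 0 < ρ) :
    ∃ w : Surface Λ → ℝ, Continuous w ∧ (∀ q, |w q| ≤ 1) ∧ ∫ q, |f q - w q| ∂areaOn M ≤ ρ := by
  obtain ⟨g, hg, hgi⟩ := hf.exists_boundedContinuous_integral_sub_le hρ
  -- Truncation to `[-1, 1]` fixes `f` almost everywhere and is 1-Lipschitz, so it does not spoil
  -- the approximation.
  have hc : Continuous fun q => max (-1) (min (g q) 1) :=
    continuous_const.max (g.continuous.min continuous_const)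
  have hb : ∀ q, |max (-1) (min (g q) 1)| ≤ 1 := fun q =>
    abs_le.2 ⟨le_max_left _ _, max_le (by norm_num) (min_le_right _ _)⟩
  refine ⟨_, hc, hb, le_trans ?_ hg⟩
  refine integral_mono_ae (hf.sub (integrable_of_abs_le hc.aestronglyMeasurable
    (Eventually.of_forall hb))).abs (hf.sub hgi).norm ?_
  filter_upwards [hf1] with q hq
  simp only [Real.norm_eq_abs]
  have h1 := abs_le.1 hq
  have h2 : f q = max (-1) (min (f q) 1) := by rw [min_eq_left h1.2, max_eq_right h1.1]
  conv_lhs => rw [h2]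
  calc |max (-1) (min (f q) 1) - max (-1) (min (g q) 1)|
      ≤ |min (f q) 1 - min (g q) 1| := by
        simpa using abs_max_sub_max_le_max (-1) (min (f q) 1) (-1) (min (g q) 1)
    _ ≤ |f q - g q| := by
        simpa using abs_min_sub_min_le_max (f q) 1 (g q) 1

end Charts

/-! ### Majorized fields as weak limits of rearrangements by isotopies. -/

section MajorizationApproximation

variable {Λ : AddSubgroup Plane} [DiscreteTopology Λ] {M : Set (Surface Λ)}

/-- The rearrangement of a discretized field along an interior isotopy, at a fixed scale. -/
lemma exists_isotopic_approx_scale [IsFiniteMeasure (areaOn M)] (hM : IsBoundedDomain M)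
    {V : Set Plane} (hVb : Bornology.IsBounded V)
    (hVM : V ⊆ proj Λ ⁻¹' interior M) (hinj : InjOn (proj Λ) V)
    (harea : ∀ B, MeasurableSet B → areaOn M B = volume (proj Λ ⁻¹' B ∩ V))
    {ω ω₀ : Surface Λ → ℝ} (hω : Integrable ω (areaOn M)) (hω₀ : Integrable ω₀ (areaOn M))
    (hω1 : ∀ᵐ q ∂areaOn M, |ω q| ≤ 1) (hω₀1 : ∀ᵐ q ∂areaOn M, |ω₀ q| ≤ 1)
    (hint : ∫ q, ω q ∂areaOn M = ∫ q, ω₀ q ∂areaOn M)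
    (hmaj : ∀ c, ∫ q, max (ω q - c) 0 ∂areaOn M ≤ ∫ q, max (ω₀ q - c) 0 ∂areaOn M)
    {w : Surface Λ → ℝ} (hw : Continuous w) (hw1 : ∀ q, |w q| ≤ 1) {t : ℝ} (ht : 0 < t)
    (hωw : ∫ q, |ω₀ q - w q| ∂areaOn M ≤ t ^ 2)
    {J : Type*} {g γ : J → Surface Λ → ℝ} (hg : ∀ j, Integrable (g j) (areaOn M))
    (hγ : ∀ j, Continuous (γ j)) {Γ : ℝ} (hΓ : 0 ≤ Γ) (hγ1 : ∀ j q, |γ j q| ≤ Γ) {e : ℝ}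
    (hgγ : ∀ j, ∫ q, |g j q - γ j q| ∂areaOn M ≤ e) {h : ℝ} (hh : 0 < h)
    (hcov : volume (V \ ⋃ k ∈ gridIndex V h, gridCell h k) ≤ ENNReal.ofReal (t ^ 2))
    (hwosc : ∀ x ∈ V, ∀ y ∈ V, ‖x - y‖ < 2 * h → |w (proj Λ x) - w (proj Λ y)| ≤ t ^ 2)
    (hγosc : ∀ j, ∀ x ∈ V, ∀ y ∈ V, ‖x - y‖ < 2 * h →
      |γ j (proj Λ x) - γ j (proj Λ y)| ≤ t ^ 2) :
    ∃ φ, IsInteriorIsotopic M φ ∧ ∀ j,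
      |∫ q, g j q * ω₀ (φ q) ∂areaOn M - ∫ q, g j q * ω q ∂areaOn M| ≤
        2 * (e + (t ^ 2 * (areaOn M).real univ + Γ * t ^ 2)) +
        Γ * (t ^ 2 * ((areaOn M).real univ + 2)) + 2 * Γ * t +
        Γ * (t * (areaOn M).real univ + (t * (areaOn M).real univ / 2 +
          3 * t * ((areaOn M).real univ + 3))) := by
  classical
  set μ := areaOn M with hμ
  set m := μ.real univ with hm
  have : Finite (gridIndex V h) := finite_gridIndex hVb hh
  have : Fintype (gridIndex V h) := Fintype.ofFinite _
  have ht2 : 0 < t ^ 2 := by positivity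
  have hcV : ∀ k : gridIndex V h, gridCell h k ⊆ V := fun k =>
    (gridCell_subset_box hh k).trans k.2
  have hcorner : ∀ k : gridIndex V h, corner h k ∈ gridCell h k := fun k => by
    have h0 : (0 : Plane) ∈ cell h := fun i => by simpa using hh
    simpa using corner_add_mem_gridCell (k := (k : Fin 2 → ℤ)) h0
  set U : gridIndex V h → Set (Surface Λ) := fun k => proj Λ '' gridCell h k with hUdef
  have hU : ∀ k, MeasurableSet (U k) := fun k =>
    measurableSet_image_proj (measurableSet_gridCell h k)
  have hdisj : Pairwise (Function.onFun Disjoint U) := by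
    intro k k' hkk
    refine Set.disjoint_left.2 ?_
    rintro _ ⟨x, hx, rfl⟩ ⟨y, hy, hyx⟩
    have := hinj (hcV k' hy) (hcV k hx) hyx
    rw [this] at hy
    exact hkk (Subtype.ext (gridCell_index_unique hx hy))
  have hκ : ∀ k, μ.real (U k) = h ^ 2 := fun k => by
    rw [measureReal_def, areaOn_image_proj hinj harea (measurableSet_gridCell h k) (hcV k),
      volume_gridCell hh.le, ENNReal.toReal_ofReal (by positivity)]
  have hκ0 : 0 < h ^ 2 := by positivity
  have hcov' : μ.real (⋃ k, U k)ᶜ ≤ t ^ 2 := by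
    rw [measureReal_def, harea _ (MeasurableSet.iUnion hU).compl]
    refine ENNReal.toReal_le_of_le_ofReal ht2.le (le_trans (measure_mono ?_) hcov)
    rintro x ⟨hx, hxV⟩
    refine ⟨hxV, fun hmem => hx ?_⟩
    obtain ⟨k, hk, hxk⟩ := mem_iUnion₂.1 hmem
    exact mem_iUnion.2 ⟨⟨k, hk⟩, mem_image_of_mem _ hxk⟩
  have hosc : ∀ (f : Surface Λ → ℝ),
      (∀ x ∈ V, ∀ y ∈ V, ‖x - y‖ < 2 * h → |f (proj Λ x) - f (proj Λ y)| ≤ t ^ 2) →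
      ∀ k, ∀ q ∈ U k, |f q - f (proj Λ (corner h k))| ≤ t ^ 2 := by
    rintro f hf k _ ⟨x, hx, rfl⟩
    refine hf x (hcV k hx) _ (hcV k (hcorner k)) (norm_lt_of_forall_abs_lt fun i => ?_)
    have := sub_corner_mem_cell hx i
    rw [abs_lt]
    constructor <;> linarith
  set a : gridIndex V h → ℝ := fun k => w (proj Λ (corner h k)) with ha
  have ha1 : ∀ k, |a k| ≤ 1 := fun k => hw1 _
  have hwi : Integrable w μ := integrable_of_abs_le hw.aestronglyMeasurable
    (Eventually.of_forall hw1)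
  have hγi : ∀ j, Integrable (γ j) μ := fun j => integrable_of_abs_le
    (hγ j).aestronglyMeasurable (Eventually.of_forall (hγ1 j))
  have htri : ∀ f₁ f₂ f₃ : Surface Λ → ℝ, Integrable f₁ μ → Integrable f₂ μ → Integrable f₃ μ →
      ∫ q, |f₁ q - f₃ q| ∂μ ≤ ∫ q, |f₁ q - f₂ q| ∂μ + ∫ q, |f₂ q - f₃ q| ∂μ := by
    intro f₁ f₂ f₃ i1 i2 i3
    refine (integral_mono (i1.sub i3).abs ((i1.sub i2).abs.add (i2.sub i3).abs) fun q =>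
      abs_sub_le _ (f₂ q) _).trans_eq (integral_add (i1.sub i2).abs (i2.sub i3).abs)
  have hη : ∫ q, |ω₀ q - stepFun U a q| ∂μ ≤ t ^ 2 * (m + 2) := by
    have h1 := integral_abs_sub_stepFun_le hU hdisj hwi ht2.le hw1 (hosc w hwosc)
    have h2 := htri ω₀ w (stepFun U a) hω₀ hwi (integrable_stepFun hU hdisj a)
    linarith
  obtain ⟨hb1, hb2, hb3⟩ := cell_average_majorization hU hdisj hκ hκ0 hω hω₀ hω1 hint hmaj hη hcov'
  have hm0 : 0 ≤ m := measureReal_nonneg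
  -- The coarse grid is fixed here, and with it `p` and `C`; only afterwards is `n` taken so large
  -- that `C / n²` is below `t`.
  obtain ⟨p, hp, C, hC⟩ := exists_average_of_perms_close (by positivity) ha1 hb1 hb2 hb3
  have hcard : h ^ 2 * Fintype.card (gridIndex V h) ≤ m := by
    have h1 := measureReal_iUnion_fintype (μ := μ) hdisj hU
    simp only [hκ, Finset.sum_const, Finset.card_univ, nsmul_eq_mul] at h1
    rw [mul_comm, ← h1]
    exact measureReal_mono (subset_univ _)
  -- The fields were approximated to order `t²` so that a factor `t` remains after the division by
  -- `t` in Young's inequality. The prefactor `h²` cancels the inverse cell area in the majorization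
  -- error, leaving a bound independent of `h`.
  have hX : h ^ 2 * ∑ k, |(h ^ 2)⁻¹ * ∫ q in U k, ω q ∂μ - p k| ≤
      t * m / 2 + 3 * t * (m + 3) := by
    refine (mul_sum_abs_le hκ0.le ht hp).trans ?_
    rw [mul_inv_cancel_left₀ hκ0.ne']
    have : 3 * (t ^ 2 * (m + 2) + t ^ 2) / t = 3 * t * (m + 3) := by field_simp; ring
    rw [this]
    gcongr
  have hlim : Tendsto (fun n : ℕ => C / (n : ℝ) ^ 2) atTop (𝓝 0) := by
    refine Tendsto.div_atTop tendsto_const_nhds ?_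
    exact (tendsto_pow_atTop two_ne_zero).comp tendsto_natCast_atTop_atTop
  obtain ⟨n, hnC, hn, hperm⟩ := ((hlim.eventually (gt_mem_nhds ht)).and
    (eventually_isIsotopyLimit_fine_perm hM hinj hVM hVb hh)).exists
  have hn' : (0 : ℝ) < n := by exact_mod_cast hn
  obtain ⟨s, hs⟩ := hC (Fin 2 → Fin n)
  have hFcard : (Fintype.card (Fin 2 → Fin n) : ℝ) = (n : ℝ) ^ 2 := by simp
  set P := fineCorner V h n with hP
  set ε := h / n with hε
  have hε0 : 0 < ε := div_pos hh hn'
  have hsep : Separated Λ P ε := separated_fineCorner hinj hh hn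
  -- The pieces in position `f` are moved between the coarse cells by the permutation `s f` and keep
  -- their position.
  let τ : Equiv.Perm (gridIndex V h × (Fin 2 → Fin n)) :=
    { toFun := fun x => (s x.2 x.1, x.2)
      invFun := fun x => ((s x.2).symm x.1, x.2)
      left_inv := fun x => by simp
      right_inv := fun x => by simp }
  set σ := cellPerm Λ P ε τ with hσ
  set fidx : gridIndex V h × (Fin 2 → Fin n) → (Fin 2 → ℤ) :=
    fun x i => n * (x.1 : Fin 2 → ℤ) i + (x.2 i : ℕ) with hfidx
  set E : gridIndex V h × (Fin 2 → Fin n) → Set (Surface Λ) :=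
    fun x => proj Λ '' gridCell ε (fidx x) with hEdef
  have hPc : ∀ x, P x = corner ε (fidx x) := fun x => rfl
  have hEsub : ∀ x, gridCell ε (fidx x) ⊆ gridCell h x.1 := by
    intro x z hz
    have := fineCorner_add_mem V hh hn x (sub_corner_mem_cell hz)
    rwa [← hP, hPc, add_sub_cancel] at this
  have hEm : ∀ x, MeasurableSet (E x) := fun x =>
    measurableSet_image_proj (measurableSet_gridCell _ _)
  have hEdisj : Pairwise (Function.onFun Disjoint E) := by
    intro x y hxy
    refine Set.disjoint_left.2 ?_
    rintro _ ⟨z, hz, rfl⟩ ⟨z', hz', hzz⟩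
    refine hxy (hsep x y (z - P x) (sub_corner_mem_cell hz) (z' - P y)
      (sub_corner_mem_cell hz') ?_).1
    rw [add_sub_cancel, add_sub_cancel, hzz]
  have hEU : ∀ k, ∀ q ∈ U k, ∃ f, q ∈ E (k, f) := by
    rintro k _ ⟨z, hz, rfl⟩
    obtain ⟨f, u, hu, rfl⟩ := exists_fineCorner_add_eq V hh hn k hz
    exact ⟨f, mem_image_of_mem _ (corner_add_mem_gridCell hu)⟩
  have hEU' : ∀ k f, E (k, f) ⊆ U k := fun k f => image_mono (hEsub (k, f))
  have hσE : ∀ k f, ∀ q ∈ E (k, f), σ q ∈ U (s f k) := by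
    rintro k f _ ⟨z, hz, rfl⟩
    have hu := sub_corner_mem_cell hz
    have h1 := cellPerm_proj hsep τ (k, f) hu
    rw [← hPc, add_sub_cancel] at h1
    rw [hσ, h1]
    exact mem_image_of_mem _ (fineCorner_add_mem V hh hn (τ (k, f)) hu)
  have hκE : ∀ x, μ.real (E x) = h ^ 2 / Fintype.card (Fin 2 → Fin n) := fun x => by
    rw [measureReal_def, areaOn_image_proj hinj harea (measurableSet_gridCell _ _)
      ((hEsub x).trans (hcV x.1)), volume_gridCell hε0.le,
      ENNReal.toReal_ofReal (by positivity), hFcard, hε, div_pow]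
  obtain ⟨φ, hφ, hφσ⟩ := hperm τ (ENNReal.ofReal t) (by simpa using ht)
  refine ⟨φ, hφ, fun j => ?_⟩
  have hφm := hφ.measurePreserving hM
  have hγk : ∀ k : gridIndex V h, |γ j (proj Λ (corner h k))| ≤ Γ := fun k => hγ1 j _
  obtain ⟨hσi, h4⟩ := abs_integral_stepFun_comp_sub_le hU hEm hdisj hEdisj hEU hEU'
    (s := fun f k => s f k) hσE hκ0
    (Nat.cast_pos.1 (by rw [hFcard]; positivity)) hκE hΓ hγk hω hs ht.le
    (by rw [hFcard]; exact hnC.le) hX hcard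
  refine abs_integral_sub_integral_le hU hdisj hΓ hγk ha1 (hg j)
    (hφm.integrable_comp_of_integrable hω₀) hω hφm.measurable
    (hφm.quasiMeasurePreserving.ae hω₀1) hω1 hσi ?_ ?_ ?_ h4
  · have h1 := integral_abs_sub_stepFun_le hU hdisj (hγi j) ht2.le (hγ1 j) (hosc (γ j) (hγosc j))
    have h2 := htri (g j) (γ j) _ (hg j) (hγi j)
      (integrable_stepFun hU hdisj fun k => γ j (proj Λ (corner h k)))
    have h3 : Γ * μ.real (⋃ k, U k)ᶜ ≤ Γ * t ^ 2 := by gcongr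
    linarith [hgγ j]
  · have hmeas : AEStronglyMeasurable (fun q => |ω₀ q - stepFun U a q|) μ :=
      (hω₀.sub (integrable_stepFun hU hdisj a)).abs.aestronglyMeasurable
    have h1 : ∫ q, |ω₀ (φ q) - stepFun U a (φ q)| ∂μ = ∫ q, |ω₀ q - stepFun U a q| ∂μ := by
      have := integral_map hφm.aemeasurable (f := fun q => |ω₀ q - stepFun U a q|)
        (by rw [hφm.map_eq]; exact hmeas)
      rw [hφm.map_eq] at this
      exact this.symm
    rw [h1]
    exact hη
  · exact ENNReal.toReal_le_of_le_ofReal ht.le hφσ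

/-- A field majorized by `ω₀` is a weak limit of rearrangements of `ω₀` by isotopies. -/
lemma exists_isotopic_approx (hM : IsBoundedDomain M)
    {ω ω₀ : Surface Λ → ℝ} (hω : Integrable ω (areaOn M)) (hω₀ : Integrable ω₀ (areaOn M))
    (hω1 : ∀ᵐ q ∂areaOn M, |ω q| ≤ 1) (hω₀1 : ∀ᵐ q ∂areaOn M, |ω₀ q| ≤ 1)
    (hint : ∫ q, ω q ∂areaOn M = ∫ q, ω₀ q ∂areaOn M)
    (hmaj : ∀ c, ∫ q, max (ω q - c) 0 ∂areaOn M ≤ ∫ q, max (ω₀ q - c) 0 ∂areaOn M)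
    {J : Type*} [Finite J] {g : J → Surface Λ → ℝ} (hg : ∀ j, Integrable (g j) (areaOn M))
    {η : ℝ} (hη : 0 < η) :
    ∃ φ, IsInteriorIsotopic M φ ∧ ∀ j,
      |∫ q, g j q * ω₀ (φ q) ∂areaOn M - ∫ q, g j q * ω q ∂areaOn M| ≤ η := by
  have := isFiniteMeasure_areaOn hM
  have := Fintype.ofFinite J
  obtain ⟨V, hVo, hVb, hVM, hinj, harea⟩ := exists_fundamental_chart hM
  choose γ hγ hγi using fun j =>
    (hg j).exists_boundedContinuous_integral_sub_le (show 0 < η / 4 by positivity)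
  set Γ : ℝ := ∑ j, ‖γ j‖ with hΓ
  have hΓ0 : 0 ≤ Γ := Finset.sum_nonneg fun j _ => norm_nonneg _
  have hγ1 : ∀ j q, |γ j q| ≤ Γ := fun j q =>
    ((γ j).norm_coe_le_norm q).trans
      (Finset.single_le_sum (f := fun j => ‖γ j‖) (fun j _ => norm_nonneg _) (Finset.mem_univ j))
  set m := (areaOn M).real univ with hm
  have hm0 : 0 ≤ m := measureReal_nonneg
  -- `B` collects all coefficients of `t` and `t²` in the error at fixed scale. With `t ≤ 1` this
  -- part is at most `t * B ≤ η / 2`, and the test functions, approximated to `η / 4`, contribute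
  -- the other half.
  set B := 2 * m + 2 * Γ + Γ * (m + 2) + (2 * Γ + Γ * (m + (m / 2 + 3 * (m + 3)))) with hB
  have hB0 : 0 ≤ B := by positivity
  obtain ⟨t, ht, ht1, htB⟩ : ∃ t : ℝ, 0 < t ∧ t ≤ 1 ∧ t * B ≤ η / 2 := by
    refine ⟨min 1 (η / (2 * (B + 1))), by positivity, min_le_left _ _, ?_⟩
    calc min 1 (η / (2 * (B + 1))) * B ≤ η / (2 * (B + 1)) * (B + 1) := by
          gcongr
          · exact min_le_right _ _
          · linarith
      _ = η / 2 := by field_simp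
  have ht2 : 0 < t ^ 2 := by positivity
  obtain ⟨w, hw, hw1, hωw⟩ := exists_continuous_approx hω₀ hω₀1 ht2
  obtain ⟨h₀, hh₀, hcov⟩ := exists_grid_cover hVo hVb.measure_lt_top.ne
    (η := ENNReal.ofReal (t ^ 2)) (by simpa using ht2)
  have hev1 := eventually_oscillation_le (hw.comp (continuous_proj (Λ := Λ))) hVb ht2
  have hev2 : ∀ᶠ h in 𝓝[>] (0 : ℝ), ∀ j, ∀ x ∈ V, ∀ y ∈ V, ‖x - y‖ < 2 * h →
      |γ j (proj Λ x) - γ j (proj Λ y)| ≤ t ^ 2 := by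
    rw [eventually_all]
    exact fun j => eventually_oscillation_le ((γ j).continuous.comp (continuous_proj (Λ := Λ)))
      hVb ht2
  obtain ⟨h, ⟨h1, h2⟩, hh⟩ := ((hev1.and hev2).and (Ioo_mem_nhdsGT hh₀)).exists
  obtain ⟨φ, hφ, hφj⟩ := exists_isotopic_approx_scale hM hVb hVM hinj harea hω hω₀ hω1 hω₀1
    hint hmaj hw hw1 ht hωw hg (fun j => (γ j).continuous) hΓ0 hγ1 hγ hh.1 (hcov h hh.1 hh.2)
    h1 h2
  refine ⟨φ, hφ, fun j => (hφj j).trans ?_⟩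
  rw [← hm]
  have h3 : t ^ 2 * (2 * m + 2 * Γ + Γ * (m + 2)) ≤ t * (2 * m + 2 * Γ + Γ * (m + 2)) := by
    refine mul_le_mul_of_nonneg_right ?_ (by positivity)
    nlinarith
  have h4 : t * B = t * (2 * m + 2 * Γ + Γ * (m + 2)) +
    t * (2 * Γ + Γ * (m + (m / 2 + 3 * (m + 3)))) := by rw [hB]; ring
  linarith

end MajorizationApproximation

/-! ### Limits of graph measures and the kernels they disintegrate into. -/

section Couplings

variable {S : Type*} [TopologicalSpace S] [PolishSpace S] [MeasurableSpace S] [BorelSpace S]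
  {ν : Measure S} {ι : Type*}

/-- Couplings of a fixed probability measure with itself are compact. -/
lemma exists_tendsto_coupling [IsFiniteMeasure ν] (l : Ultrafilter ι)
    {π : ι → ProbabilityMeasure (S × S)}
    (h1 : ∀ i, (π i : Measure (S × S)).fst = ν) (h2 : ∀ i, (π i : Measure (S × S)).snd = ν) :
    ∃ π' : ProbabilityMeasure (S × S), (π' : Measure (S × S)).fst = ν ∧
      (π' : Measure (S × S)).snd = ν ∧ Tendsto π l (𝓝 π') := by
  have htight : IsTightMeasureSet {x | ∃ μ ∈ range π, (μ : Measure (S × S)) = x} := by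
    rw [isTightMeasureSet_iff_exists_isCompact_measure_compl_le]
    intro ε hε
    -- The single measure `ν` is tight, and a coupling gives the complement of `K ×ˢ K` at most `ν
    -- Kᶜ` from each marginal.
    obtain ⟨K, hK, hKε⟩ := isTightMeasureSet_iff_exists_isCompact_measure_compl_le.1
      (isTightMeasureSet_singleton (μ := ν)) (ε / 2) (ENNReal.half_pos hε.ne')
    refine ⟨K ×ˢ K, hK.prod hK, ?_⟩
    rintro _ ⟨_, ⟨i, rfl⟩, rfl⟩
    have hKm : MeasurableSet Kᶜ := hK.isClosed.measurableSet.compl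
    have hsub : (K ×ˢ K)ᶜ ⊆ Prod.fst ⁻¹' Kᶜ ∪ Prod.snd ⁻¹' Kᶜ := by
      rintro ⟨x, y⟩ hxy
      by_contra hn
      simp only [mem_union, mem_preimage, mem_compl_iff, not_or, not_not] at hn
      exact hxy hn
    have hν := hKε ν rfl
    calc (π i : Measure (S × S)) (K ×ˢ K)ᶜ
        ≤ (π i : Measure (S × S)) (Prod.fst ⁻¹' Kᶜ) + (π i : Measure (S × S)) (Prod.snd ⁻¹' Kᶜ) :=
          (measure_mono hsub).trans (measure_union_le _ _)
      _ = ν Kᶜ + ν Kᶜ := by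
          rw [← Measure.fst_apply hKm, ← Measure.snd_apply hKm, h1, h2]
      _ ≤ ε / 2 + ε / 2 := add_le_add hν hν
      _ = ε := ENNReal.add_halves ε
  obtain ⟨π', -, hπ'⟩ := (isCompact_closure_of_isTightMeasureSet htight).ultrafilter_le_nhds
    (l.map π) (by
      refine le_principal_iff.2 (mem_map.2 (univ_mem' fun i => ?_))
      exact subset_closure (mem_range_self i))
  have hlim : Tendsto π l (𝓝 π') := hπ'
  have hmarg : ∀ f : S × S → S, (hf : Continuous f) →
      (∀ i, (π i : Measure (S × S)).map f = ν) → (π' : Measure (S × S)).map f = ν := by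
    intro f hf h
    have ht := ProbabilityMeasure.tendsto_map_of_tendsto_of_continuous π π' hlim hf
    have hp : IsProbabilityMeasure ν := by
      obtain ⟨i⟩ : Nonempty ι := l.neBot.nonempty
      rw [← h i]
      exact Measure.isProbabilityMeasure_map hf.measurable.aemeasurable
    have hc : ∀ i, (π i).map hf.measurable.aemeasurable = (⟨ν, hp⟩ : ProbabilityMeasure S) :=
      fun i => Subtype.ext (h i)
    simp only [hc] at ht
    have he : π'.map hf.measurable.aemeasurable = (⟨ν, hp⟩ : ProbabilityMeasure S) :=
      tendsto_nhds_unique ht tendsto_const_nhds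
    exact congrArg Subtype.val he
  exact ⟨π', hmarg _ continuous_fst h1, hmarg _ continuous_snd h2, hlim⟩

lemma integrable_mul_snd {π : Measure (S × S)} [IsFiniteMeasure π] (hπ : π.snd = ν) {u : S → ℝ}
    (hu : Integrable u ν) (g : BoundedContinuousFunction S ℝ) :
    Integrable (fun z : S × S => g z.1 * u z.2) π := by
  have h1 : Integrable (fun z : S × S => u z.2) π := by
    refine Integrable.comp_measurable (f := Prod.snd) (g := u) ?_ measurable_snd
    rwa [← Measure.snd, hπ]
  refine h1.bdd_mul (c := ‖g‖) (g.continuous.comp continuous_fst).aestronglyMeasurable ?_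
  exact Eventually.of_forall fun z => g.norm_coe_le_norm _

/-- Test functions that are merely integrable in the second variable pass to the limit of
couplings. -/
lemma tendsto_integral_mul_of_tendsto_coupling [IsFiniteMeasure ν] {l : Filter ι}
    {π : ι → ProbabilityMeasure (S × S)} {π' : ProbabilityMeasure (S × S)}
    (h : Tendsto π l (𝓝 π'))
    (h2 : ∀ i, (π i : Measure (S × S)).snd = ν) (h2' : (π' : Measure (S × S)).snd = ν) {u : S → ℝ}
    (hu : Integrable u ν) (g : BoundedContinuousFunction S ℝ) :
    Tendsto (fun i => ∫ z, g z.1 * u z.2 ∂(π i : Measure (S × S))) l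
      (𝓝 (∫ z, g z.1 * u z.2 ∂(π' : Measure (S × S)))) := by
  let _ := TopologicalSpace.upgradeIsCompletelyMetrizable S
  rw [Metric.tendsto_nhds]
  intro ε hε
  obtain ⟨v, hv, hvi⟩ := hu.exists_boundedContinuous_integral_sub_le
    (show 0 < ε / (3 * (‖g‖ + 1)) by positivity)
  -- The error of replacing `u` by a bounded continuous `v` involves only the second marginal, so it
  -- is uniform over all couplings, including the limit.
  have hbound : ∀ π : Measure (S × S), IsFiniteMeasure π → π.snd = ν →
      |∫ z, g z.1 * u z.2 ∂π - ∫ z, g z.1 * v z.2 ∂π| < ε / 3 := by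
    intro π _ hπ
    have hd : Integrable (fun y => u y - v y) ν := hu.sub hvi
    have i1 := integrable_mul_snd hπ hu g
    have i2 := integrable_mul_snd hπ hvi g
    have i3 : Integrable (fun z : S × S => |u z.2 - v z.2|) π := by
      refine Integrable.comp_measurable (f := Prod.snd) (g := fun y => |u y - v y|) ?_
        measurable_snd
      rw [← Measure.snd, hπ]
      exact hd.abs
    rw [← integral_sub i1 i2]
    calc |∫ z, (g z.1 * u z.2 - g z.1 * v z.2) ∂π|
        ≤ ∫ z, |g z.1 * u z.2 - g z.1 * v z.2| ∂π := abs_integral_le_integral_abs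
      _ ≤ ∫ z, ‖g‖ * |u z.2 - v z.2| ∂π := by
          refine integral_mono (i1.sub i2).abs (i3.const_mul _) fun z => ?_
          dsimp only
          rw [← mul_sub, abs_mul]
          exact mul_le_mul_of_nonneg_right (g.norm_coe_le_norm _) (abs_nonneg _)
      _ = ‖g‖ * ∫ y, |u y - v y| ∂ν := by
          rw [integral_const_mul]
          congr 1
          have := integral_map (μ := π) measurable_snd.aemeasurable (f := fun y => |u y - v y|)
            (by rw [← Measure.snd, hπ]; exact hd.abs.aestronglyMeasurable)
          rw [← Measure.snd, hπ] at this
          exact this.symm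
      _ ≤ ‖g‖ * (ε / (3 * (‖g‖ + 1))) := mul_le_mul_of_nonneg_left hv (norm_nonneg _)
      _ < (‖g‖ + 1) * (ε / (3 * (‖g‖ + 1))) :=
          mul_lt_mul_of_pos_right (by linarith) (by positivity)
      _ = ε / 3 := by have : ‖g‖ + 1 ≠ 0 := by positivity
                      field_simp
  let G : BoundedContinuousFunction (S × S) ℝ :=
    g.compContinuous ⟨Prod.fst, continuous_fst⟩ * v.compContinuous ⟨Prod.snd, continuous_snd⟩
  have hG := ProbabilityMeasure.tendsto_iff_forall_integral_tendsto.1 h G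
  have hG' := Metric.tendsto_nhds.1 hG (ε / 3) (by positivity)
  filter_upwards [hG'] with i hi
  rw [Real.dist_eq] at hi ⊢
  change |∫ z, g z.1 * v z.2 ∂(π i : Measure (S × S)) -
    ∫ z, g z.1 * v z.2 ∂(π' : Measure (S × S))| < ε / 3 at hi
  have h3 := abs_lt.1 (hbound (π i) inferInstance (h2 i))
  have h4 := abs_lt.1 (hbound π' inferInstance h2')
  have h5 := abs_lt.1 hi
  rw [abs_lt]
  constructor <;> linarith

/-- The difference `d` is itself approximated in `L¹` by a bounded continuous `g`. As `∫ g * d = 0`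
and `d` is bounded, `∫ d²` equals `∫ (d - g) * d` and is arbitrarily small. -/
lemma ae_eq_of_forall_integral_boundedContinuous_mul [IsFiniteMeasure ν] {u v : S → ℝ}
    (hu : Integrable u ν) (hv : Integrable v ν) {C : ℝ} (hC : ∀ᵐ x ∂ν, |u x - v x| ≤ C)
    (h : ∀ g : BoundedContinuousFunction S ℝ, ∫ x, g x * u x ∂ν = ∫ x, g x * v x ∂ν) :
    u =ᵐ[ν] v := by
  let _ := TopologicalSpace.upgradeIsCompletelyMetrizable S
  set d := fun x => u x - v x with hd
  have hdi : Integrable d ν := hu.sub hv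
  have hdd : Integrable (fun x => d x * d x) ν := hdi.mul_bdd hdi.aestronglyMeasurable hC
  have hgd : ∀ g : BoundedContinuousFunction S ℝ, Integrable (fun x => g x * d x) ν := fun g =>
    hdi.bdd_mul (c := ‖g‖) g.continuous.aestronglyMeasurable
      (Eventually.of_forall fun z => g.norm_coe_le_norm _)
  have hzero : ∀ g : BoundedContinuousFunction S ℝ, ∫ x, g x * d x ∂ν = 0 := by
    intro g
    have hgi : ∀ w : S → ℝ, Integrable w ν → Integrable (fun x => g x * w x) ν := fun w hw =>
      hw.bdd_mul (c := ‖g‖) g.continuous.aestronglyMeasurable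
        (Eventually.of_forall fun z => g.norm_coe_le_norm _)
    simp only [hd, mul_sub]
    rw [integral_sub (hgi u hu) (hgi v hv), h, sub_self]
  have hle : ∫ x, d x * d x ∂ν ≤ 0 := by
    refine le_of_forall_pos_le_add fun ε hε => ?_
    set C' := max C 0
    have hC' : 0 ≤ C' := le_max_right _ _
    obtain ⟨g, hg, hgi⟩ := hdi.exists_boundedContinuous_integral_sub_le
      (show 0 < ε / (C' + 1) by positivity)
    have h1 : ∫ x, d x * d x ∂ν = ∫ x, (d x * d x - g x * d x) ∂ν := by
      rw [integral_sub hdd (hgd g), hzero, sub_zero]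
    rw [h1, zero_add]
    calc ∫ x, (d x * d x - g x * d x) ∂ν ≤ ∫ x, ‖d x - g x‖ * (C' + 1) ∂ν := by
          refine integral_mono_ae (hdd.sub (hgd g)) ((hdi.sub hgi).norm.mul_const _) ?_
          filter_upwards [hC] with x hx
          rw [← sub_mul]
          refine (le_abs_self _).trans ?_
          rw [abs_mul]
          refine mul_le_mul_of_nonneg_left ?_ (abs_nonneg _)
          linarith [le_max_left C 0]
      _ ≤ ε / (C' + 1) * (C' + 1) := by
          rw [integral_mul_const]
          exact mul_le_mul_of_nonneg_right hg (by positivity)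
      _ = ε := by field_simp
  have h0 := (integral_eq_zero_iff_of_nonneg (fun x => mul_self_nonneg (d x)) hdd).1
    (le_antisymm hle (integral_nonneg fun x => mul_self_nonneg (d x)))
  filter_upwards [h0] with x hx
  exact sub_eq_zero.1 (mul_self_eq_zero.1 hx)

/-- A weak limit of rearrangements is the image under a kernel leaving the measure invariant:
case of a probability measure. -/
lemma exists_invariant_kernel_of_tendsto_prob [IsProbabilityMeasure ν] (l : Ultrafilter ι)
    {φ : ι → S → S} (hφ : ∀ i, MeasurePreserving (φ i) ν ν) {ω ω₀ : S → ℝ} (hω : Integrable ω ν)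
    (hω₀ : Integrable ω₀ ν) {C : ℝ} (hωC : ∀ᵐ x ∂ν, |ω x| ≤ C) (hω₀C : ∀ᵐ x ∂ν, |ω₀ x| ≤ C)
    (h : ∀ g : BoundedContinuousFunction S ℝ,
      Tendsto (fun i => ∫ x, g x * ω₀ (φ i x) ∂ν) l (𝓝 (∫ x, g x * ω x ∂ν))) :
    ∃ K : Kernel S S, IsMarkovKernel K ∧ K.Invariant ν ∧ ω =ᵐ[ν] fun x => ∫ y, ω₀ y ∂(K x) := by
  have hne : Nonempty S := ν.nonempty_of_neZero
  have hm : ∀ i, Measurable fun x => (x, φ i x) := fun i => measurable_id.prodMk (hφ i).measurable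
  -- The measure carried by the graph of `φ i`; both marginals are `ν` because `φ i` preserves `ν`.
  let π : ι → ProbabilityMeasure (S × S) := fun i =>
    ⟨ν.map fun x => (x, φ i x), Measure.isProbabilityMeasure_map (hm i).aemeasurable⟩
  have h1 : ∀ i, (π i : Measure (S × S)).fst = ν := fun i => by
    change (ν.map fun x => (x, φ i x)).fst = ν
    rw [Measure.fst_map_prodMk (hφ i).measurable]
    exact Measure.map_id
  have h2 : ∀ i, (π i : Measure (S × S)).snd = ν := fun i => by
    change (ν.map fun x => (x, φ i x)).snd = ν
    rw [Measure.snd_map_prodMk (X := fun x => x) measurable_id, (hφ i).map_eq]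
  obtain ⟨π', h1', h2', hlim⟩ := exists_tendsto_coupling l h1 h2
  -- Disintegration over the first marginal: the first marginal makes `K` act on `ν`, the second is
  -- its invariance.
  set K := (π' : Measure (S × S)).condKernel with hK
  have hdis : ν ⊗ₘ K = π' := by
    conv_lhs => rw [← h1']
    exact Measure.disintegrate _ _
  have hinv : K.Invariant ν := by
    change ν.bind K = ν
    rw [← Measure.snd_compProd, hdis, h2']
  refine ⟨K, inferInstance, hinv, ?_⟩
  have hω₀K : ∀ᵐ x ∂ν, ∀ᵐ y ∂(K x), |ω₀ y| ≤ C := by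
    refine Measure.ae_ae_of_ae_bind K.aemeasurable ?_
    rw [hinv.def]
    exact hω₀C
  have hKb : ∀ᵐ x ∂ν, |∫ y, ω₀ y ∂(K x)| ≤ C := by
    filter_upwards [hω₀K] with x hx
    have := norm_integral_le_of_norm_le_const (μ := K x) (f := ω₀) (C := C) hx
    simpa using this
  have hint1 : Integrable (fun z : S × S => ω₀ z.2) (ν ⊗ₘ K) := by
    rw [hdis]
    refine Integrable.comp_measurable (f := Prod.snd) (g := ω₀) ?_ measurable_snd
    rwa [← Measure.snd, h2']
  have hKi : Integrable (fun x => ∫ y, ω₀ y ∂(K x)) ν := Integrable.integral_compProd hint1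
  refine ae_eq_of_forall_integral_boundedContinuous_mul hω hKi (C := C + C) ?_ fun g => ?_
  · filter_upwards [hωC, hKb] with x hx1 hx2
    exact (abs_sub _ _).trans (add_le_add hx1 hx2)
  · have ht := tendsto_integral_mul_of_tendsto_coupling hlim h2 h2' hω₀ g
    have he : ∀ i, ∫ z, g z.1 * ω₀ z.2 ∂(π i : Measure (S × S)) = ∫ x, g x * ω₀ (φ i x) ∂ν := by
      intro i
      exact integral_map (hm i).aemeasurable
        (integrable_mul_snd (h2 i) hω₀ g).aestronglyMeasurable
    simp only [he] at ht
    rw [tendsto_nhds_unique (h g) ht]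
    have hi := integrable_mul_snd h2' hω₀ g
    rw [← hdis] at hi ⊢
    rw [Measure.integral_compProd hi]
    simp only [integral_const_mul]

/-- A weak limit of rearrangements is the image under a kernel leaving the measure invariant. -/
lemma exists_invariant_kernel_of_tendsto {μ : Measure S} [IsFiniteMeasure μ] (l : Ultrafilter ι)
    {φ : ι → S → S} (hφ : ∀ i, MeasurePreserving (φ i) μ μ) {ω ω₀ : S → ℝ} (hω : Integrable ω μ)
    (hω₀ : Integrable ω₀ μ) {C : ℝ} (hωC : ∀ᵐ x ∂μ, |ω x| ≤ C) (hω₀C : ∀ᵐ x ∂μ, |ω₀ x| ≤ C)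
    (h : ∀ g : BoundedContinuousFunction S ℝ,
      Tendsto (fun i => ∫ x, g x * ω₀ (φ i x) ∂μ) l (𝓝 (∫ x, g x * ω x ∂μ))) :
    ∃ K : Kernel S S, IsMarkovKernel K ∧ K.Invariant μ ∧ ω =ᵐ[μ] fun x => ∫ y, ω₀ y ∂(K x) := by
  by_cases hμ : μ = 0
  · subst hμ
    exact ⟨Kernel.id, inferInstance, by simp [Kernel.Invariant], by simp [EventuallyEq]⟩
  have : NeZero μ := ⟨hμ⟩
  -- Prokhorov compactness is used for probability measures. Normalization changes neither null
  -- sets, nor invariance, nor the convergence.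
  set c := (μ univ)⁻¹ with hc
  have hc0 : c ≠ 0 := ENNReal.inv_ne_zero.2 (measure_ne_top _ _)
  have hct : c ≠ ⊤ := ENNReal.inv_ne_top.2 fun h0 => hμ (Measure.measure_univ_eq_zero.1 h0)
  have hae : ae (c • μ) = ae μ := Measure.ae_ennreal_smul_measure_eq hc0 μ
  have hp : IsProbabilityMeasure (c • μ) := isProbabilityMeasureSMul
  obtain ⟨K, hK1, hK2, hK3⟩ := exists_invariant_kernel_of_tendsto_prob (ν := c • μ) l
    (φ := φ) (fun i => (hφ i).smul_measure c) (hω.smul_measure hct) (hω₀.smul_measure hct)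
    (by rwa [hae]) (by rwa [hae]) (fun g => by
      simp only [integral_smul_measure]
      exact (h g).const_smul _)
  refine ⟨K, hK1, ?_, ?_⟩
  · have := hK2.def
    rw [Measure.bind_smul] at this
    change μ.bind K = μ
    ext B hB
    have h3 := congrArg (fun m => m B) this
    simp only [Measure.smul_apply, smul_eq_mul] at h3
    exact (ENNReal.mul_right_inj hc0 hct).1 h3
  · unfold EventuallyEq at hK3 ⊢
    rwa [hae] at hK3

end Couplings

/-! ### Convex inequalities for bistochastic images. -/

section Jensen

variable {S : Type*} [MeasurableSpace S] {μ : Measure S} [IsFiniteMeasure μ]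

lemma integral_integral_of_invariant {K : Kernel S S} [IsMarkovKernel K] (hK : K.Invariant μ)
    {u : S → ℝ} (hu : Integrable u μ) :
    Integrable (fun x => ∫ y, u y ∂(K x)) μ ∧ ∫ x, ∫ y, u y ∂(K x) ∂μ = ∫ x, u x ∂μ := by
  have hsnd : (μ ⊗ₘ K).snd = μ := by
    rw [Measure.snd_compProd]
    exact hK
  have hi : Integrable (fun z : S × S => u z.2) (μ ⊗ₘ K) := by
    refine Integrable.comp_measurable (f := Prod.snd) (g := u) ?_ measurable_snd
    rwa [← Measure.snd, hsnd]
  refine ⟨Integrable.integral_compProd hi, ?_⟩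
  have h1 := Measure.integral_compProd hi
  dsimp only at h1
  rw [← h1]
  have h2 := integral_map (μ := μ ⊗ₘ K) measurable_snd.aemeasurable (f := u)
    (by rw [← Measure.snd, hsnd]; exact hu.aestronglyMeasurable)
  rw [← Measure.snd, hsnd] at h2
  exact h2.symm

omit [IsFiniteMeasure μ] in
lemma ae_abs_integral_le_of_invariant {K : Kernel S S} [IsMarkovKernel K] (hK : K.Invariant μ)
    {u : S → ℝ} {C : ℝ} (huC : ∀ᵐ x ∂μ, |u x| ≤ C) : ∀ᵐ x ∂μ, |∫ y, u y ∂(K x)| ≤ C := by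
  have huK : ∀ᵐ x ∂μ, ∀ᵐ y ∂(K x), |u y| ≤ C := by
    refine Measure.ae_ae_of_ae_bind K.aemeasurable ?_
    rw [hK.def]
    exact huC
  filter_upwards [huK] with x hx
  have := norm_integral_le_of_norm_le_const (μ := K x) (f := u) (C := C) hx
  simpa using this

/-- Jensen's inequality for a kernel leaving the measure invariant. -/
lemma integral_convex_kernel_le {K : Kernel S S} [IsMarkovKernel K] (hK : K.Invariant μ)
    {u : S → ℝ} (hu : Integrable u μ) {C : ℝ} (huC : ∀ᵐ x ∂μ, |u x| ≤ C) {f : ℝ → ℝ}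
    (hf : ConvexOn ℝ univ f) :
    ∫ x, f (∫ y, u y ∂(K x)) ∂μ ≤ ∫ x, f (u x) ∂μ := by
  have hfc : Continuous f := continuousOn_univ.1 (hf.continuousOn isOpen_univ)
  obtain ⟨D, hD⟩ := (isCompact_Icc (a := -C) (b := C)).exists_bound_of_continuousOn
    hfc.continuousOn
  have hfu : Integrable (fun x => f (u x)) μ := by
    refine integrable_of_abs_le (hfc.comp_aestronglyMeasurable hu.aestronglyMeasurable) (C := D) ?_
    filter_upwards [huC] with x hx
    exact hD _ (abs_le.1 hx)
  have hKb := ae_abs_integral_le_of_invariant hK huC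
  have hint : ∀ v : S → ℝ, Integrable v μ → ∀ᵐ x ∂μ, Integrable v (K x) := by
    intro v hv
    refine Measure.ae_integrable_of_integrable_comp ?_
    have : K ∘ₘ μ = μ := hK
    rwa [this]
  obtain ⟨hi1, -⟩ := integral_integral_of_invariant hK hu
  obtain ⟨hi2, he2⟩ := integral_integral_of_invariant hK hfu
  -- By invariance the right-hand side is the integral of `x ↦ ∫ y, f (u y) ∂(K x)`, and Jensen's
  -- inequality for the probability measure `K x` applies at almost every `x`.
  rw [← he2]
  refine integral_mono_ae ?_ hi2 ?_
  · refine integrable_of_abs_le (hfc.comp_aestronglyMeasurable hi1.aestronglyMeasurable)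
      (C := D) ?_
    filter_upwards [hKb] with x hx
    exact hD _ (abs_le.1 hx)
  · filter_upwards [hint u hu, hint _ hfu] with x hx1 hx2
    exact hf.map_integral_le hfc.continuousOn isClosed_univ (by simp) hx1 hx2

end Jensen

/-! ### Orbits and their weak-* closures. -/

section Orbits

variable {Λ : AddSubgroup Plane} {M : Set (Surface Λ)}

lemma SmoothOn.continuousOn_interior {ψ : Surface Λ → Surface Λ} (h : SmoothOn M ψ) :
    ContinuousOn ψ (interior M) := by
  intro q hq
  refine ContinuousAt.continuousWithinAt ?_
  obtain ⟨x, rfl⟩ := surjective_proj q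
  have hmem : proj Λ ⁻¹' M ∈ 𝓝 x :=
    mem_of_superset ((isOpen_interior.preimage continuous_proj).mem_nhds hq)
      (preimage_mono interior_subset)
  obtain ⟨F, hF, hFψ⟩ := h x (interior_subset hq)
  rw [nhdsWithin_eq_nhds.2 hmem] at hFψ
  have h1 : ContinuousAt (fun y => proj Λ (F y)) x :=
    continuous_proj.continuousAt.comp (hF.continuousWithinAt.continuousAt hmem)
  have h2 : ContinuousAt (fun y => ψ (proj Λ y)) x := h1.congr hFψ
  rw [ContinuousAt, ← isOpenMap_proj.map_nhds_eq continuous_proj.continuousAt, tendsto_map'_iff]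
  exact h2

lemma ae_abs_le_one_of_mem_phaseSpace {ω : LInfty M} (hω : ω ∈ phaseSpace M) :
    ∀ᵐ q ∂areaOn M, |ω q| ≤ 1 := by
  have h1 : eLpNorm ω ⊤ (areaOn M) ≤ 1 := by
    have h2 : (eLpNorm ω ⊤ (areaOn M)).toReal ≤ 1 := by
      rw [← Lp.norm_def]; exact hω
    exact (ENNReal.toReal_le_toReal (Lp.eLpNorm_ne_top ω) ENNReal.one_ne_top).1 (by simpa using h2)
  filter_upwards [ae_le_eLpNormEssSup (f := ω) (μ := areaOn M)] with q hq
  rw [eLpNorm_exponent_top] at h1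
  have h3 := hq.trans h1
  rw [← ofReal_norm] at h3
  exact ENNReal.ofReal_le_one.1 h3

lemma mem_phaseSpace_of_ae_abs_le_one [IsFiniteMeasure (areaOn M)] {ω : LInfty M}
    (hω : ∀ᵐ q ∂areaOn M, |ω q| ≤ 1) : ω ∈ phaseSpace M := by
  have := Lp.norm_le_of_ae_bound (f := ω) zero_le_one hω
  simpa [phaseSpace] using this

lemma integrable_of_mem_LInfty [IsFiniteMeasure (areaOn M)] (ω : LInfty M) :
    Integrable ω (areaOn M) :=
  (Lp.memLp ω).integrable le_top

variable [DiscreteTopology Λ]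

/-- Almost everywhere, an area-preserving diffeomorphism agrees with a measurable map preserving
the area measure. -/
lemma exists_measurePreserving_ae_eq (hM : IsBoundedDomain M) {φ : Surface Λ → Surface Λ}
    (hφ : φ ∈ areaPreservingDiffeos M) :
    ∃ ψ, MeasurePreserving ψ (areaOn M) (areaOn M) ∧ φ =ᵐ[areaOn M] ψ := by
  classical
  obtain ⟨Φ, -, hΦ, -, hφ⟩ := hφ
  obtain ⟨⟨χ, -, -, -, hs, -⟩, harea⟩ := hΦ 1 (by simp)
  -- The values of `φ` outside `M` are arbitrary. Keeping the diffeomorphism on the open interior,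
  -- where it is continuous, and the identity elsewhere gives a measurable map.
  set ψ := (interior M).piecewise (Φ 1) id with hψ
  have hIm : MeasurableSet (interior M) := isOpen_interior.measurableSet
  have hψm : Measurable ψ :=
    hs.continuousOn_interior.measurable_piecewise continuousOn_id hIm
  refine ⟨ψ, ⟨hψm, ?_⟩, ?_⟩
  · ext B hB
    rw [Measure.map_apply hψm hB, areaOn, Measure.restrict_apply (hψm hB),
      Measure.restrict_apply hB, inter_comm, area_inter_eq_area_inter_interior hM, inter_comm B M,
      ← harea B hB, area_inter_eq_area_inter_interior hM]
    congr 1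
    ext q
    refine and_congr_right fun hq => ?_
    rw [mem_preimage, mem_preimage, hψ, piecewise_eq_of_mem _ _ _ hq]
  · rw [areaOn_eq_restrict_interior hM]
    filter_upwards [ae_restrict_mem hIm] with q hq
    rw [hψ, piecewise_eq_of_mem _ _ _ hq]
    exact (hφ (interior_subset hq)).symm

/-- Weak-* limits of the orbit are images under bistochastic operators. -/
lemma exists_isBistochastic_of_mem_weakStarClosure (hM : IsBoundedDomain M) {ω₀ ω : LInfty M}
    (hω₀ : ω₀ ∈ phaseSpace M) (hω : ω ∈ weakStarClosure M (orbit M ω₀)) :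
    ∃ K : Kernel (Surface Λ) (Surface Λ), IsBistochastic M K ∧
      ω =ᵐ[areaOn M] fun x => ∫ y, ω₀ y ∂(K x) := by
  classical
  have := isFiniteMeasure_areaOn hM
  set μ := areaOn M with hμ
  obtain ⟨u, hu, huω⟩ := (@mem_closure_iff_ultrafilter (LInfty M) ω (orbit M ω₀) (weakStar M)).1 hω
  rw [nhds_induced, ← tendsto_iff_comap, tendsto_pi_nhds] at huω
  -- The ultrafilter lives on all of `L^∞` but contains the orbit, so the identity can serve as a
  -- dummy map for the other `θ`.
  have hex : ∀ θ : LInfty M, ∃ ψ : Surface Λ → Surface Λ, MeasurePreserving ψ μ μ ∧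
      (θ ∈ orbit M ω₀ → θ =ᵐ[μ] fun x => ω₀ (ψ x)) := by
    intro θ
    by_cases hθ : θ ∈ orbit M ω₀
    · obtain ⟨φ, hφ, hθφ⟩ := hθ
      obtain ⟨ψ, hψ, hφψ⟩ := exists_measurePreserving_ae_eq hM hφ
      refine ⟨ψ, hψ, fun _ => ?_⟩
      filter_upwards [hθφ, hφψ] with q h1 h2
      rw [h1, h2]
    · exact ⟨id, MeasurePreserving.id _, fun h => absurd h hθ⟩
  choose ψ hψ hψo using hex
  have hω₀b := ae_abs_le_one_of_mem_phaseSpace hω₀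
  -- That `ω` lies in the unit ball is not yet known; any common bound suffices, and the kernel
  -- representation yields the bound one afterwards.
  set C := max 1 ‖ω‖
  have hωb : ∀ᵐ q ∂μ, |ω q| ≤ C := by
    filter_upwards [ae_le_eLpNormEssSup (f := ω) (μ := μ)] with q hq
    rw [← eLpNorm_exponent_top, ← ofReal_norm,
      ENNReal.ofReal_le_iff_le_toReal (Lp.eLpNorm_ne_top ω), ← Lp.norm_def] at hq
    exact hq.trans (le_max_right _ _)
  obtain ⟨K, hK1, hK2, hK3⟩ := exists_invariant_kernel_of_tendsto (μ := μ) u hψ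
    (integrable_of_mem_LInfty ω) (integrable_of_mem_LInfty ω₀) hωb
    (hω₀b.mono fun q hq => hq.trans (le_max_left _ _)) (fun g => by
      have hg : MemLp g 1 μ := memLp_one_iff_integrable.2 (g.integrable μ)
      have h1 : Tendsto (fun θ : LInfty M => ∫ x, hg.toLp g x * θ x ∂μ) u
        (𝓝 (∫ x, hg.toLp g x * ω x ∂μ)) := huω (hg.toLp g)
      have h2 : ∀ θ : LInfty M, ∫ x, hg.toLp g x * θ x ∂μ = ∫ x, g x * θ x ∂μ := fun θ =>
        integral_congr_ae (hg.coeFn_toLp.mul (ae_eq_refl θ))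
      simp only [h2] at h1
      refine h1.congr' ?_
      filter_upwards [hu] with θ hθ
      refine integral_congr_ae ?_
      filter_upwards [hψo θ hθ] with q hq
      rw [hq])
  exact ⟨K, ⟨hK1, hK2⟩, hK3⟩

/-- Fields majorized by `ω₀` are weak-* limits of the orbit of `ω₀`. -/
lemma mem_weakStarClosure_of_majorized (hM : IsBoundedDomain M) {ω₀ ω : LInfty M}
    (hω₀ : ω₀ ∈ phaseSpace M) (hω : ω ∈ phaseSpace M)
    (hint : ∫ q, ω q ∂areaOn M = ∫ q, ω₀ q ∂areaOn M)
    (hmaj : ∀ c, ∫ q, max (ω q - c) 0 ∂areaOn M ≤ ∫ q, max (ω₀ q - c) 0 ∂areaOn M) :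
    ω ∈ weakStarClosure M (orbit M ω₀) := by
  have := isFiniteMeasure_areaOn hM
  -- Membership in the weak-* closure becomes membership in a closure for the product topology,
  -- whose basic neighbourhoods constrain finitely many test functions.
  refine closure_induced.2 ?_
  have hbasis := hasBasis_pi fun g : Lp ℝ 1 (areaOn M) =>
    Metric.nhds_basis_closedBall (x := ∫ x, g x * ω x ∂(areaOn M))
  rw [← nhds_pi] at hbasis
  refine (mem_closure_iff_nhds_basis hbasis).2 ?_
  rintro ⟨I, r⟩ ⟨hI, hr⟩
  obtain ⟨η, hηr, hη⟩ : ∃ η : ℝ, (∀ g ∈ I, η < r g) ∧ 0 < η := by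
    have h1 : ∀ᶠ η in 𝓝[>] (0 : ℝ), ∀ g ∈ I, η < r g :=
      hI.eventually_all.2 fun g hg => nhdsWithin_le_nhds (gt_mem_nhds (hr g hg))
    exact (h1.and self_mem_nhdsWithin).exists
  have : Finite I := hI
  obtain ⟨φ, hφ, hφg⟩ := exists_isotopic_approx hM (integrable_of_mem_LInfty ω)
    (integrable_of_mem_LInfty ω₀) (ae_abs_le_one_of_mem_phaseSpace hω)
    (ae_abs_le_one_of_mem_phaseSpace hω₀) hint hmaj (J := I)
    (g := fun g => (g : Lp ℝ 1 (areaOn M))) (fun g => L1.integrable_coeFn _) hη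
  have hφm := hφ.measurePreserving hM
  have hcoe := Lp.coeFn_compMeasurePreserving ω₀ hφm
  refine ⟨_, mem_image_of_mem _ ⟨φ, hφ.mem_areaPreservingDiffeos hM, hcoe⟩, fun g hg => ?_⟩
  rw [Metric.mem_closedBall, Real.dist_eq]
  have h1 : ∫ x, g x * Lp.compMeasurePreserving φ hφm ω₀ x ∂areaOn M =
      ∫ x, g x * ω₀ (φ x) ∂areaOn M := by
    refine integral_congr_ae ?_
    filter_upwards [hcoe] with q hq
    rw [hq, Function.comp_apply]
  dsimp only
  rw [h1]
  exact (hφg ⟨g, hg⟩).trans (hηr g hg).le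

lemma convexOn_max_sub_zero (c : ℝ) : ConvexOn ℝ univ fun x : ℝ => max (x - c) 0 :=
  ((convexOn_id convex_univ).sub (concaveOn_const c convex_univ)).sup
    (convexOn_const 0 convex_univ)

end Orbits

end FlatFluid

/-! ### The equality of the four sets. -/

theorem proposition4p1 (Λ : AddSubgroup FlatFluid.Plane) [DiscreteTopology Λ]
    (M : Set (FlatFluid.Surface Λ)) (hM : FlatFluid.IsBoundedDomain M)
    (ω₀ : FlatFluid.LInfty M) (hω₀ : ω₀ ∈ FlatFluid.phaseSpace M) :
    FlatFluid.weakStarClosure M (FlatFluid.orbit M ω₀) =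
        {ω | ω ∈ FlatFluid.phaseSpace M ∧
          ∃ K : Kernel (FlatFluid.Surface Λ) (FlatFluid.Surface Λ),
            FlatFluid.IsBistochastic M K ∧
            ω =ᵐ[FlatFluid.areaOn M] fun x => ∫ y, ω₀ y ∂(K x)} ∧
    FlatFluid.weakStarClosure M (FlatFluid.orbit M ω₀) =
        {ω | ω ∈ FlatFluid.phaseSpace M ∧
          ∫ x, ω x ∂(FlatFluid.areaOn M) = ∫ x, ω₀ x ∂(FlatFluid.areaOn M) ∧
          ∀ c : ℝ, ∫ x, max (ω x - c) 0 ∂(FlatFluid.areaOn M) ≤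
            ∫ x, max (ω₀ x - c) 0 ∂(FlatFluid.areaOn M)} ∧
    FlatFluid.weakStarClosure M (FlatFluid.orbit M ω₀) =
        {ω | ω ∈ FlatFluid.phaseSpace M ∧
          ∫ x, ω x ∂(FlatFluid.areaOn M) = ∫ x, ω₀ x ∂(FlatFluid.areaOn M) ∧
          ∀ f : ℝ → ℝ, ConvexOn ℝ univ f →
            ∫ x, f (ω x) ∂(FlatFluid.areaOn M) ≤ ∫ x, f (ω₀ x) ∂(FlatFluid.areaOn M)} := by
  have := FlatFluid.isFiniteMeasure_areaOn hM
  have hω₀i := FlatFluid.integrable_of_mem_LInfty ω₀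
  have hω₀b := FlatFluid.ae_abs_le_one_of_mem_phaseSpace hω₀
  have hCB : ∀ ω ∈ FlatFluid.weakStarClosure M (FlatFluid.orbit M ω₀), ω ∈ FlatFluid.phaseSpace M ∧
      ∃ K : Kernel (FlatFluid.Surface Λ) (FlatFluid.Surface Λ), FlatFluid.IsBistochastic M K ∧
        ω =ᵐ[FlatFluid.areaOn M] fun x => ∫ y, ω₀ y ∂(K x) := by
    intro ω hω
    obtain ⟨K, ⟨hK1, hK2⟩, hK⟩ :=
      FlatFluid.exists_isBistochastic_of_mem_weakStarClosure hM hω₀ hω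
    refine ⟨FlatFluid.mem_phaseSpace_of_ae_abs_le_one ?_, K, ⟨hK1, hK2⟩, hK⟩
    filter_upwards [hK, FlatFluid.ae_abs_integral_le_of_invariant hK2 hω₀b] with q h1 h2
    rwa [h1]
  have hBV : ∀ ω : FlatFluid.LInfty M,
      (∃ K : Kernel (FlatFluid.Surface Λ) (FlatFluid.Surface Λ), FlatFluid.IsBistochastic M K ∧
        ω =ᵐ[FlatFluid.areaOn M] fun x => ∫ y, ω₀ y ∂(K x)) →
      ∫ x, ω x ∂(FlatFluid.areaOn M) = ∫ x, ω₀ x ∂(FlatFluid.areaOn M) ∧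
      ∀ f : ℝ → ℝ, ConvexOn ℝ univ f →
        ∫ x, f (ω x) ∂(FlatFluid.areaOn M) ≤ ∫ x, f (ω₀ x) ∂(FlatFluid.areaOn M) := by
    rintro ω ⟨K, ⟨hK1, hK2⟩, hK⟩
    refine ⟨?_, fun f hf => ?_⟩
    · rw [integral_congr_ae hK]
      exact (FlatFluid.integral_integral_of_invariant hK2 hω₀i).2
    · exact (integral_congr_ae (hK.fun_comp f)).trans_le
        (FlatFluid.integral_convex_kernel_le hK2 hω₀i hω₀b hf)
  -- All inclusions follow from three facts: limits are bistochastic images (`hCB`), these satisfy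
  -- the convex inequalities (`hBV`), and the inequalities for the convex functions `max (x - c) 0`
  -- already imply membership in the closure.
  refine ⟨Subset.antisymm hCB ?_, Subset.antisymm ?_ ?_, Subset.antisymm ?_ ?_⟩
  · rintro ω ⟨hω, hK⟩
    obtain ⟨h1, h2⟩ := hBV ω hK
    exact FlatFluid.mem_weakStarClosure_of_majorized hM hω₀ hω h1 fun c =>
      h2 _ (FlatFluid.convexOn_max_sub_zero c)
  · intro ω hω
    obtain ⟨h1, hK⟩ := hCB ω hω
    obtain ⟨h2, h3⟩ := hBV ω hK
    exact ⟨h1, h2, fun c => h3 _ (FlatFluid.convexOn_max_sub_zero c)⟩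
  · rintro ω ⟨hω, h1, h2⟩
    exact FlatFluid.mem_weakStarClosure_of_majorized hM hω₀ hω h1 h2
  · intro ω hω
    obtain ⟨h1, hK⟩ := hCB ω hω
    exact ⟨h1, hBV ω hK⟩
  · rintro ω ⟨hω, h1, h2⟩
    exact FlatFluid.mem_weakStarClosure_of_majorized hM hω₀ hω h1 fun c =>
      h2 _ (FlatFluid.convexOn_max_sub_zero c)
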